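/- \textbf{Setting.} Let $(\Omega,\mathcal F)$ be a measurable space and $\mathcal H$ a set of real random variables on it that contains every indicator $I_A$, $A\in\mathcal F$, and is closed under $(X_1,\dots,X_n)\mapsto\varphi(X_1,\dots,X_n)$ for all $\varphi:\mathbb R^n\to\mathbb R$ with $|\varphi(x)-\varphi(y)|\le C(1+|x|^m+|y|^m)|x-y|$ for some $C>0$, $m\in\mathbb N$. Let $\mathbb E:\mathcal H\to[-\infty,\infty]$ be a sublinear expectation, i.e. for all $X,Y\in\mathcal H$, $c\in\mathbb R$ and $\lambda\ge 0$: $X\ge Y$ implies $\mathbb E[X]\ge\mathbb E[Y]$; $\mathbb E[c]=c$; $\mathbb E[\lambda X]=\lambda\mathbb E[X]$; and $\mathbb E[X+Y]\le\mathbb E[X]+\mathbb E[Y]$ whenever the right-hand side is not of the form $\infty-\infty$. Assume that $\mathbb E$ is countably sub-additive: $\mathbb E[X]\le\sum_n\mathbb E[X_n]$ whenever $0\le X\le\sum_n X_n$ with $X,X_n\in\mathcal H$, $X_n\ge0$. Put $\mathbb V(A)=\inf\{\mathbb E[\xi]: I_A\le\xi,\ \xi\in\mathcal H\}$ and $C_{\mathbb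 V}(X)=\int_0^\infty \mathbb V(X>x)\,dx+\int_{-\infty}^0(\mathbb V(X>x)-1)\,dx$. A random vector $\mathbf Y$ with components in $\mathcal H$ is independent of such a vector $\mathbf X$ if $\mathbb E[\psi(\mathbf X,\mathbf Y)]=\mathbb E\big[\mathbb E[\psi(x,\mathbf Y)]|_{x=\mathbf X}\big]$ for every Borel function $\psi$ for which all random variables whose expectations occur belong to $\mathcal H$, $\bar\psi(x)=\mathbb E|\psi(x,\mathbf Y)|<\infty$ for all $x$, $\bar\psi(\mathbf X)\in\mathcal H$ and $\mathbb E[\bar\psi(\mathbf X)]<\infty$. A sequence $X_0,X_1,\dots$ is independent if $X_{n+1}$ is independent of $(X_0,\dots,X_n)$ for every $n\ge0$. Two random variables $X,Y\in\mathcal H$ are identically distributed if $\mathbb E[\psi(X)]=\mathbb E[\psi(Y)]$ for every Borel $\psi$ with $\psi(X),\psi(Y)\in\mathcal H$ for which both expectations are finite. Let $A_0^{a}=1$ and $A_n^{a}=(a+1)(a+2)\cdots(a+n)/n!$ for $n\ge1$. \textbf{Theorem.} Let $0<\alpha\le1$ and $r\ge1$. Let $\{X_n, n\ge0\}\subset\mathcal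 H$ be a sequence of independent random variables, each identically distributed as $X\in\mathcal H$, with $\mathbb E(X_i)=-\mathbb E(-X_i)=0$ for all $i$. Consider the conditions $$\text{(M)}\quad\begin{cases} C_{\mathbb V}\big(|X|^{(r-1)/\alpha}\big)<\infty, & 0<\alpha<1-1/r,\\ C_{\mathbb V}\big(|X|^{r}\ln(1+|X|)\big)<\infty, & \alpha=1-1/r,\\ C_{\mathbb V}\big(|X|^{r}\big)<\infty, & \alpha>1-1/r,\end{cases}$$ $$\text{(CM)}\quad \sum_{n=1}^\infty n^{r-2}\,\mathbb E\Big[\Big(\max_{0\le j\le n}\Big|\sum_{i=0}^{j}A_{n-i}^{\alpha-1}X_i/A_n^{\alpha}\Big|-\varepsilon\Big)^{+}\Big]<\infty\quad\text{for all }\varepsilon>0,$$ $$\text{(CC)}\quad \sum_{n=1}^\infty n^{r-2}\,\mathbb V\Big(\max_{0\le j\le n}\Big|\sum_{i=0}^{j}A_{n-i}^{\alpha-1}X_i/A_n^{\alpha}\Big|>\varepsilon\Big)<\infty\quad\text{for all }\varepsilon>0.$$ Then (M) implies (CC) and, if $r>1$, (M) also implies (CM). Conversely, (CM) implies (M). 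-/

import Mathlib

open MeasureTheory Set
open scoped ENNReal

/-- The class `C_{l,Lip}(ℝⁿ)` of functions with
`|φ x - φ y| ≤ C (1 + |x|^m + |y|^m) |x - y|`. All norms on `ℝⁿ` give the same class. -/
def LocLip {n : ℕ} (φ : (Fin n → ℝ) → ℝ) : Prop :=
  ∃ C : ℝ, 0 < C ∧ ∃ m : ℕ, ∀ x y : Fin n → ℝ,
    |φ x - φ y| ≤ C * (1 + ‖x‖ ^ m + ‖y‖ ^ m) * ‖x - y‖

/-- A sublinear expectation space `(Ω, H, E)` over the measurable space `Ω`.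
The functional `E` is only meaningful (and only constrained) on `H`. -/
structure SublinearExpectationSpace (Ω : Type*) [MeasurableSpace Ω] where
  /-- the space of random variables -/
  H : Set (Ω → ℝ)
  measurable_of_mem : ∀ X ∈ H, Measurable X
  indicator_mem : ∀ A : Set Ω, MeasurableSet A → A.indicator (fun _ => (1 : ℝ)) ∈ H
  comp_mem : ∀ (n : ℕ) (φ : (Fin n → ℝ) → ℝ), LocLip φ →
    ∀ X : Fin n → Ω → ℝ, (∀ i, X i ∈ H) → (fun ω => φ (fun i => X i ω)) ∈ H
  /-- the sublinear expectation -/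
  E : (Ω → ℝ) → EReal
  mono : ∀ X ∈ H, ∀ Y ∈ H, (∀ ω, Y ω ≤ X ω) → E Y ≤ E X
  const : ∀ c : ℝ, E (fun _ => c) = (c : EReal)
  pos_homog : ∀ X ∈ H, ∀ c : ℝ, 0 ≤ c → E (fun ω => c * X ω) = (c : EReal) * E X
  subadd : ∀ X ∈ H, ∀ Y ∈ H, ¬ (E X = ⊤ ∧ E Y = ⊥) → ¬ (E X = ⊥ ∧ E Y = ⊤) →
    E (fun ω => X ω + Y ω) ≤ E X + E Y

namespace SublinearExpectationSpace

variable {Ω : Type*} [MeasurableSpace Ω] (S : SublinearExpectationSpace Ω)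

/-- `E[ξ]` for `ξ ≥ 0`, as an element of `[0, ∞]`. -/
noncomputable def expNonneg (ξ : Ω → ℝ) : ℝ≥0∞ := (S.E ξ).toENNReal

/-- Countable sub-additivity: `E[X] ≤ ∑ E[Xₙ]` whenever `X ≤ ∑ Xₙ` with `X, Xₙ ≥ 0` in `H`.
The pointwise sums `∑ Xₙ(ω)` may be infinite. -/
def CountablySubadditive : Prop :=
  ∀ X ∈ S.H, ∀ Y : ℕ → Ω → ℝ, (∀ n, Y n ∈ S.H) → (∀ ω, 0 ≤ X ω) → (∀ n ω, 0 ≤ Y n ω) →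
    (∀ ω, ENNReal.ofReal (X ω) ≤ ∑' n, ENNReal.ofReal (Y n ω)) →
    S.expNonneg X ≤ ∑' n, S.expNonneg (Y n)

/-- The capacity `V(A) = inf {E[ξ] : I_A ≤ ξ, ξ ∈ H}`. -/
noncomputable def capacity (A : Set Ω) : ℝ≥0∞ :=
  (sInf {e : EReal | ∃ ξ ∈ S.H, (∀ ω, A.indicator (fun _ => (1 : ℝ)) ω ≤ ξ ω) ∧ e = S.E ξ}).toENNReal

/-- The Choquet expectation
`C_V(X) = ∫_0^∞ V(X > x) dx + ∫_{-∞}^0 (V(X > x) - 1) dx`. -/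
noncomputable def choquet (X : Ω → ℝ) : EReal :=
  ((∫⁻ x in Ioi (0 : ℝ), S.capacity {ω | x < X ω} : ℝ≥0∞) : EReal)
    - ((∫⁻ x in Iio (0 : ℝ), (1 - S.capacity {ω | x < X ω}) : ℝ≥0∞) : EReal)

/-- The random vector `Y` is independent of the random vector `X`:
`E[ψ(X, Y)] = E[E[ψ(x, Y)]|_{x = X}]` for every Borel function `ψ` for which the expressions
that occur are expectations of members of `H` and `E|ψ(x, Y)|` and
`E[E|ψ(x, Y)| |_{x = X}]` are finite. -/
def IndepOf {m n : ℕ} (Y : Fin n → Ω → ℝ) (X : Fin m → Ω → ℝ) : Prop :=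
  ∀ ψ : (Fin m → ℝ) → (Fin n → ℝ) → ℝ,
    Measurable (fun p : (Fin m → ℝ) × (Fin n → ℝ) => ψ p.1 p.2) →
    (fun ω => ψ (fun i => X i ω) (fun j => Y j ω)) ∈ S.H →
    (∀ x, (fun ω => ψ x (fun j => Y j ω)) ∈ S.H) →
    (∀ x, S.E (fun ω => |ψ x (fun j => Y j ω)|) < ⊤) →
    (fun ω => (S.E (fun ω' => |ψ (fun i => X i ω) (fun j => Y j ω')|)).toReal) ∈ S.H →
    S.E (fun ω => (S.E (fun ω' => |ψ (fun i => X i ω) (fun j => Y j ω')|)).toReal) < ⊤ →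
    (fun ω => (S.E (fun ω' => ψ (fun i => X i ω) (fun j => Y j ω'))).toReal) ∈ S.H →
    S.E (fun ω => ψ (fun i => X i ω) (fun j => Y j ω))
      = S.E (fun ω => (S.E (fun ω' => ψ (fun i => X i ω) (fun j => Y j ω'))).toReal)

/-- `X 0, X 1, …` is a sequence of independent random variables: `X (n+1)` is independent of
`(X 0, …, X n)` for every `n`. -/
def IndepSeq (X : ℕ → Ω → ℝ) : Prop :=
  ∀ n : ℕ, S.IndepOf (fun _ : Fin 1 => X (n + 1)) (fun i : Fin (n + 1) => X i)

/-- `X` and `Y` are identically distributed. -/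
def IdentDist (X Y : Ω → ℝ) : Prop :=
  ∀ ψ : ℝ → ℝ, Measurable ψ → (fun ω => ψ (X ω)) ∈ S.H → (fun ω => ψ (Y ω)) ∈ S.H →
    S.E (fun ω => ψ (X ω)) ≠ ⊤ → S.E (fun ω => ψ (X ω)) ≠ ⊥ →
    S.E (fun ω => ψ (Y ω)) ≠ ⊤ → S.E (fun ω => ψ (Y ω)) ≠ ⊥ →
    S.E (fun ω => ψ (X ω)) = S.E (fun ω => ψ (Y ω))

/-- The three-case moment condition on `X`. -/
def MomentCondition (α r : ℝ) (X : Ω → ℝ) : Prop :=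
  (α < 1 - 1 / r → S.choquet (fun ω => |X ω| ^ ((r - 1) / α)) < ⊤) ∧
  (α = 1 - 1 / r → S.choquet (fun ω => |X ω| ^ r * Real.log (1 + |X ω|)) < ⊤) ∧
  (1 - 1 / r < α → S.choquet (fun ω => |X ω| ^ r) < ⊤)

end SublinearExpectationSpace

/-- The Cesàro numbers `A_n^a = (a+1)(a+2)⋯(a+n) / n!`, `A_0^a = 1`. -/
noncomputable def cesaro (a : ℝ) (n : ℕ) : ℝ :=
  (∏ k ∈ Finset.range n, (a + ((k : ℝ) + 1))) / (n.factorial : ℝ)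

/-- `max_{0 ≤ j ≤ n} |∑_{i=0}^j A_{n-i}^{α-1} X_i / A_n^α|`. -/
noncomputable def maxCesaroSum {Ω : Type*} (α : ℝ) (X : ℕ → Ω → ℝ) (n : ℕ) (ω : Ω) : ℝ :=
  (Finset.range (n + 1)).sup' Finset.nonempty_range_add_one
    (fun j => |∑ i ∈ Finset.range (j + 1), cesaro (α - 1) (n - i) * X i ω / cesaro α n|)

namespace SublinearExpectationSpace

variable {Ω : Type*} [MeasurableSpace Ω] (S : SublinearExpectationSpace Ω)

/-- `∑_{n ≥ 1} n^{r-2} E[(M_n - ε)⁺] < ∞` for all `ε > 0`. -/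
def CompleteMomentConvergence (r : ℝ) (M : ℕ → Ω → ℝ) : Prop :=
  ∀ ε : ℝ, 0 < ε →
    ∑' n : ℕ, ENNReal.ofReal (((n + 1 : ℕ) : ℝ) ^ (r - 2)) *
      S.expNonneg (fun ω => max (M (n + 1) ω - ε) 0) < ⊤

/-- `∑_{n ≥ 1} n^{r-2} V(M_n > ε) < ∞` for all `ε > 0`. -/
def CompleteConvergence (r : ℝ) (M : ℕ → Ω → ℝ) : Prop :=
  ∀ ε : ℝ, 0 < ε →
    ∑' n : ℕ, ENNReal.ofReal (((n + 1 : ℕ) : ℝ) ^ (r - 2)) *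
      S.capacity {ω | ε < M (n + 1) ω} < ⊤

end SublinearExpectationSpace

/-!
Write `v(t) = 𝕍(|X| > t)` and let `a_{ni} = A_{n-i}^{α-1} / A_n^α` be the Cesàro weights. They are
positive, sum to one, and `1 / a_{ni}` is comparable to `k^{1-α} n^α` with `k = n - i + 1`
(`cesaroWeight_le`, `le_cesaroWeight`). Everything is governed by the series
`∑ₙ n^{r-2} ∑ᵢ v(ε / a_{ni})`.

*Counting.* The total weight `∑ n^{r-2}` of the pairs `(n, k)` with `k^{1-α} n^α ≤ t` has exactly
the order of the function `Φ(t)` whose Choquet expectation occurs in the moment condition; the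
three cases reflect whether the sum over `k` converges, diverges logarithmically or diverges like a
power (`exists_tsum_indexWeight_le`, `exists_momentFun_le`). Cutting `v` into its level sets turns
this pointwise comparison into a comparison of `C_𝕍(Φ(|X|))` with the series
(`tsum_mul_le_lintegral`, `lintegral_le_tsum_mul`). Linearity of a Choquet integral is never needed.

*Necessity.* By Markov's inequality complete moment convergence gives complete convergence. If the
maximum is at most `ε`, then `a_{ni} |X_i| ≤ 2 ε` for all `i`, and for independent events
`1 - 𝕍(⋃ Aᵢ) ≤ exp (-∑ 𝕍(Aᵢ))`. Monotonicity of the scales along dyadic blocks shows that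
`∑ᵢ v(ε / a_{ni})` is eventually small, hence at most twice the capacity of the union,
and the series converges (`momentCondition_of_completeConvergence`).

*Sufficiency.* Truncate `a_{ni} X_i` at a level `y` proportional to `x`. Ville's maximal inequality
(`IndepSeq.capacity_prod_le`), proved with a stopped product of exponentials, yields a Fuk-Nagaev
bound for `𝕍(max > x)`: the single terms `∑ v(y / a_{ni})` plus an arbitrary power of the truncated
variance `B / y²` (`IndepSeq.capacity_maxCesaroSum_le`). The means of the truncated variables are
small because `∑ₘ v(m) < ∞` and `a_{ni} = O(n^{-α})`. If `r > 1`, a weak moment of order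
`p ∈ (1, 2)` gives `B / y² = O(n^{-α(p-1)} y^{-p})`, and a high power of it is summable; summing
over the levels `x = 2ʲ ε` bounds the expectation of `(max - ε)⁺`. If `r = 1`, the first power of `B` is
summable by the counting estimate.

Countable sub-additivity enters through layer decompositions, which bound expectations by series of
values of `v`; since indicators belong to the space of random variables, `v` is the same for all
`X_i`, and no integrability of powers of `|X|` has to be discussed.
-/

namespace SublinearExpectationSpace

theorem indicator_one_nonneg {Ω : Type*} (A : Set Ω) (ω : Ω) :
    0 ≤ A.indicator (fun _ => (1 : ℝ)) ω :=
  Set.indicator_nonneg (fun _ _ => zero_le_one) ω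

variable {Ω : Type*} [MeasurableSpace Ω] (S : SublinearExpectationSpace Ω)

/-! ### Closure properties of the space of random variables -/

/-- Stability under Lipschitz maps, the case `m = 0` of the closure axiom. -/
theorem lip_mem {φ : ℝ → ℝ} {K : ℝ} (hφ : ∀ x y, |φ x - φ y| ≤ K * |x - y|)
    {X : Ω → ℝ} (hX : X ∈ S.H) : (fun ω => φ (X ω)) ∈ S.H := by
  refine S.comp_mem 1 (fun x => φ (x 0)) ⟨|K| + 1, by positivity, 0, fun x y => ?_⟩
    (fun _ => X) (fun _ => hX)
  have h1 : |x 0 - y 0| ≤ ‖x - y‖ := by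
    simpa using norm_le_pi_norm (x - y) 0
  calc |φ (x 0) - φ (y 0)| ≤ K * |x 0 - y 0| := hφ _ _
    _ ≤ (|K| + 1) * 3 * ‖x - y‖ := by
        have := le_abs_self K
        have h0 := abs_nonneg (x 0 - y 0)
        have hK := abs_nonneg K
        calc K * |x 0 - y 0| ≤ ((|K| + 1) * 3) * |x 0 - y 0| := by
              apply mul_le_mul_of_nonneg_right _ h0
              linarith
          _ ≤ _ := by
              apply mul_le_mul_of_nonneg_left h1
              positivity
    _ = _ := by norm_num

theorem lip_mem₂ {φ : ℝ → ℝ → ℝ} {K : ℝ} (hK : 0 ≤ K)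
    (hφ : ∀ a b c d, |φ a b - φ c d| ≤ K * (|a - c| + |b - d|))
    {X Y : Ω → ℝ} (hX : X ∈ S.H) (hY : Y ∈ S.H) : (fun ω => φ (X ω) (Y ω)) ∈ S.H := by
  have := S.comp_mem 2 (fun x => φ (x 0) (x 1)) ⟨K + 1, by positivity, 0, fun x y => ?_⟩
    ![X, Y] (fun i => by fin_cases i <;> simpa)
  · simpa using this
  have h1 : |x 0 - y 0| ≤ ‖x - y‖ := by simpa using norm_le_pi_norm (x - y) 0
  have h2 : |x 1 - y 1| ≤ ‖x - y‖ := by simpa using norm_le_pi_norm (x - y) 1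
  have h0 := norm_nonneg (x - y)
  calc |φ (x 0) (x 1) - φ (y 0) (y 1)| ≤ K * (|x 0 - y 0| + |x 1 - y 1|) := hφ _ _ _ _
    _ ≤ K * (‖x - y‖ + ‖x - y‖) := by gcongr
    _ ≤ (K + 1) * (1 + ‖x‖ ^ 0 + ‖y‖ ^ 0) * ‖x - y‖ := by
        simp only [pow_zero]
        nlinarith

theorem const_mem (c : ℝ) : (fun _ => c) ∈ S.H :=
  S.comp_mem 0 (fun _ => c) ⟨1, one_pos, 0, fun x y => by simp; positivity⟩
    (fun _ _ => 0) (fun i => i.elim0)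

theorem add_mem {X Y : Ω → ℝ} (hX : X ∈ S.H) (hY : Y ∈ S.H) : (fun ω => X ω + Y ω) ∈ S.H :=
  S.lip_mem₂ (φ := fun a b => a + b) zero_le_one (fun a b c d => by
    rw [one_mul, show a + b - (c + d) = (a - c) + (b - d) by ring]
    exact abs_add_le _ _) hX hY

/-- The product is locally Lipschitz of polynomial growth, so the space is an algebra. -/
theorem mul_mem {X Y : Ω → ℝ} (hX : X ∈ S.H) (hY : Y ∈ S.H) : (fun ω => X ω * Y ω) ∈ S.H := by
  have := S.comp_mem 2 (fun x => x 0 * x 1) ⟨1, one_pos, 1, fun x y => ?_⟩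
    ![X, Y] (fun i => by fin_cases i <;> simpa)
  · simpa using this
  have h1 : |x 0 - y 0| ≤ ‖x - y‖ := by simpa using norm_le_pi_norm (x - y) 0
  have h2 : |x 1 - y 1| ≤ ‖x - y‖ := by simpa using norm_le_pi_norm (x - y) 1
  have h3 : |x 0| ≤ ‖x‖ := by simpa using norm_le_pi_norm x 0
  have h4 : |y 1| ≤ ‖y‖ := by simpa using norm_le_pi_norm y 1
  have h0 := norm_nonneg (x - y)
  calc |x 0 * x 1 - y 0 * y 1| = |x 0 * (x 1 - y 1) + y 1 * (x 0 - y 0)| := by ring_nf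
    _ ≤ |x 0| * |x 1 - y 1| + |y 1| * |x 0 - y 0| := by
        rw [← abs_mul, ← abs_mul]; exact abs_add_le _ _
    _ ≤ ‖x‖ * ‖x - y‖ + ‖y‖ * ‖x - y‖ := by gcongr
    _ ≤ 1 * (1 + ‖x‖ ^ 1 + ‖y‖ ^ 1) * ‖x - y‖ := by
        simp only [pow_one]
        nlinarith

theorem const_mul_mem (c : ℝ) {X : Ω → ℝ} (hX : X ∈ S.H) : (fun ω => c * X ω) ∈ S.H :=
  S.mul_mem (S.const_mem c) hX

theorem abs_mem {X : Ω → ℝ} (hX : X ∈ S.H) : (fun ω => |X ω|) ∈ S.H :=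
  S.lip_mem (φ := fun x => |x|) (K := 1)
    (fun x y => by simpa using abs_abs_sub_abs_le_abs_sub x y) hX

theorem max_mem {X Y : Ω → ℝ} (hX : X ∈ S.H) (hY : Y ∈ S.H) :
    (fun ω => max (X ω) (Y ω)) ∈ S.H :=
  S.lip_mem₂ (φ := fun a b => max a b) zero_le_one (fun a b c d => by
    rw [one_mul]
    refine (abs_max_sub_max_le_max a b c d).trans ?_
    exact max_le (by linarith [abs_nonneg (b - d)]) (by linarith [abs_nonneg (a - c)])) hX hY

theorem posPart_sub_mem (c : ℝ) {X : Ω → ℝ} (hX : X ∈ S.H) :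
    (fun ω => max (X ω - c) 0) ∈ S.H := by
  have := S.max_mem (S.add_mem hX (S.const_mem (-c))) (S.const_mem 0)
  simpa [sub_eq_add_neg] using this

theorem sum_mem {ι : Type*} (s : Finset ι) {Y : ι → Ω → ℝ} (hY : ∀ i ∈ s, Y i ∈ S.H) :
    (fun ω => ∑ i ∈ s, Y i ω) ∈ S.H := by
  classical
  induction s using Finset.induction_on with
  | empty => simpa using S.const_mem 0
  | insert a s ha ih =>
    simp only [Finset.sum_insert ha]
    exact S.add_mem (hY a (by simp)) (ih fun i hi => hY i (by simp [hi]))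

theorem sup'_mem {ι : Type*} (s : Finset ι) (hs : s.Nonempty) {Y : ι → Ω → ℝ}
    (hY : ∀ i ∈ s, Y i ∈ S.H) : (fun ω => s.sup' hs (fun i => Y i ω)) ∈ S.H := by
  have h : s.sup' hs Y ∈ S.H :=
    Finset.sup'_induction hs Y (p := fun f => f ∈ S.H) (fun a ha b hb => S.max_mem ha hb) hY
  convert h using 1
  ext ω
  rw [Finset.sup'_apply]

theorem ind_mem {A : Set Ω} (hA : MeasurableSet A) : A.indicator (fun _ => (1 : ℝ)) ∈ S.H :=
  S.indicator_mem A hA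

/-! ### The expectation on nonnegative random variables and the capacity -/

theorem E_nonneg {X : Ω → ℝ} (hX : X ∈ S.H) (h0 : ∀ ω, 0 ≤ X ω) : 0 ≤ S.E X := by
  have := S.mono X hX _ (S.const_mem 0) h0
  rwa [S.const 0, EReal.coe_zero] at this

theorem coe_expNonneg {X : Ω → ℝ} (hX : X ∈ S.H) (h0 : ∀ ω, 0 ≤ X ω) :
    ((S.expNonneg X : ℝ≥0∞) : EReal) = S.E X :=
  EReal.coe_toENNReal (S.E_nonneg hX h0)

theorem expNonneg_mono {X Y : Ω → ℝ} (hX : X ∈ S.H) (hY : Y ∈ S.H) (h : ∀ ω, X ω ≤ Y ω) :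
    S.expNonneg X ≤ S.expNonneg Y :=
  EReal.toENNReal_le_toENNReal (S.mono Y hY X hX h)

theorem expNonneg_const (c : ℝ) : S.expNonneg (fun _ => c) = ENNReal.ofReal c := by
  rw [expNonneg, S.const, EReal.toENNReal_of_ne_top (EReal.coe_ne_top c), EReal.toReal_coe]

theorem expNonneg_const_mul {c : ℝ} (hc : 0 ≤ c) {X : Ω → ℝ} (hX : X ∈ S.H) :
    S.expNonneg (fun ω => c * X ω) = ENNReal.ofReal c * S.expNonneg X := by
  rw [expNonneg, S.pos_homog X hX c hc, EReal.toENNReal_mul (by exact_mod_cast hc), expNonneg,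
    EReal.toENNReal_of_ne_top (EReal.coe_ne_top c), EReal.toReal_coe]

theorem expNonneg_add_le {X Y : Ω → ℝ} (hX : X ∈ S.H) (hY : Y ∈ S.H) (hX0 : ∀ ω, 0 ≤ X ω)
    (hY0 : ∀ ω, 0 ≤ Y ω) :
    S.expNonneg (fun ω => X ω + Y ω) ≤ S.expNonneg X + S.expNonneg Y := by
  have hx := S.E_nonneg hX hX0
  have hy := S.E_nonneg hY hY0
  rw [expNonneg, expNonneg, expNonneg, ← EReal.toENNReal_add hx hy]
  refine EReal.toENNReal_le_toENNReal (S.subadd X hX Y hY ?_ ?_)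
  · rintro ⟨-, h⟩; simp [h] at hy
  · rintro ⟨h, -⟩; simp [h] at hx

theorem expNonneg_sum_le {ι : Type*} (s : Finset ι) {Y : ι → Ω → ℝ} (hY : ∀ i ∈ s, Y i ∈ S.H)
    (hY0 : ∀ i ∈ s, ∀ ω, 0 ≤ Y i ω) :
    S.expNonneg (fun ω => ∑ i ∈ s, Y i ω) ≤ ∑ i ∈ s, S.expNonneg (Y i) := by
  classical
  induction s using Finset.induction_on with
  | empty => simp [S.expNonneg_const]
  | insert a s ha ih =>
    simp only [Finset.sum_insert ha]
    have hY' : ∀ i ∈ s, Y i ∈ S.H := fun i hi => hY i (by simp [hi])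
    have hY0' : ∀ i ∈ s, ∀ ω, 0 ≤ Y i ω := fun i hi => hY0 i (by simp [hi])
    refine (S.expNonneg_add_le (hY a (by simp)) (S.sum_mem s hY') (hY0 a (by simp))
      (fun ω => Finset.sum_nonneg fun i hi => hY0' i hi ω)).trans ?_
    gcongr
    exact ih hY' hY0'

/-- The infimum defining the capacity of a measurable set is attained at its indicator. -/
theorem capacity_eq {A : Set Ω} (hA : MeasurableSet A) :
    S.capacity A = S.expNonneg (A.indicator (fun _ => (1 : ℝ))) := by
  rw [capacity, expNonneg]
  congr 1
  apply le_antisymm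
  · exact sInf_le ⟨_, S.ind_mem hA, fun _ => le_rfl, rfl⟩
  · apply le_sInf
    rintro _ ⟨ξ, hξ, h, rfl⟩
    exact S.mono ξ hξ _ (S.ind_mem hA) h

theorem capacity_mono {A B : Set Ω} (h : A ⊆ B) : S.capacity A ≤ S.capacity B := by
  refine EReal.toENNReal_le_toENNReal (sInf_le_sInf ?_)
  rintro _ ⟨ξ, hξ, h', rfl⟩
  exact ⟨ξ, hξ, fun ω => (Set.indicator_le_indicator_of_subset h (fun _ => zero_le_one) ω).trans
    (h' ω), rfl⟩

theorem capacity_univ : S.capacity univ = 1 := by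
  rw [S.capacity_eq MeasurableSet.univ]
  simpa using S.expNonneg_const 1

theorem capacity_le_one (A : Set Ω) : S.capacity A ≤ 1 :=
  (S.capacity_mono (subset_univ A)).trans S.capacity_univ.le

theorem capacity_union_le {A B : Set Ω} (hA : MeasurableSet A) (hB : MeasurableSet B) :
    S.capacity (A ∪ B) ≤ S.capacity A + S.capacity B := by
  rw [S.capacity_eq hA, S.capacity_eq hB, S.capacity_eq (hA.union hB)]
  refine (S.expNonneg_mono (S.ind_mem (hA.union hB)) (S.add_mem (S.ind_mem hA) (S.ind_mem hB))
    fun ω => ?_).trans (S.expNonneg_add_le (S.ind_mem hA) (S.ind_mem hB)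
      (indicator_one_nonneg A) (indicator_one_nonneg B))
  by_cases h1 : ω ∈ A <;> by_cases h2 : ω ∈ B <;> simp [h1, h2]

theorem capacity_biUnion_le {ι : Type*} (s : Finset ι) {A : ι → Set Ω}
    (hA : ∀ i, MeasurableSet (A i)) :
    S.capacity (⋃ i ∈ s, A i) ≤ ∑ i ∈ s, S.capacity (A i) := by
  classical
  induction s using Finset.induction_on with
  | empty =>
    rw [S.capacity_eq (by simp)]
    simpa using (S.expNonneg_const 0).le
  | insert a s ha ih =>
    rw [Finset.set_biUnion_insert, Finset.sum_insert ha]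
    refine (S.capacity_union_le (hA a) (Finset.measurableSet_biUnion s fun i _ => hA i)).trans ?_
    gcongr

/-- Markov's inequality: `c 𝕍(A) ≤ 𝔼[X]` as soon as `c ≤ X` on `A`. -/
theorem mul_capacity_le {c : ℝ} (hc : 0 ≤ c) {X : Ω → ℝ} (hX : X ∈ S.H) (h0 : ∀ ω, 0 ≤ X ω)
    {A : Set Ω} (hA : MeasurableSet A) (h : ∀ ω ∈ A, c ≤ X ω) :
    ENNReal.ofReal c * S.capacity A ≤ S.expNonneg X := by
  rw [S.capacity_eq hA, ← S.expNonneg_const_mul hc (S.ind_mem hA)]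
  refine S.expNonneg_mono (S.const_mul_mem c (S.ind_mem hA)) hX fun ω => ?_
  by_cases h1 : ω ∈ A
  · simpa [h1] using h ω h1
  · simpa [h1] using h0 ω

variable {S} in
/-- Countable sub-additivity along a layer decomposition: a bound of `X` by a weighted sum of
indicators of level sets of `Y` passes to the expectation. -/
theorem CountablySubadditive.expNonneg_le_tsum_capacity (hS : S.CountablySubadditive)
    {X Y : Ω → ℝ} (hX : X ∈ S.H) (hX0 : ∀ ω, 0 ≤ X ω) (hY : Measurable Y) {w s : ℕ → ℝ}
    (hw : ∀ n, 0 ≤ w n)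
    (h : ∀ ω, ENNReal.ofReal (X ω) ≤ ∑' n, ENNReal.ofReal (if s n < Y ω then w n else 0)) :
    S.expNonneg X ≤ ∑' n, ENNReal.ofReal (w n) * S.capacity {ω | s n < Y ω} := by
  have hm : ∀ n, MeasurableSet {ω | s n < Y ω} := fun n => measurableSet_lt measurable_const hY
  have e : ∀ n ω, w n * ({ω | s n < Y ω} : Set Ω).indicator (fun _ => (1 : ℝ)) ω
      = if s n < Y ω then w n else 0 := fun n ω => by
    by_cases h1 : s n < Y ω <;> simp [h1]
  refine (hS X hX (fun n ω => w n * ({ω | s n < Y ω} : Set Ω).indicator (fun _ => (1 : ℝ)) ω)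
    (fun n => S.const_mul_mem _ (S.ind_mem (hm n))) hX0
    (fun n ω => mul_nonneg (hw n) (indicator_one_nonneg _ ω)) ?_).trans_eq ?_
  · simpa only [e] using h
  · exact tsum_congr fun n => by
      rw [S.expNonneg_const_mul (hw n) (S.ind_mem (hm n)), S.capacity_eq (hm n)]

variable {S} in
/-- Identically distributed random variables have the same capacities. -/
theorem IdentDist.capacity_eq {X Y : Ω → ℝ} (h : S.IdentDist X Y) (hX : X ∈ S.H) (hY : Y ∈ S.H)
    {B : Set ℝ} (hB : MeasurableSet B) : S.capacity (X ⁻¹' B) = S.capacity (Y ⁻¹' B) := by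
  have fin : ∀ {Z : Ω → ℝ}, Z ∈ S.H →
      (fun ω => B.indicator (fun _ => (1 : ℝ)) (Z ω)) = (Z ⁻¹' B).indicator (fun _ => (1 : ℝ)) ∧
      (fun ω => B.indicator (fun _ => (1 : ℝ)) (Z ω)) ∈ S.H ∧
      S.E (fun ω => B.indicator (fun _ => (1 : ℝ)) (Z ω)) ≠ ⊤ ∧
      S.E (fun ω => B.indicator (fun _ => (1 : ℝ)) (Z ω)) ≠ ⊥ := by
    intro Z hZ
    have hm : MeasurableSet (Z ⁻¹' B) := S.measurable_of_mem Z hZ hB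
    have e : (fun ω => B.indicator (fun _ => (1 : ℝ)) (Z ω))
        = (Z ⁻¹' B).indicator (fun _ => (1 : ℝ)) := rfl
    refine ⟨e, e ▸ S.ind_mem hm, ?_, ?_⟩ <;> rw [e, ← S.coe_expNonneg (S.ind_mem hm)
      (indicator_one_nonneg _), ← S.capacity_eq hm]
    · simpa using ((S.capacity_le_one _).trans_lt ENNReal.one_lt_top).ne
    · exact EReal.coe_ennreal_ne_bot _
  obtain ⟨e1, m1, t1, b1⟩ := fin hX
  obtain ⟨e2, m2, t2, b2⟩ := fin hY
  have := h (B.indicator (fun _ => (1 : ℝ))) (measurable_const.indicator hB) m1 m2 t1 b1 t2 b2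
  rw [e1, e2] at this
  rw [S.capacity_eq (S.measurable_of_mem X hX hB), S.capacity_eq (S.measurable_of_mem Y hY hB),
    expNonneg, expNonneg, this]

/-! ### Two consequences of independence -/

theorem expNonneg_lt_top_of_le {X : Ω → ℝ} (hX : X ∈ S.H) {K : ℝ} (hK : ∀ ω, X ω ≤ K) :
    S.expNonneg X < ⊤ :=
  (S.expNonneg_mono hX (S.const_mem K) hK).trans_lt
    ((S.expNonneg_const K).trans_lt ENNReal.ofReal_lt_top)

variable {S} in
/-- The only form in which independence is used: for bounded nonnegative `F`, `G` and `h`,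
`𝔼[F(X₀,…,Xₙ) + G(X₀,…,Xₙ) h(Xₙ₊₁)] = 𝔼[F(X₀,…,Xₙ) + c G(X₀,…,Xₙ)]` with `c = 𝔼[h(Xₙ₊₁)]`. -/
theorem IndepSeq.expNonneg_add_mul {Xs : ℕ → Ω → ℝ} (hi : S.IndepSeq Xs) (n : ℕ)
    {F G : (Fin (n + 1) → ℝ) → ℝ} {h : ℝ → ℝ} {K : ℝ}
    (hFm : Measurable F) (hGm : Measurable G) (hhm : Measurable h)
    (hF0 : ∀ x, 0 ≤ F x) (hG0 : ∀ x, 0 ≤ G x) (hh0 : ∀ x, 0 ≤ h x)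
    (hFK : ∀ x, F x ≤ K) (hGK : ∀ x, G x ≤ K) (hhK : ∀ x, h x ≤ K)
    (hFH : (fun ω => F fun i => Xs i ω) ∈ S.H) (hGH : (fun ω => G fun i => Xs i ω) ∈ S.H)
    (hhH : (fun ω => h (Xs (n + 1) ω)) ∈ S.H) :
    S.expNonneg (fun ω => (F fun i => Xs i ω) + (G fun i => Xs i ω) * h (Xs (n + 1) ω)) =
      S.expNonneg (fun ω => (F fun i => Xs i ω) + (G fun i => Xs i ω) *
        (S.expNonneg fun ω => h (Xs (n + 1) ω)).toReal) := by
  set c := (S.expNonneg fun ω => h (Xs (n + 1) ω)).toReal with hc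
  have hK0 : 0 ≤ K := (hh0 0).trans (hhK 0)
  have hc0 : 0 ≤ c := ENNReal.toReal_nonneg
  have hEh : S.E (fun ω => h (Xs (n + 1) ω)) = (c : EReal) := by
    rw [← S.coe_expNonneg hhH fun ω => hh0 _, hc, EReal.coe_ennreal_toReal]
    exact (S.expNonneg_lt_top_of_le hhH fun ω => hhK _).ne
  have hxH : ∀ a b : ℝ, (fun ω => a + b * h (Xs (n + 1) ω)) ∈ S.H := fun a b =>
    S.add_mem (S.const_mem a) (S.const_mul_mem b hhH)
  -- the expectation for frozen values of the past
  have hval : ∀ a b : ℝ, 0 ≤ a → 0 ≤ b →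
      S.E (fun ω => a + b * h (Xs (n + 1) ω)) = ((a + b * c : ℝ) : EReal) := by
    intro a b ha hb
    have hmul : S.E (fun ω => b * h (Xs (n + 1) ω)) = ((b * c : ℝ) : EReal) := by
      rw [S.pos_homog _ hhH b hb, hEh, EReal.coe_mul]
    apply le_antisymm
    · have := S.subadd _ (S.const_mem a) _ (S.const_mul_mem b hhH)
        (fun h => EReal.coe_ne_top a (by rw [← h.1, S.const]))
        (fun h => EReal.coe_ne_bot a (by rw [← h.1, S.const]))
      rwa [hmul, S.const, ← EReal.coe_add] at this
    · have h1 := S.subadd _ (hxH a b) _ (S.const_mem (-a))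
        (by rw [S.const]; simp) (by rw [S.const]; simp)
      have e : (fun ω => a + b * h (Xs (n + 1) ω) + -a) = fun ω => b * h (Xs (n + 1) ω) := by
        funext ω; ring
      rw [e, hmul, S.const] at h1
      have h2 : S.E (fun ω => a + b * h (Xs (n + 1) ω)) < ⊤ := by
        rw [← S.coe_expNonneg (hxH a b) fun ω => add_nonneg ha (mul_nonneg hb (hh0 _))]
        have := S.expNonneg_lt_top_of_le (hxH a b) (K := a + b * K) fun ω =>
          add_le_add le_rfl (mul_le_mul_of_nonneg_left (hhK _) hb)
        exact lt_top_iff_ne_top.2 (by simpa using this.ne)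
      have h3 : S.E (fun ω => a + b * h (Xs (n + 1) ω)) ≠ ⊥ :=
        fun h => by
          have := S.E_nonneg (hxH a b) fun ω => add_nonneg ha (mul_nonneg hb (hh0 _))
          simp [h] at this
      generalize S.E (fun ω => a + b * h (Xs (n + 1) ω)) = e at h1 h2 h3
      induction e with
      | bot => simp at h3
      | top => simp at h2
      | coe x =>
        rw [← EReal.coe_add, EReal.coe_le_coe_iff] at h1
        rw [EReal.coe_le_coe_iff]
        linarith
  have habs : ∀ a b y : ℝ, 0 ≤ a → 0 ≤ b → |a + b * h y| = a + b * h y := fun a b y ha hb =>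
    abs_of_nonneg (add_nonneg ha (mul_nonneg hb (hh0 _)))
  have hmem : (fun ω => (F fun i => Xs i ω) + (G fun i => Xs i ω) * c) ∈ S.H :=
    S.add_mem hFH (S.mul_mem hGH (S.const_mem c))
  have key := hi n (fun x y => F x + G x * h (y 0)) (by fun_prop)
    (S.add_mem hFH (S.mul_mem hGH hhH)) (fun x => hxH _ _)
    (fun x => by
      simp only [habs _ _ _ (hF0 x) (hG0 x)]
      rw [hval _ _ (hF0 x) (hG0 x)]
      exact EReal.coe_lt_top _)
    (by
      simp only [habs _ _ _ (hF0 _) (hG0 _), hval _ _ (hF0 _) (hG0 _), EReal.toReal_coe]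
      exact hmem)
    (by
      simp only [habs _ _ _ (hF0 _) (hG0 _), hval _ _ (hF0 _) (hG0 _), EReal.toReal_coe]
      rw [← S.coe_expNonneg hmem fun ω => add_nonneg (hF0 _) (mul_nonneg (hG0 _) hc0)]
      have := S.expNonneg_lt_top_of_le hmem (K := K + K * c) fun ω =>
        add_le_add (hFK _) (mul_le_mul_of_nonneg_right (hGK _) hc0)
      exact lt_top_iff_ne_top.2 (by simpa using this.ne))
    (by
      simp only [hval _ _ (hF0 _) (hG0 _), EReal.toReal_coe]
      exact hmem)
  simp only [hval _ _ (hF0 _) (hG0 _), EReal.toReal_coe] at key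
  rw [expNonneg, expNonneg, key]

/-- The product `∏ h i (x i)`, frozen from the first time on at which it is at least `c`. -/
noncomputable def stoppedProd (c : ℝ) (h : ℕ → ℝ → ℝ) : ℕ → (ℕ → ℝ) → ℝ
  | 0, x => h 0 (x 0)
  | j + 1, x => {u | c ≤ u}.indicator id (stoppedProd c h j x) +
      {u | u < c}.indicator id (stoppedProd c h j x) * h (j + 1) (x (j + 1))

theorem stoppedProd_congr (c : ℝ) (h : ℕ → ℝ → ℝ) (j : ℕ) {x y : ℕ → ℝ}
    (hxy : ∀ i ≤ j, x i = y i) : stoppedProd c h j x = stoppedProd c h j y := by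
  induction j with
  | zero => simp [stoppedProd, hxy 0]
  | succ j ih =>
    rw [stoppedProd, stoppedProd, ih fun i hi => hxy i (by omega), hxy (j + 1) le_rfl]

theorem measurable_stoppedProd (c : ℝ) {h : ℕ → ℝ → ℝ} (hm : ∀ i, Measurable (h i)) (j : ℕ) :
    Measurable (stoppedProd c h j) := by
  induction j with
  | zero => exact (hm 0).comp (measurable_pi_apply 0)
  | succ j ih =>
    refine ((measurable_id.indicator measurableSet_Ici).comp ih).add
      (((measurable_id.indicator measurableSet_Iio).comp ih).mul
        ((hm _).comp (measurable_pi_apply _)))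

theorem stoppedProd_nonneg (c : ℝ) {h : ℕ → ℝ → ℝ} (h0 : ∀ i x, 0 ≤ h i x) (j : ℕ) (x : ℕ → ℝ) :
    0 ≤ stoppedProd c h j x := by
  induction j with
  | zero => exact h0 _ _
  | succ j ih =>
    have : ∀ s : Set ℝ, 0 ≤ s.indicator id (stoppedProd c h j x) := fun s =>
      Set.indicator_apply_nonneg fun _ => ih
    exact add_nonneg (this _) (mul_nonneg (this _) (h0 _ _))

theorem stoppedProd_le (c : ℝ) {h : ℕ → ℝ → ℝ} {K : ℝ} (hK : 1 ≤ K) (h0 : ∀ i x, 0 ≤ h i x)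
    (hhK : ∀ i x, h i x ≤ K) (j : ℕ) (x : ℕ → ℝ) : stoppedProd c h j x ≤ K ^ (j + 1) := by
  induction j with
  | zero => simpa [stoppedProd] using hhK 0 (x 0)
  | succ j ih =>
    have h1 : (0 : ℝ) ≤ K ^ (j + 1) := by positivity
    rcases le_or_gt c (stoppedProd c h j x) with hc | hc
    · simp [stoppedProd, hc, not_lt.2 hc]
      exact ih.trans (pow_le_pow_right₀ hK (by omega))
    · simp [stoppedProd, hc, not_le.2 hc]
      rw [pow_succ K (j + 1)]
      exact mul_le_mul ih (hhK _ _) (h0 _ _) h1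

theorem le_stoppedProd (c : ℝ) (h : ℕ → ℝ → ℝ) (n : ℕ) (x : ℕ → ℝ) {j : ℕ} (hj : j ≤ n)
    (hc : c ≤ ∏ i ∈ Finset.range (j + 1), h i (x i)) : c ≤ stoppedProd c h n x := by
  have stay : ∀ i, c ≤ stoppedProd c h i x → c ≤ stoppedProd c h (i + 1) x := fun i hi => by
    simp [stoppedProd, hi, not_lt.2 hi]
  have reach : ∀ i, c ≤ stoppedProd c h i x ∨
      stoppedProd c h i x = ∏ l ∈ Finset.range (i + 1), h l (x l) := by
    intro i
    induction i with
    | zero => right; simp [stoppedProd]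
    | succ i ih =>
      rcases le_or_gt c (stoppedProd c h i x) with h1 | h1
      · exact Or.inl (stay i h1)
      · right
        rcases ih with ih | ih
        · exact absurd ih (not_le.2 h1)
        · rw [Finset.prod_range_succ, ← ih]
          simp [stoppedProd, h1, not_le.2 h1]
  induction n, hj using Nat.le_induction with
  | base => rcases reach j with h1 | h1 <;> [exact h1; exact h1 ▸ hc]
  | succ n _ ih => exact stay n ih

variable {S} in
/-- Ville's maximal inequality: a product of independent bounded nonnegative factors of
expectation at most one ever reaches the level `c` with capacity at most `c⁻¹`. -/
theorem IndepSeq.capacity_prod_le {Xs : ℕ → Ω → ℝ} (hi : S.IndepSeq Xs) (hXs : ∀ i, Xs i ∈ S.H)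
    {h : ℕ → ℝ → ℝ} {K : ℝ} (hhm : ∀ i, Measurable (h i)) (hh0 : ∀ i x, 0 ≤ h i x)
    (hhK : ∀ i x, h i x ≤ K) (hhH : ∀ i, (fun ω => h i (Xs i ω)) ∈ S.H)
    (hh1 : ∀ i, S.expNonneg (fun ω => h i (Xs i ω)) ≤ 1) {c : ℝ} (hc : 0 < c) (n : ℕ) :
    S.capacity {ω | ∃ j ≤ n, c ≤ ∏ i ∈ Finset.range (j + 1), h i (Xs i ω)} ≤
      ENNReal.ofReal c⁻¹ := by
  wlog hK : 1 ≤ K generalizing K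
  · exact this (K := 1) (fun i x => (hhK i x).trans (not_le.1 hK).le) le_rfl
  have hXm : ∀ i, Measurable (Xs i) := fun i => S.measurable_of_mem _ (hXs i)
  have hindH : ∀ (s : Set ℝ), MeasurableSet s → ∀ Z ∈ S.H,
      (fun ω => s.indicator id (Z ω)) ∈ S.H := by
    intro s hs Z hZ
    have := S.mul_mem (S.ind_mem (S.measurable_of_mem Z hZ hs)) hZ
    convert this using 1
    funext ω
    by_cases h1 : Z ω ∈ s
    · have h2 : ω ∈ Z ⁻¹' s := h1
      simp [h1]
    · have h2 : ω ∉ Z ⁻¹' s := h1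
      simp [h1]
  have memH : ∀ j, (fun ω => stoppedProd c h j fun i => Xs i ω) ∈ S.H := by
    intro j
    induction j with
    | zero => exact hhH 0
    | succ j ih =>
      exact S.add_mem (hindH {u | c ≤ u} measurableSet_Ici _ ih)
        (S.mul_mem (hindH {u | u < c} measurableSet_Iio _ ih) (hhH (j + 1)))
  have nonneg : ∀ j ω, 0 ≤ stoppedProd c h j fun i => Xs i ω := fun j ω =>
    stoppedProd_nonneg c hh0 j _
  have exp_le : ∀ j, S.expNonneg (fun ω => stoppedProd c h j fun i => Xs i ω) ≤ 1 := by
    intro j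
    induction j with
    | zero => exact hh1 0
    | succ j ih =>
      -- the stopped product as a function of the finitely many past coordinates
      let ext : (Fin (j + 1) → ℝ) → ℕ → ℝ := fun x i => if hi : i < j + 1 then x ⟨i, hi⟩ else 0
      have extm : Measurable ext := measurable_pi_lambda _ fun i => by
        by_cases hi : i < j + 1
        · simp only [ext, hi, dif_pos]; fun_prop
        · simp only [ext, hi]; simp
      have hext : ∀ ω, stoppedProd c h j (ext fun i => Xs i ω) =
          stoppedProd c h j fun i => Xs i ω := fun ω =>
        stoppedProd_congr c h j fun i hi => by simp [ext]; intro h; omega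
      have hm := (measurable_stoppedProd c hhm j).comp extm
      have hbd : ∀ (s : Set ℝ) x, 0 ≤ s.indicator id (stoppedProd c h j (ext x)) ∧
          s.indicator id (stoppedProd c h j (ext x)) ≤ K ^ (j + 1) := fun s x => by
        have h1 := stoppedProd_nonneg c hh0 j (ext x)
        have h2 := stoppedProd_le c hK hh0 hhK j (ext x)
        by_cases hs : stoppedProd c h j (ext x) ∈ s <;> simp [hs, h1, h2]
        positivity
      have key := hi.expNonneg_add_mul j (h := h (j + 1)) (K := K ^ (j + 1))
        (F := fun x => {u | c ≤ u}.indicator id (stoppedProd c h j (ext x)))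
        (G := fun x => {u | u < c}.indicator id (stoppedProd c h j (ext x)))
        ((measurable_id.indicator measurableSet_Ici).comp hm)
        ((measurable_id.indicator measurableSet_Iio).comp hm) (hhm _)
        (fun x => (hbd _ x).1) (fun x => (hbd _ x).1) (hh0 _)
        (fun x => (hbd _ x).2) (fun x => (hbd _ x).2)
        (fun x => (hhK _ x).trans (le_self_pow₀ hK (by omega)))
        (by simp only [hext]; exact hindH {u | c ≤ u} measurableSet_Ici _ (memH j))
        (by simp only [hext]; exact hindH {u | u < c} measurableSet_Iio _ (memH j)) (hhH _)
      simp only [hext] at key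
      refine le_trans (le_of_eq key) (le_trans ?_ ih)
      refine S.expNonneg_mono (S.add_mem (hindH {u | c ≤ u} measurableSet_Ici _ (memH j))
        (S.mul_mem (hindH {u | u < c} measurableSet_Iio _ (memH j)) (S.const_mem _)))
        (memH j) fun ω => ?_
      have h1 : (S.expNonneg fun ω => h (j + 1) (Xs (j + 1) ω)).toReal ≤ 1 :=
        ENNReal.toReal_le_of_le_ofReal zero_le_one (by simpa using hh1 (j + 1))
      have h2 := nonneg j ω
      rcases le_or_gt c (stoppedProd c h j fun i => Xs i ω) with h3 | h3
      · simp [h3, not_lt.2 h3]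
      · simp only [mem_ofPred_eq, not_le.2 h3, not_false_eq_true, indicator_of_notMem, h3,
          indicator_of_mem, id, zero_add]
        exact mul_le_of_le_one_right h2 h1
  have hmeas : MeasurableSet {ω | c ≤ stoppedProd c h n fun i => Xs i ω} :=
    measurableSet_le measurable_const (S.measurable_of_mem _ (memH n))
  have hle := (S.mul_capacity_le hc.le (memH n) (nonneg n) hmeas fun ω hω => hω).trans (exp_le n)
  calc _ ≤ S.capacity {ω | c ≤ stoppedProd c h n fun i => Xs i ω} :=
        by
          refine S.capacity_mono ?_
          rintro ω ⟨j, hj, h1⟩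
          exact le_stoppedProd c h n _ hj h1
    _ ≤ ENNReal.ofReal c⁻¹ := by
        rw [ENNReal.ofReal_inv_of_pos hc, ENNReal.le_inv_iff_mul_le, mul_comm]
        exact hle

variable {S} in
/-- For independent events, `1 - 𝕍(⋃ Aᵢ) ≤ exp (-∑ 𝕍(Aᵢ))`. -/
theorem IndepSeq.one_sub_capacity_biUnion_le {Xs : ℕ → Ω → ℝ} (hi : S.IndepSeq Xs)
    (hXs : ∀ i, Xs i ∈ S.H) {B : ℕ → Set ℝ} (hB : ∀ i, MeasurableSet (B i)) (n : ℕ) :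
    1 - (S.capacity {ω | ∃ i ≤ n, Xs i ω ∈ B i}).toReal ≤
      Real.exp (-∑ i ∈ Finset.range (n + 1), (S.capacity (Xs i ⁻¹' B i)).toReal) := by
  have hXm : ∀ i, Measurable (Xs i) := fun i => S.measurable_of_mem _ (hXs i)
  have hAm : ∀ i, MeasurableSet (Xs i ⁻¹' B i) := fun i => hXm i (hB i)
  have hUm : ∀ n, MeasurableSet {ω | ∃ i ≤ n, Xs i ω ∈ B i} := fun n => by
    have : {ω | ∃ i ≤ n, Xs i ω ∈ B i} = ⋃ i ≤ n, Xs i ⁻¹' B i := by ext; simp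
    rw [this]
    exact MeasurableSet.biUnion (Set.to_countable _) fun i _ => hAm i
  have hne : ∀ A, S.capacity A ≠ ⊤ := fun A => ((S.capacity_le_one A).trans_lt (by simp)).ne
  induction n with
  | zero =>
    have : {ω | ∃ i ≤ 0, Xs i ω ∈ B i} = Xs 0 ⁻¹' B 0 := by ext; simp
    rw [this]
    simpa using Real.one_sub_le_exp_neg (S.capacity (Xs 0 ⁻¹' B 0)).toReal
  | succ n ih =>
    set U := {ω | ∃ i ≤ n, Xs i ω ∈ B i} with hU
    have hUmn : MeasurableSet U := hUm n
    set D : Set (Fin (n + 1) → ℝ) := {x | ∃ i : Fin (n + 1), x i ∈ B i} with hD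
    set p := (S.capacity (Xs (n + 1) ⁻¹' B (n + 1))).toReal with hp
    have hp1 : p ≤ 1 := ENNReal.toReal_le_of_le_ofReal zero_le_one (by
      simpa using S.capacity_le_one _)
    have hDm : MeasurableSet D := by
      have : D = ⋃ i : Fin (n + 1), (fun x => x i) ⁻¹' B i := by ext; simp [hD]
      rw [this]
      exact MeasurableSet.iUnion fun i => measurable_pi_apply i (hB i)
    have hUD : ∀ ω, (fun i : Fin (n + 1) => Xs i ω) ∈ D ↔ ω ∈ U := fun ω => by
      simp only [hD, hU, mem_ofPred_eq]
      constructor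
      · rintro ⟨i, h⟩; exact ⟨i, by omega, h⟩
      · rintro ⟨i, h, h'⟩; exact ⟨⟨i, by omega⟩, h'⟩
    have eD : ∀ ω, D.indicator (fun _ => (1 : ℝ)) (fun i => Xs i ω)
        = U.indicator (fun _ => (1 : ℝ)) ω := fun ω => by
      by_cases h : ω ∈ U
      · simp [h, (hUD ω).2 h]
      · simp [h, mt (hUD ω).1 h]
    have eDc : ∀ ω, Dᶜ.indicator (fun _ => (1 : ℝ)) (fun i => Xs i ω)
        = Uᶜ.indicator (fun _ => (1 : ℝ)) ω := fun ω => by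
      by_cases h : ω ∈ U
      · simp [h, (hUD ω).2 h]
      · simp [h, mt (hUD ω).1 h]
    have bd : ∀ {α : Type} (s : Set α) x, s.indicator (fun _ => (1 : ℝ)) x ≤ 1 := fun s x =>
      Set.indicator_le' (fun _ _ => le_rfl) (fun _ _ => zero_le_one) x
    have key := hi.expNonneg_add_mul n (F := D.indicator fun _ => (1 : ℝ))
      (G := Dᶜ.indicator fun _ => (1 : ℝ)) (h := (B (n + 1)).indicator fun _ => (1 : ℝ)) (K := 1)
      (measurable_const.indicator hDm) (measurable_const.indicator hDm.compl)
      (measurable_const.indicator (hB _)) (indicator_one_nonneg _) (indicator_one_nonneg _)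
      (indicator_one_nonneg _) (bd _) (bd _) (bd _)
      (by simp only [eD]; exact S.ind_mem (hUmn))
      (by simp only [eDc]; exact S.ind_mem (hUmn).compl) (S.ind_mem (hAm _))
    have eh : (S.expNonneg fun ω => (B (n + 1)).indicator (fun _ => (1 : ℝ)) (Xs (n + 1) ω))
        = S.capacity (Xs (n + 1) ⁻¹' B (n + 1)) := by rw [S.capacity_eq (hAm _)]; rfl
    simp only [eD, eDc, eh] at key
    have hV : {ω | ∃ i ≤ n + 1, Xs i ω ∈ B i} = U ∪ Xs (n + 1) ⁻¹' B (n + 1) := by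
      ext ω
      simp only [hU, mem_ofPred_eq, mem_union, mem_preimage]
      constructor
      · rintro ⟨i, h, h'⟩
        rcases Nat.le_succ_iff.1 h with h | rfl
        · exact Or.inl ⟨i, h, h'⟩
        · exact Or.inr h'
      · rintro (⟨i, h, h'⟩ | h)
        · exact ⟨i, by omega, h'⟩
        · exact ⟨n + 1, le_rfl, h⟩
    clear_value U
    -- independence replaces the indicator of the last event by `p`, so that its union with `U` has
    -- capacity `𝔼[p + (1 - p) 1_U]`, which is at least `p + (1 - p) 𝕍(U)`
    have low : 1 ≤ (1 - p) * (1 - (S.capacity U).toReal) +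
        (S.capacity (U ∪ Xs (n + 1) ⁻¹' B (n + 1))).toReal := by
      have hcap : S.capacity (U ∪ Xs (n + 1) ⁻¹' B (n + 1)) =
          S.expNonneg (fun ω => p + (1 - p) * U.indicator (fun _ => (1 : ℝ)) ω) := by
        rw [S.capacity_eq ((hUmn).union (hAm _))]
        convert key using 2
        · funext ω
          by_cases h1 : ω ∈ U <;> by_cases h2 : Xs (n + 1) ω ∈ B (n + 1) <;> simp [h1, h2]
        · funext ω
          by_cases h1 : ω ∈ U <;> simp [h1, hp]
      have hUH := S.const_mul_mem (1 - p) (S.ind_mem (hUmn))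
      have h1 := S.subadd _ (S.add_mem (S.const_mem p) hUH) _ (S.const_mem (-p))
        (by rw [S.const]; simp) (by rw [S.const]; simp)
      have e : (fun ω => p + (1 - p) * U.indicator (fun _ => (1 : ℝ)) ω + -p)
          = fun ω => (1 - p) * U.indicator (fun _ => (1 : ℝ)) ω := by funext ω; ring
      have hnn : ∀ ω, 0 ≤ p + (1 - p) * U.indicator (fun _ => (1 : ℝ)) ω := fun ω =>
        add_nonneg ENNReal.toReal_nonneg (mul_nonneg (by linarith) (indicator_one_nonneg _ ω))
      rw [e, S.pos_homog _ (S.ind_mem (hUmn)) _ (by linarith), S.const,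
        ← S.coe_expNonneg (S.ind_mem (hUmn)) (indicator_one_nonneg U), ← S.capacity_eq (hUmn),
        ← S.coe_expNonneg (S.add_mem (S.const_mem p) hUH) hnn, ← hcap,
        ← EReal.coe_ennreal_toReal (hne _), ← EReal.coe_ennreal_toReal (hne _),
        ← EReal.coe_mul, ← EReal.coe_add, EReal.coe_le_coe_iff] at h1
      linarith
    rw [hV, Finset.sum_range_succ, neg_add, Real.exp_add]
    have h3 : 1 - p ≤ Real.exp (-p) := Real.one_sub_le_exp_neg p
    have h4 : 0 ≤ 1 - (S.capacity U).toReal := by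
      have := ENNReal.toReal_le_of_le_ofReal zero_le_one (b := (1 : ℝ))
        (by simpa using S.capacity_le_one U)
      linarith
    calc _ ≤ (1 - p) * (1 - (S.capacity U).toReal) := by linarith
      _ ≤ Real.exp (-p) * (1 - (S.capacity U).toReal) := by gcongr
      _ ≤ Real.exp (-p) * _ := by gcongr
      _ = _ := mul_comm _ _

end SublinearExpectationSpace

/-! ### Comparing weighted series of tail values with Choquet integrals -/

theorem lintegral_Ioi_indicator_lt (a : ℝ≥0∞) :
    ∫⁻ u in Ioi (0 : ℝ), (if ENNReal.ofReal u < a then 1 else 0) = a := by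
  have hm : MeasurableSet {u : ℝ | ENNReal.ofReal u < a} :=
    measurableSet_lt ENNReal.measurable_ofReal measurable_const
  have h : (fun u : ℝ => if ENNReal.ofReal u < a then (1 : ℝ≥0∞) else 0)
      = {u : ℝ | ENNReal.ofReal u < a}.indicator 1 := by
    funext u; by_cases hu : ENNReal.ofReal u < a <;> simp [hu]
  rw [h, lintegral_indicator_one hm, Measure.restrict_apply hm]
  rcases eq_or_ne a ⊤ with rfl | ha
  · simp
  · have : {u : ℝ | ENNReal.ofReal u < a} ∩ Ioi 0 = Ioo 0 a.toReal := by
      ext u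
      simp only [mem_inter_iff, mem_ofPred_eq, mem_Ioi, mem_Ioo]
      constructor
      · rintro ⟨h1, h2⟩
        exact ⟨h2, (ENNReal.ofReal_lt_iff_lt_toReal h2.le ha).1 h1⟩
      · rintro ⟨h1, h2⟩
        exact ⟨(ENNReal.ofReal_lt_iff_lt_toReal h1.le ha).2 h2, h1⟩
    rw [this]
    simp [ha]

theorem lintegral_Ioi_eq_lintegral_lintegral {T : ℝ → ℝ≥0∞} (hT : Measurable T) :
    ∫⁻ x in Ioi (0 : ℝ), T x = ∫⁻ u in Ioi (0 : ℝ), ∫⁻ x in Ioi (0 : ℝ),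
      (if ENNReal.ofReal u < T x then 1 else 0) := by
  rw [lintegral_lintegral_swap]
  · simp only [lintegral_Ioi_indicator_lt]
  · refine Measurable.aemeasurable (Measurable.ite ?_ measurable_const measurable_const)
    exact measurableSet_lt (ENNReal.measurable_ofReal.comp measurable_fst)
      (hT.comp measurable_snd)

theorem tsum_mul_eq_lintegral {ι : Type*} [Countable ι] (w : ι → ℝ≥0∞) (a : ι → ℝ≥0∞) :
    ∑' i, w i * a i =
      ∫⁻ u in Ioi (0 : ℝ), ∑' i, (if ENNReal.ofReal u < a i then w i else 0) := by
  have hm : ∀ i, Measurable fun u : ℝ => if ENNReal.ofReal u < a i then (1 : ℝ≥0∞) else 0 :=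
    fun i => Measurable.ite (measurableSet_lt ENNReal.measurable_ofReal measurable_const)
      measurable_const measurable_const
  have e : ∀ (u : ℝ) i, (if ENNReal.ofReal u < a i then w i else 0)
      = w i * (if ENNReal.ofReal u < a i then 1 else 0) := fun u i => by simp
  simp only [e]
  rw [lintegral_tsum fun i => ((hm i).const_mul _).aemeasurable]
  refine tsum_congr fun i => ?_
  rw [lintegral_const_mul _ (hm i), lintegral_Ioi_indicator_lt]

/-- If the weights of the thresholds up to `t` sum to at most `C Φ(t)`, then the weighted series
of the tail `v` is at most `C` times the integral of a function `T` which is the tail of `Φ`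
under `v`. Both sides are integrals over the levels `u` of `v`, where the claim is pointwise. -/
theorem tsum_mul_le_lintegral {ι : Type*} [Countable ι] {v T : ℝ → ℝ≥0∞} {Φ : ℝ → ℝ}
    (hT : Measurable T) (hvT : ∀ s, 0 ≤ s → ∀ x, 0 < x → x < Φ s → v s ≤ T x)
    {w : ι → ℝ≥0∞} {s : ι → ℝ} (hs : ∀ i, 0 ≤ s i) {C : ℝ≥0∞}
    (h : ∀ t, 0 ≤ t → ∑' i, (if s i ≤ t then w i else 0) ≤ C * ENNReal.ofReal (Φ t)) :
    ∑' i, w i * v (s i) ≤ C * ∫⁻ x in Ioi (0 : ℝ), T x := by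
  have hmeas : Measurable fun p : ℝ × ℝ =>
      if ENNReal.ofReal p.1 < T p.2 then (1 : ℝ≥0∞) else 0 :=
    Measurable.ite (measurableSet_lt (ENNReal.measurable_ofReal.comp measurable_fst)
      (hT.comp measurable_snd)) measurable_const measurable_const
  rw [tsum_mul_eq_lintegral, lintegral_Ioi_eq_lintegral_lintegral hT,
    ← lintegral_const_mul _ (Measurable.lintegral_prod_right hmeas)]
  refine lintegral_mono fun u => ?_
  rw [ENNReal.tsum_eq_iSup_sum]
  refine iSup_le fun F => ?_
  classical
  rw [← Finset.sum_filter]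
  set F' := F.filter fun i => ENNReal.ofReal u < v (s i) with hF'
  rcases F'.eq_empty_or_nonempty with h0 | hne
  · simp [h0]
  obtain ⟨m, hm, hmax⟩ := F'.exists_max_image s hne
  have hum : ENNReal.ofReal u < v (s m) := (Finset.mem_filter.1 hm).2
  calc ∑ i ∈ F', w i = ∑ i ∈ F', (if s i ≤ s m then w i else 0) :=
        Finset.sum_congr rfl fun i hi => by rw [if_pos (hmax i hi)]
    _ ≤ ∑' i, (if s i ≤ s m then w i else 0) := ENNReal.sum_le_tsum _
    _ ≤ C * ENNReal.ofReal (Φ (s m)) := h _ (hs m)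
    _ ≤ _ := by
        gcongr
        calc ENNReal.ofReal (Φ (s m)) = volume (Ioo 0 (Φ (s m))) := by simp
          _ = ∫⁻ x in Ioi (0 : ℝ), (Ioo 0 (Φ (s m))).indicator 1 x := by
              rw [lintegral_indicator_one measurableSet_Ioo,
                Measure.restrict_apply measurableSet_Ioo,
                inter_eq_left.2 fun x hx => hx.1]
          _ ≤ _ := by
              refine lintegral_mono fun x => ?_
              by_cases hx : x ∈ Ioo 0 (Φ (s m))
              · rw [if_pos (hum.trans_le (hvT _ (hs m) x hx.1 hx.2))]
                simp [hx]
              · simp [hx]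

theorem lintegral_Ioi_ofReal_le_le {p : ℝ → Prop} (hp : MeasurableSet {x | p x})
    [DecidablePred p] {R : ℝ≥0∞}
    (h : ∀ x, 0 < x → p x → ENNReal.ofReal x ≤ R) :
    ∫⁻ x in Ioi (0 : ℝ), (if p x then 1 else 0) ≤ R := by
  have e : (fun x : ℝ => if p x then (1 : ℝ≥0∞) else 0) = {x | p x}.indicator 1 := by
    funext x; by_cases hx : p x <;> simp [hx]
  rw [e, lintegral_indicator_one hp, Measure.restrict_apply hp]
  rcases eq_or_ne R ⊤ with rfl | hR
  · simp
  calc volume ({x | p x} ∩ Ioi 0) ≤ volume (Ioc 0 R.toReal) := by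
        refine measure_mono fun x hx => ⟨hx.2, ?_⟩
        exact (ENNReal.ofReal_le_iff_le_toReal hR).1 (h x hx.2 hx.1)
    _ = R := by simp [hR]

/-- The converse comparison: if `Φ(t)` is at most `C` times one plus the weights of the
thresholds up to `t`, the integral of the tail of `Φ` is controlled by the weighted series. -/
theorem lintegral_le_tsum_mul {ι : Type*} [Countable ι] {v T : ℝ → ℝ≥0∞} {Φ : ℝ → ℝ}
    (hT : Measurable T) (hT1 : ∀ x, T x ≤ 1) (hv : Antitone v)
    (hTv : ∀ x, 0 < x → ∃ t, 0 ≤ t ∧ x = Φ t ∧ T x ≤ v t)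
    {w : ι → ℝ≥0∞} {s : ι → ℝ} {C : ℝ≥0∞}
    (h : ∀ t, 0 ≤ t → ENNReal.ofReal (Φ t) ≤ C * (1 + ∑' i, (if s i ≤ t then w i else 0))) :
    ∫⁻ x in Ioi (0 : ℝ), T x ≤ C * (1 + ∑' i, w i * v (s i)) := by
  have hm : ∀ i, Measurable fun u : ℝ => if ENNReal.ofReal u < v (s i) then w i else 0 :=
    fun i => Measurable.ite (measurableSet_lt ENNReal.measurable_ofReal measurable_const)
      measurable_const measurable_const
  have hm' : Measurable fun u : ℝ => ∑' i, if ENNReal.ofReal u < v (s i) then w i else 0 :=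
    Measurable.tsum hm
  have hm1 : Measurable fun u : ℝ => if ENNReal.ofReal u < 1 then (1 : ℝ≥0∞) else 0 :=
    Measurable.ite (measurableSet_lt ENNReal.measurable_ofReal measurable_const)
      measurable_const measurable_const
  rw [lintegral_Ioi_eq_lintegral_lintegral hT, tsum_mul_eq_lintegral]
  conv_rhs => rw [← lintegral_Ioi_indicator_lt 1]
  rw [← lintegral_add_left hm1, ← lintegral_const_mul _ (by exact hm1.add hm')]
  refine lintegral_mono fun u => ?_
  refine lintegral_Ioi_ofReal_le_le (measurableSet_lt measurable_const hT) fun x hx hux => ?_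
  obtain ⟨t, ht, rfl, htv⟩ := hTv x hx
  refine (h t ht).trans ?_
  rw [if_pos (hux.trans_le (hT1 _))]
  gcongr with i
  split_ifs with h1 h2
  · exact le_rfl
  · exact absurd (hux.trans_le (htv.trans (hv h1))) h2
  · exact zero_le
  · exact le_rfl

namespace SublinearExpectationSpace

variable {Ω : Type*} [MeasurableSpace Ω] (S : SublinearExpectationSpace Ω)

/-- The tail `t ↦ 𝕍(|X| > t)`. -/
noncomputable def tail (X : Ω → ℝ) (t : ℝ) : ℝ≥0∞ := S.capacity {ω | t < |X ω|}

theorem tail_antitone (X : Ω → ℝ) : Antitone (S.tail X) := fun _ _ h =>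
  S.capacity_mono fun _ hω => lt_of_le_of_lt h hω

theorem tail_le_one (X : Ω → ℝ) (t : ℝ) : S.tail X t ≤ 1 := S.capacity_le_one _

/-- For `g ≥ 0` the integral over the negative half-line vanishes, because `𝕍(g > x) = 1` for
`x < 0`. -/
theorem choquet_lt_top_iff {g : Ω → ℝ} (hg : ∀ ω, 0 ≤ g ω) :
    S.choquet g < ⊤ ↔ ∫⁻ x in Ioi (0 : ℝ), S.capacity {ω | x < g ω} < ⊤ := by
  have h : ∫⁻ x in Iio (0 : ℝ), (1 - S.capacity {ω | x < g ω}) = 0 := by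
    rw [← lintegral_zero (μ := volume.restrict (Iio (0 : ℝ)))]
    refine setLIntegral_congr_fun measurableSet_Iio fun x hx => ?_
    have : {ω | x < g ω} = univ := eq_univ_of_forall fun ω => lt_of_lt_of_le hx (hg ω)
    simp [this, S.capacity_univ]
  rw [choquet, h, EReal.coe_ennreal_zero, sub_zero, lt_top_iff_ne_top, lt_top_iff_ne_top]
  simp

theorem measurable_capacity_gt (g : Ω → ℝ) : Measurable fun x : ℝ => S.capacity {ω | x < g ω} :=
  Antitone.measurable fun _ _ h => S.capacity_mono fun _ hω => lt_of_le_of_lt h hω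

/-- Finiteness of a Choquet expectation `C_𝕍(Φ(|X|))` bounds weighted tail series whose
weights up to `t` sum to `O(Φ(t))`. -/
theorem tsum_mul_tail_lt_top {ι : Type*} [Countable ι] {X : Ω → ℝ} {Φ : ℝ → ℝ}
    (hΦ0 : ∀ t, 0 ≤ t → 0 ≤ Φ t) (hΦ : MonotoneOn Φ (Ici 0))
    (hC : S.choquet (fun ω => Φ |X ω|) < ⊤)
    {w : ι → ℝ≥0∞} {s : ι → ℝ} (hs : ∀ i, 0 ≤ s i) {C : ℝ≥0∞} (hC' : C ≠ ⊤)
    (h : ∀ t, 0 ≤ t → ∑' i, (if s i ≤ t then w i else 0) ≤ C * ENNReal.ofReal (Φ t)) :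
    ∑' i, w i * S.tail X (s i) < ⊤ := by
  rw [S.choquet_lt_top_iff fun ω => hΦ0 _ (abs_nonneg _)] at hC
  refine (tsum_mul_le_lintegral (S.measurable_capacity_gt _) ?_ hs h).trans_lt
    (ENNReal.mul_lt_top (lt_top_iff_ne_top.2 hC') hC)
  intro s hs x _ hx
  refine S.capacity_mono fun ω hω => hx.trans_le ?_
  exact hΦ hs (mem_Ici.2 (abs_nonneg _)) (le_of_lt hω)

/-- Finiteness of a weighted tail series whose weights up to `t` are at least of the order `Φ(t)`
bounds the Choquet expectation `C_𝕍(Φ(|X|))`. -/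
theorem choquet_lt_top_of_tsum {ι : Type*} [Countable ι] {X : Ω → ℝ} {Φ : ℝ → ℝ}
    (hΦ0 : ∀ t, 0 ≤ t → 0 ≤ Φ t) (hΦ : MonotoneOn Φ (Ici 0))
    (hsurj : ∀ x, 0 < x → ∃ t, 0 ≤ t ∧ Φ t = x)
    {w : ι → ℝ≥0∞} {s : ι → ℝ} {C : ℝ≥0∞} (hC' : C ≠ ⊤)
    (h : ∀ t, 0 ≤ t →
      ENNReal.ofReal (Φ t) ≤ C * (1 + ∑' i, (if s i ≤ t then w i else 0)))
    (hfin : ∑' i, w i * S.tail X (s i) < ⊤) : S.choquet (fun ω => Φ |X ω|) < ⊤ := by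
  rw [S.choquet_lt_top_iff fun ω => hΦ0 _ (abs_nonneg _)]
  refine (lintegral_le_tsum_mul (S.measurable_capacity_gt _) (fun _ => S.capacity_le_one _)
    (S.tail_antitone X) ?_ h).trans_lt
    (ENNReal.mul_lt_top (lt_top_iff_ne_top.2 hC') (ENNReal.add_lt_top.2 ⟨by simp, hfin⟩))
  intro x hx
  obtain ⟨t, ht, rfl⟩ := hsurj x hx
  refine ⟨t, ht, rfl, S.capacity_mono fun ω hω => ?_⟩
  by_contra hlt
  exact absurd hω (not_lt.2 (hΦ (mem_Ici.2 (abs_nonneg _)) ht (not_lt.1 hlt)))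

end SublinearExpectationSpace

/-! ### Cesàro numbers -/

theorem cesaro_zero (a : ℝ) : cesaro a 0 = 1 := by simp [cesaro]

theorem cesaro_succ (a : ℝ) (n : ℕ) :
    cesaro a (n + 1) = cesaro a n * ((a + (n + 1)) / (n + 1)) := by
  have h1 : ((n + 1 : ℕ) : ℝ) ≠ 0 := by positivity
  have h2 : (n.factorial : ℝ) ≠ 0 := by positivity
  rw [cesaro, cesaro, Finset.prod_range_succ, Nat.factorial_succ]
  push_cast at h1 ⊢
  field_simp

theorem cesaro_pos {a : ℝ} (ha : -1 < a) (n : ℕ) : 0 < cesaro a n := by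
  induction n with
  | zero => simp [cesaro_zero]
  | succ n ih =>
    rw [cesaro_succ]
    have : (0 : ℝ) ≤ n := n.cast_nonneg
    exact mul_pos ih (div_pos (by linarith) (by linarith))

theorem cesaro_sub_one_mul (α : ℝ) (n : ℕ) :
    cesaro (α - 1) n * (α + n) = α * cesaro α n := by
  induction n with
  | zero => simp [cesaro_zero]
  | succ n ih =>
    have h1 : ((n : ℝ) + 1) ≠ 0 := by positivity
    rw [cesaro_succ, cesaro_succ, ← mul_assoc, ← ih]
    push_cast
    field_simp
    ring

theorem sum_cesaro_sub_one (α : ℝ) (n : ℕ) :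
    ∑ k ∈ Finset.range (n + 1), cesaro (α - 1) k = cesaro α n := by
  induction n with
  | zero => simp [cesaro_zero]
  | succ n ih =>
    have h1 : ((n : ℝ) + 1) ≠ 0 := by positivity
    have h2 := cesaro_sub_one_mul α n
    rw [Finset.sum_range_succ, ih, cesaro_succ, cesaro_succ]
    field_simp
    linear_combination h2

theorem rpow_le_cesaro {α : ℝ} (h0 : 0 < α) (h1 : α ≤ 1) (n : ℕ) :
    ((n : ℝ) + 1) ^ α ≤ cesaro α n := by
  induction n with
  | zero => simp [cesaro_zero]
  | succ n ih =>
    have hn : (0 : ℝ) < n + 1 := by positivity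
    have e : ((n + 1 : ℕ) : ℝ) + 1 = (n + 1) * (1 + 1 / (n + 1)) := by
      push_cast; field_simp
    rw [e, Real.mul_rpow hn.le (by positivity), cesaro_succ]
    refine mul_le_mul ih ?_ (by positivity) (cesaro_pos (by linarith) n).le
    refine (rpow_one_add_le_one_add_mul_self (s := 1 / ((n : ℝ) + 1)) ?_ h0.le h1).trans_eq ?_
    · have : (0 : ℝ) < 1 / (n + 1) := by positivity
      linarith
    · field_simp
      ring

theorem cesaro_le_two_mul_rpow {α : ℝ} (h0 : 0 < α) (h1 : α ≤ 1) {n : ℕ} (hn : 1 ≤ n) :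
    cesaro α n ≤ 2 * (n : ℝ) ^ α := by
  induction n, hn using Nat.le_induction with
  | base => simp [cesaro_succ, cesaro_zero]; linarith
  | succ n hn ih =>
    have hn0 : (1 : ℝ) ≤ n := by exact_mod_cast hn
    have hn1 : (0 : ℝ) < n + 1 := by positivity
    rw [cesaro_succ]
    -- `(n / (n + 1)) ^ α ≤ 1 - α / (n + 1) ≤ (1 + α / (n + 1))⁻¹`
    have h2 : (n : ℝ) ^ α ≤ ((n : ℝ) + 1) ^ α * (1 - α / (n + 1)) := by
      have e : (n : ℝ) = (n + 1) * (1 + -(1 / (n + 1))) := by field_simp; ring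
      conv_lhs => rw [e]
      have h4 : 1 / ((n : ℝ) + 1) ≤ 1 := by rw [div_le_one hn1]; linarith
      rw [Real.mul_rpow hn1.le (by linarith)]
      gcongr
      refine (rpow_one_add_le_one_add_mul_self (by linarith) h0.le h1).trans_eq ?_
      field_simp
      ring
    have h3 : (0 : ℝ) < ((n : ℝ) + 1) ^ α := by positivity
    have h5 : (1 - α / ((n : ℝ) + 1)) * ((α + (n + 1)) / (n + 1)) ≤ 1 := by
      have : (1 - α / ((n : ℝ) + 1)) * ((α + (n + 1)) / (n + 1))
          = 1 - (α / (n + 1)) ^ 2 := by field_simp; ring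
      rw [this]
      linarith [sq_nonneg (α / ((n : ℝ) + 1))]
    have h6 : (0 : ℝ) ≤ (α + (n + 1)) / (n + 1) := by positivity
    push_cast
    calc cesaro α n * ((α + (n + 1)) / (n + 1))
        ≤ 2 * (((n : ℝ) + 1) ^ α * (1 - α / (n + 1))) * ((α + (n + 1)) / (n + 1)) := by
          gcongr
          exact ih.trans (by gcongr)
      _ = 2 * (((n : ℝ) + 1) ^ α * ((1 - α / (n + 1)) * ((α + (n + 1)) / (n + 1)))) := by ring
      _ ≤ 2 * (((n : ℝ) + 1) ^ α * 1) := by gcongr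
      _ = _ := by ring

theorem cesaro_sub_one_le {α : ℝ} (h0 : 0 < α) (h1 : α ≤ 1) (k : ℕ) :
    cesaro (α - 1) k ≤ 2 * ((k : ℝ) + 1) ^ (α - 1) := by
  have hk : (0 : ℝ) ≤ k := k.cast_nonneg
  have hA : cesaro α k ≤ 2 * ((k : ℝ) + 1) ^ α := by
    rcases Nat.eq_zero_or_pos k with rfl | hk'
    · simp [cesaro_zero]
    · refine (cesaro_le_two_mul_rpow h0 h1 hk').trans ?_
      gcongr
      linarith
  have e := cesaro_sub_one_mul α k
  rw [Real.rpow_sub_one (by positivity), ← mul_div_assoc, le_div_iff₀ (by positivity)]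
  have h2 := cesaro_pos (show -1 < α - 1 by linarith) k
  have h3 : α * (cesaro (α - 1) k * (k + 1)) ≤ α * cesaro α k := by
    rw [← e]
    nlinarith [mul_nonneg h2.le (mul_nonneg hk (sub_nonneg.2 h1))]
  exact (le_of_mul_le_mul_left h3 h0).trans hA

theorem le_cesaro_sub_one {α : ℝ} (h0 : 0 < α) (h1 : α ≤ 1) (k : ℕ) :
    α * ((k : ℝ) + 1) ^ (α - 1) ≤ cesaro (α - 1) k := by
  have hk : (0 : ℝ) ≤ k := k.cast_nonneg
  have e := cesaro_sub_one_mul α k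
  have hA := rpow_le_cesaro h0 h1 k
  have h2 := cesaro_pos (show -1 < α - 1 by linarith) k
  rw [Real.rpow_sub_one (by positivity), ← mul_div_assoc, div_le_iff₀ (by positivity)]
  nlinarith

/-- The weights `A_{n-i}^{α-1} / A_n^α` of the Cesàro mean, which sum to one. -/
noncomputable def cesaroWeight (α : ℝ) (n i : ℕ) : ℝ := cesaro (α - 1) (n - i) / cesaro α n

/-- The order of magnitude `m^{1-α} N^α` of the reciprocal weights, with `m = k + 1` and
`N = n + 1`. -/
noncomputable def cesaroScale (α : ℝ) (n k : ℕ) : ℝ :=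
  ((k : ℝ) + 1) ^ (1 - α) * ((n : ℝ) + 1) ^ α

theorem cesaroScale_pos (α : ℝ) (n k : ℕ) : 0 < cesaroScale α n k := by
  unfold cesaroScale; positivity

theorem cesaroWeight_pos {α : ℝ} (h0 : 0 < α) (n i : ℕ) : 0 < cesaroWeight α n i :=
  div_pos (cesaro_pos (by linarith) _) (cesaro_pos (by linarith) _)

theorem sum_cesaroWeight {α : ℝ} (h0 : 0 < α) (n : ℕ) :
    ∑ i ∈ Finset.range (n + 1), cesaroWeight α n i = 1 := by
  have h := cesaro_pos (show -1 < α by linarith) n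
  unfold cesaroWeight
  rw [← Finset.sum_div, div_eq_one_iff_eq h.ne', ← sum_cesaro_sub_one α n]
  exact Finset.sum_range_reflect (fun k => cesaro (α - 1) k) (n + 1)

theorem cesaroWeight_le {α : ℝ} (h0 : 0 < α) (h1 : α ≤ 1) (n i : ℕ) :
    cesaroWeight α (n + 1) i ≤ 2 / cesaroScale α n (n + 1 - i) := by
  have h2 := cesaro_sub_one_le h0 h1 (n + 1 - i)
  have h3 := rpow_le_cesaro h0 h1 (n + 1)
  have h4 : ((n : ℝ) + 1) ^ α ≤ cesaro α (n + 1) := by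
    refine le_trans ?_ h3
    gcongr
    linarith
  have h5 := cesaro_pos (show -1 < α by linarith) (n + 1)
  have h6 : (0 : ℝ) < ((n + 1 - i : ℕ) : ℝ) + 1 := by positivity
  calc cesaroWeight α (n + 1) i
      ≤ (2 * (((n + 1 - i : ℕ) : ℝ) + 1) ^ (α - 1)) / ((n : ℝ) + 1) ^ α := by
        unfold cesaroWeight
        gcongr
    _ = _ := by
        rw [cesaroScale, show α - 1 = -(1 - α) by ring, Real.rpow_neg h6.le]
        field_simp

theorem le_cesaroWeight {α : ℝ} (h0 : 0 < α) (h1 : α ≤ 1) (n i : ℕ) :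
    α / 2 / cesaroScale α n (n + 1 - i) ≤ cesaroWeight α (n + 1) i := by
  have h2 := le_cesaro_sub_one h0 h1 (n + 1 - i)
  have h3 := cesaro_le_two_mul_rpow h0 h1 (show 1 ≤ n + 1 by omega)
  have h5 := cesaro_pos (show -1 < α by linarith) (n + 1)
  have h6 : (0 : ℝ) < ((n + 1 - i : ℕ) : ℝ) + 1 := by positivity
  push_cast at h3
  calc α / 2 / cesaroScale α n (n + 1 - i)
      = (α * (((n + 1 - i : ℕ) : ℝ) + 1) ^ (α - 1)) / (2 * ((n : ℝ) + 1) ^ α) := by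
        rw [cesaroScale, show α - 1 = -(1 - α) by ring, Real.rpow_neg h6.le]
        field_simp
    _ ≤ _ := by
        unfold cesaroWeight
        gcongr
        exact (cesaro_pos (by linarith) _).le

theorem rpow_le_cesaroScale {α : ℝ} (h1 : α ≤ 1) (n k : ℕ) :
    ((n : ℝ) + 1) ^ α ≤ cesaroScale α n k := by
  unfold cesaroScale
  refine le_mul_of_one_le_left (by positivity) (Real.one_le_rpow ?_ (by linarith))
  linarith [(k.cast_nonneg : (0 : ℝ) ≤ k)]

/-! ### Power sums -/

theorem rpow_sub_one_le_mul_sub {s : ℝ} (hs : 0 < s) (n : ℕ) :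
    min s 1 * ((n : ℝ) + 1) ^ (s - 1) ≤ ((n : ℝ) + 1) ^ s - (n : ℝ) ^ s := by
  have hx : (0 : ℝ) < n + 1 := by positivity
  have hi : 1 / ((n : ℝ) + 1) ≤ 1 := by
    rw [div_le_one hx]; linarith [(n.cast_nonneg : (0 : ℝ) ≤ n)]
  have key : (1 + -(1 / ((n : ℝ) + 1))) ^ s ≤ 1 - min s 1 * (1 / (n + 1)) := by
    rcases le_total s 1 with h | h
    · rw [min_eq_left h]
      refine (rpow_one_add_le_one_add_mul_self (by linarith) hs.le h).trans_eq (by ring)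
    · rw [min_eq_right h]
      have hp : 0 < 1 / ((n : ℝ) + 1) := by positivity
      refine (Real.rpow_le_rpow_of_exponent_ge' (by linarith) (by linarith) zero_le_one h).trans ?_
      rw [Real.rpow_one]; linarith
  have e : (n : ℝ) ^ s = ((n : ℝ) + 1) ^ s * (1 + -(1 / ((n : ℝ) + 1))) ^ s := by
    rw [← Real.mul_rpow hx.le (by linarith)]
    congr 1; field_simp; ring
  rw [e, Real.rpow_sub_one hx.ne']
  have h0 : (0 : ℝ) < ((n : ℝ) + 1) ^ s := by positivity
  calc min s 1 * (((n : ℝ) + 1) ^ s / (n + 1))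
      = ((n : ℝ) + 1) ^ s - ((n : ℝ) + 1) ^ s * (1 - min s 1 * (1 / (n + 1))) := by ring
    _ ≤ _ := by gcongr

theorem sum_rpow_sub_one_le {s : ℝ} (hs : 0 < s) (N : ℕ) :
    ∑ n ∈ Finset.range N, ((n : ℝ) + 1) ^ (s - 1) ≤ (min s 1)⁻¹ * (N : ℝ) ^ s := by
  have h0 : 0 < min s 1 := lt_min hs one_pos
  rw [← div_eq_inv_mul, le_div_iff₀' h0, Finset.mul_sum]
  calc _ ≤ ∑ n ∈ Finset.range N, (((n + 1 : ℕ) : ℝ) ^ s - (n : ℝ) ^ s) := by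
        refine Finset.sum_le_sum fun n _ => ?_
        push_cast
        exact rpow_sub_one_le_mul_sub hs n
    _ = _ := by
        rw [Finset.sum_range_sub fun n : ℕ => (n : ℝ) ^ s]
        simp [hs.ne']

theorem tsum_ite_add_one_le (f : ℕ → ℝ≥0∞) {R : ℝ} (hR : 0 ≤ R) :
    ∑' n : ℕ, (if (n : ℝ) + 1 ≤ R then f n else 0) = ∑ n ∈ Finset.range ⌊R⌋₊, f n := by
  have h : ∀ n : ℕ, (n : ℝ) + 1 ≤ R ↔ n ∈ Finset.range ⌊R⌋₊ := fun n => by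
    rw [Finset.mem_range, ← Nat.succ_le_iff, Nat.le_floor_iff hR]
    push_cast
    rfl
  rw [tsum_eq_sum (s := Finset.range ⌊R⌋₊) fun n hn => if_neg (mt (h n).1 hn)]
  exact Finset.sum_congr rfl fun n hn => if_pos ((h n).2 hn)

theorem tsum_rpow_sub_one_le {s : ℝ} (hs : 0 < s) {R : ℝ} (hR : 0 ≤ R) :
    ∑' n : ℕ, (if (n : ℝ) + 1 ≤ R then ENNReal.ofReal (((n : ℝ) + 1) ^ (s - 1)) else 0) ≤
      ENNReal.ofReal ((min s 1)⁻¹ * R ^ s) := by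
  rw [tsum_ite_add_one_le _ hR, ← ENNReal.ofReal_sum_of_nonneg fun n _ => by positivity]
  refine ENNReal.ofReal_le_ofReal ((sum_rpow_sub_one_le hs _).trans ?_)
  have h0 : 0 < min s 1 := lt_min hs one_pos
  gcongr
  exact Nat.floor_le hR

/-- Summing over the block `[N - N/2, N]` with `N = ⌊R⌋` is enough for the lower bound, and
keeps the indices above `R / 4`. -/
theorem exists_le_tsum_rpow (r : ℝ) : ∃ c : ℝ, 0 < c ∧ ∀ R : ℝ, 2 ≤ R →
    ENNReal.ofReal (c * R ^ (r - 1)) ≤ ∑' n : ℕ, (if R / 4 ≤ (n : ℝ) + 1 ∧ (n : ℝ) + 1 ≤ R then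
      ENNReal.ofReal (((n : ℝ) + 1) ^ (r - 2)) else 0) := by
  refine ⟨min ((1 / 4) ^ (r - 2)) 1 / 4, by positivity, fun R hR => ?_⟩
  set N := ⌊R⌋₊ with hN
  have hN2 : 2 ≤ N := Nat.le_floor (by exact_mod_cast hR)
  have hNR : (N : ℝ) ≤ R := Nat.floor_le (by linarith)
  have hRN : R < N + 1 := Nat.lt_floor_add_one R
  have hRN2 : R ≤ 2 * N := by
    have : (2 : ℝ) ≤ N := by exact_mod_cast hN2
    linarith
  set D := min ((1 / 4 : ℝ) ^ (r - 2)) 1 * R ^ (r - 2) with hD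
  have term : ∀ n ∈ Finset.Ico (N - N / 2 - 1) N, (R / 4 ≤ (n : ℝ) + 1 ∧ (n : ℝ) + 1 ≤ R) ∧
      D ≤ ((n : ℝ) + 1) ^ (r - 2) := by
    intro n hn
    rw [Finset.mem_Ico] at hn
    have h1 : (n : ℝ) + 1 ≤ R := le_trans (by exact_mod_cast hn.2) hNR
    have h2 : R / 4 ≤ (n : ℝ) + 1 := by
      have h3 : N ≤ 2 * (n + 1) := by omega
      have h4 : (N : ℝ) ≤ 2 * (n + 1) := by exact_mod_cast h3
      linarith
    refine ⟨⟨h2, h1⟩, ?_⟩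
    rcases le_total 2 r with h | h
    · calc D ≤ (1 / 4) ^ (r - 2) * R ^ (r - 2) := by
            rw [hD]; gcongr; exact min_le_left _ _
        _ = (R / 4) ^ (r - 2) := by
            rw [← Real.mul_rpow (by norm_num) (by linarith)]; congr 1; ring
        _ ≤ _ := Real.rpow_le_rpow (by linarith) h2 (by linarith)
    · calc D ≤ 1 * R ^ (r - 2) := by
            rw [hD]; gcongr; exact min_le_right _ _
        _ = R ^ (r - 2) := one_mul _
        _ ≤ _ := Real.rpow_le_rpow_of_nonpos (by positivity) h1 (by linarith)
  have hD0 : 0 ≤ D := by positivity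
  have hcard : (Finset.Ico (N - N / 2 - 1) N).card = N / 2 + 1 := by
    rw [Nat.card_Ico]; omega
  calc ENNReal.ofReal (min ((1 / 4) ^ (r - 2)) 1 / 4 * R ^ (r - 1))
      ≤ ENNReal.ofReal (((N / 2 + 1 : ℕ) : ℝ) * D) := by
        apply ENNReal.ofReal_le_ofReal
        have e : min ((1 / 4) ^ (r - 2)) 1 / 4 * R ^ (r - 1) = R / 4 * D := by
          rw [hD, show r - 1 = (r - 2) + 1 by ring, Real.rpow_add_one (by linarith)]; ring
        rw [e]
        gcongr
        have h3 : N ≤ 2 * (N / 2 + 1) := by omega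
        have h4 : (N : ℝ) ≤ 2 * ((N / 2 + 1 : ℕ) : ℝ) := by exact_mod_cast h3
        linarith
    _ = ∑ n ∈ Finset.Ico (N - N / 2 - 1) N, ENNReal.ofReal D := by
        rw [Finset.sum_const, hcard, ENNReal.ofReal_mul (by positivity), nsmul_eq_mul,
          ENNReal.ofReal_natCast]
    _ ≤ ∑ n ∈ Finset.Ico (N - N / 2 - 1) N, (if R / 4 ≤ (n : ℝ) + 1 ∧ (n : ℝ) + 1 ≤ R then
          ENNReal.ofReal (((n : ℝ) + 1) ^ (r - 2)) else 0) := by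
        refine Finset.sum_le_sum fun n hn => ?_
        rw [if_pos (term n hn).1]
        exact ENNReal.ofReal_le_ofReal (term n hn).2
    _ ≤ _ := ENNReal.sum_le_tsum _

/-! ### The moment function and the counting of the reciprocal weights -/

/-- The weight `N^{r-2}` of the reciprocal weight with index `p = (n, k)`, where `N = n + 1` and
`k ≤ N`; the other pairs get weight zero. -/
noncomputable def indexWeight (r : ℝ) (p : ℕ × ℕ) : ℝ≥0∞ :=
  if p.2 ≤ p.1 + 1 then ENNReal.ofReal (((p.1 : ℝ) + 1) ^ (r - 2)) else 0

/-- The function whose Choquet expectation at `|X|` appears in the moment condition. -/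
noncomputable def momentFun (α r t : ℝ) : ℝ :=
  if α < 1 - 1 / r then t ^ ((r - 1) / α)
  else if α = 1 - 1 / r then t ^ r * Real.log (1 + t) else t ^ r

theorem momentFun_nonneg (α r : ℝ) {t : ℝ} (ht : 0 ≤ t) : 0 ≤ momentFun α r t := by
  have := Real.log_nonneg (show (1 : ℝ) ≤ 1 + t by linarith)
  unfold momentFun
  split_ifs <;> positivity

theorem lt_div_of_lt_one_sub {α r : ℝ} (h0 : 0 < α) (hr : 1 ≤ r) (h : α < 1 - 1 / r) :
    r < (r - 1) / α := by
  have hr0 : 0 < r := by linarith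
  rw [lt_div_iff₀ h0]
  have := mul_lt_mul_of_pos_left h hr0
  rw [mul_sub, mul_one_div_cancel hr0.ne'] at this
  linarith

theorem momentFun_monotoneOn {α r : ℝ} (h0 : 0 < α) (hr : 1 ≤ r) :
    MonotoneOn (momentFun α r) (Ici 0) := by
  intro s hs t ht hst
  have hs0 : (0 : ℝ) ≤ s := hs
  have ht0 : (0 : ℝ) ≤ t := ht
  unfold momentFun
  split_ifs with h h'
  · exact Real.rpow_le_rpow hs0 hst (div_nonneg (by linarith) h0.le)
  · have := Real.log_nonneg (show (1 : ℝ) ≤ 1 + s by linarith)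
    gcongr
  · exact Real.rpow_le_rpow hs0 hst (by linarith)

theorem continuousOn_momentFun {α r : ℝ} (h0 : 0 < α) (hr : 1 ≤ r) :
    ContinuousOn (momentFun α r) (Ici 0) := by
  unfold momentFun
  split_ifs with h h'
  · exact (Real.continuous_rpow_const (div_nonneg (by linarith) h0.le)).continuousOn
  · refine (Real.continuous_rpow_const (by linarith)).continuousOn.mul
      (ContinuousOn.log (by fun_prop) fun t ht => ?_)
    have : (0 : ℝ) ≤ t := ht
    linarith
  · exact (Real.continuous_rpow_const (by linarith)).continuousOn

/-- The moment function dominates the `r`-th power away from the origin. -/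
theorem rpow_le_momentFun {α r : ℝ} (h0 : 0 < α) (hr : 1 ≤ r) {t : ℝ} (ht : 1 ≤ t) :
    t ^ r ≤ (Real.log 2)⁻¹ * momentFun α r t := by
  have hl : 0 < Real.log 2 := Real.log_pos (by norm_num)
  have hl1 : Real.log 2 ≤ 1 := by linarith [Real.log_two_lt_d9]
  have htr : 0 < t ^ r := by positivity
  rw [← div_eq_inv_mul, le_div_iff₀ hl]
  unfold momentFun
  split_ifs with h h'
  · calc t ^ r * Real.log 2 ≤ t ^ r * 1 := by gcongr
      _ = t ^ r := mul_one _
      _ ≤ _ := Real.rpow_le_rpow_of_exponent_le ht (lt_div_of_lt_one_sub h0 hr h).le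
  · have : Real.log 2 ≤ Real.log (1 + t) := Real.log_le_log (by norm_num) (by linarith)
    gcongr
  · nlinarith

theorem exists_momentFun_eq {α r : ℝ} (h0 : 0 < α) (hr : 1 ≤ r) {x : ℝ} (hx : 0 < x) :
    ∃ t, 0 ≤ t ∧ momentFun α r t = x := by
  have hl : 0 < Real.log 2 := Real.log_pos (by norm_num)
  set M := max 1 ((Real.log 2)⁻¹ * x) with hM
  have hM1 : 1 ≤ M := le_max_left _ _
  have hlarge : x ≤ momentFun α r M := by
    have h1 := rpow_le_momentFun h0 hr hM1
    have h2 : M ≤ M ^ r := by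
      simpa using Real.rpow_le_rpow_of_exponent_le hM1 hr
    have h3 : (Real.log 2)⁻¹ * x ≤ (Real.log 2)⁻¹ * momentFun α r M :=
      (le_max_right _ _).trans (h2.trans h1)
    exact le_of_mul_le_mul_left h3 (by positivity)
  have hzero : momentFun α r 0 ≤ x := by
    have hr0 : r ≠ 0 := by linarith
    unfold momentFun
    split_ifs with h h'
    · have := lt_div_of_lt_one_sub h0 hr h
      rw [Real.zero_rpow (by linarith)]; exact hx.le
    · simpa using hx.le
    · rw [Real.zero_rpow hr0]; exact hx.le
  obtain ⟨t, ht, h⟩ := intermediate_value_Icc (by linarith : (0 : ℝ) ≤ M)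
    ((continuousOn_momentFun h0 hr).mono Icc_subset_Ici_self) ⟨hzero, hlarge⟩
  exact ⟨t, ht.1, h⟩

theorem momentFun_mul_le_of_le_one {α r : ℝ} (h0 : 0 < α) (hr : 1 ≤ r) {l t : ℝ} (hl0 : 0 < l)
    (hl : l ≤ 1) (ht : 0 ≤ t) : momentFun α r (l * t) ≤ l ^ r * momentFun α r t := by
  unfold momentFun
  split_ifs with h h'
  · rw [Real.mul_rpow hl0.le ht]
    gcongr ?_ * _
    exact Real.rpow_le_rpow_of_exponent_ge hl0 hl (lt_div_of_lt_one_sub h0 hr h).le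
  · rw [Real.mul_rpow hl0.le ht, ← mul_assoc]
    gcongr
    nlinarith
  · rw [Real.mul_rpow hl0.le ht]

theorem momentFun_mul_le_of_one_le (α r : ℝ) {l t : ℝ} (hl : 1 ≤ l)
    (ht : 0 ≤ t) : momentFun α r (l * t) ≤
      max (l ^ ((r - 1) / α)) (l ^ r * l) * momentFun α r t := by
  have hl0 : 0 ≤ l := by linarith
  unfold momentFun
  split_ifs with h h'
  · rw [Real.mul_rpow hl0 ht]
    gcongr
    exact le_max_left _ _
  · rw [Real.mul_rpow hl0 ht]
    have h1 : Real.log (1 + l * t) ≤ l * Real.log (1 + t) := by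
      rw [← Real.log_rpow (by linarith)]
      exact Real.log_le_log (by positivity)
        (one_add_mul_self_le_rpow_one_add (by linarith) hl)
    have h2 := Real.log_nonneg (show (1 : ℝ) ≤ 1 + t by linarith)
    calc l ^ r * t ^ r * Real.log (1 + l * t) ≤ l ^ r * t ^ r * (l * Real.log (1 + t)) := by
          gcongr
      _ = (l ^ r * l) * (t ^ r * Real.log (1 + t)) := by ring
      _ ≤ _ := by
          gcongr
          exact le_max_right _ _
  · rw [Real.mul_rpow hl0 ht]
    gcongr
    refine le_trans ?_ (le_max_right _ _)
    exact le_mul_of_one_le_right (by positivity) hl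

/-- Summing the index weights over `n` first. The exponent `δ` trades powers of `n` for powers of
`k ≤ n + 1` and makes the sum over `n` grow like a power even if `r = 1`. -/
theorem tsum_indexWeight_le {α r δ : ℝ} (h0 : 0 < α) (h1 : α ≤ 1) (hδ : 0 ≤ δ)
    (hs : 0 < r - 1 + δ) {T : ℝ} (hT : 0 ≤ T) :
    ∑' p : ℕ × ℕ, (if cesaroScale α p.1 p.2 ≤ T then indexWeight r p else 0) ≤
      ENNReal.ofReal (2 ^ δ * (min (r - 1 + δ) 1)⁻¹ * T ^ ((r - 1 + δ) / α)) *
        ∑' k : ℕ, (if (k : ℝ) + 1 ≤ 2 * T then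
          ENNReal.ofReal (((k : ℝ) + 1) ^ (-(δ + (1 - α) * ((r - 1 + δ) / α)))) else 0) := by
  rw [ENNReal.tsum_prod', ENNReal.tsum_comm, ← ENNReal.tsum_mul_left]
  refine ENNReal.tsum_le_tsum fun k => ?_
  set s := r - 1 + δ with hs'
  set m : ℝ := (k : ℝ) + 1 with hm
  have hm0 : 0 < m := by positivity
  set R : ℝ := (T * m ^ (α - 1)) ^ (1 / α) with hR
  have hR0 : 0 ≤ R := by positivity
  have hmin : 0 < min s 1 := lt_min hs one_pos
  have term : ∀ n : ℕ, (if cesaroScale α n k ≤ T then indexWeight r (n, k) else 0) ≤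
      (if m ≤ 2 * T then ENNReal.ofReal (2 ^ δ * m ^ (-δ)) else 0) *
      (if (n : ℝ) + 1 ≤ R then ENNReal.ofReal (((n : ℝ) + 1) ^ (s - 1)) else 0) := by
    intro n
    by_cases hc : cesaroScale α n k ≤ T
    swap
    · simp [hc]
    by_cases hk : k ≤ n + 1
    swap
    · simp [indexWeight, hk]
    have hM0 : (0 : ℝ) < n + 1 := by positivity
    have hmM : m / 2 ≤ (n : ℝ) + 1 := by
      have : (k : ℝ) ≤ n + 1 := by exact_mod_cast hk
      have hn0 : (0 : ℝ) ≤ n := n.cast_nonneg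
      rw [hm]; linarith
    have hmT : m ≤ 2 * T := by
      have h2 : m / 2 ≤ cesaroScale α n k := by
        calc m / 2 = (m / 2) ^ (1 - α) * (m / 2) ^ α := by
              rw [← Real.rpow_add (by positivity)]; simp
          _ ≤ m ^ (1 - α) * ((n : ℝ) + 1) ^ α := by
              gcongr
              linarith
      linarith
    have hMR : (n : ℝ) + 1 ≤ R := by
      rw [hR, one_div, Real.le_rpow_inv_iff_of_pos hM0.le (by positivity) h0]
      have : m ^ (1 - α) * ((n : ℝ) + 1) ^ α ≤ T := hc
      rw [show α - 1 = -(1 - α) by ring, Real.rpow_neg hm0.le, ← div_eq_mul_inv,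
        le_div_iff₀ (by positivity)]
      linarith
    rw [if_pos hc, if_pos hmT, if_pos hMR, indexWeight, if_pos hk,
      ← ENNReal.ofReal_mul (by positivity)]
    apply ENNReal.ofReal_le_ofReal
    have e : ((n : ℝ) + 1) ^ (r - 2) = ((n : ℝ) + 1) ^ (-δ) * ((n : ℝ) + 1) ^ (s - 1) := by
      rw [← Real.rpow_add hM0]; congr 1; rw [hs']; ring
    dsimp only
    rw [e]
    gcongr
    calc ((n : ℝ) + 1) ^ (-δ) ≤ (m / 2) ^ (-δ) :=
          Real.rpow_le_rpow_of_nonpos (by positivity) hmM (by linarith)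
      _ = 2 ^ δ * m ^ (-δ) := by
          rw [Real.div_rpow hm0.le (by norm_num), Real.rpow_neg (by norm_num : (0 : ℝ) ≤ 2),
            div_inv_eq_mul, mul_comm]
  refine (ENNReal.tsum_le_tsum term).trans ?_
  rw [ENNReal.tsum_mul_left]
  refine (mul_le_mul_right (tsum_rpow_sub_one_le hs hR0) _).trans ?_
  split_ifs
  · rw [← ENNReal.ofReal_mul (by positivity), ← ENNReal.ofReal_mul (by positivity)]
    apply ENNReal.ofReal_le_ofReal
    apply le_of_eq
    have e : R ^ s = T ^ (s / α) * m ^ ((α - 1) * (s / α)) := by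
      rw [hR, ← Real.rpow_mul (by positivity), Real.mul_rpow hT (by positivity),
        ← Real.rpow_mul hm0.le]
      congr 2 <;> ring
    rw [e, show -(δ + (1 - α) * (s / α)) = -δ + (α - 1) * (s / α) by ring, Real.rpow_add hm0]
    ring
  · simp

theorem log_one_add_bound {T : ℝ} (hT : 1 ≤ 2 * T) :
    1 + Real.log (2 * T) ≤ (1 + (1 + Real.log 2) / Real.log (3 / 2)) * Real.log (1 + T) := by
  have h32 : 0 < Real.log (3 / 2) := Real.log_pos (by norm_num)
  have hl2 : 0 < Real.log 2 := Real.log_pos (by norm_num)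
  have h1 : Real.log (3 / 2) ≤ Real.log (1 + T) := Real.log_le_log (by norm_num) (by linarith)
  have h2 : Real.log (2 * T) ≤ Real.log 2 + Real.log (1 + T) := by
    rw [← Real.log_mul (by norm_num) (by linarith)]
    exact Real.log_le_log (by linarith) (by linarith)
  have h3 : 1 + Real.log 2 ≤ (1 + Real.log 2) / Real.log (3 / 2) * Real.log (1 + T) := by
    calc 1 + Real.log 2 = (1 + Real.log 2) / Real.log (3 / 2) * Real.log (3 / 2) := by
          field_simp
      _ ≤ _ := by gcongr
  linarith

/-- The total index weight of the scales up to `T` is at most of the order of the moment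
function. -/
theorem exists_tsum_indexWeight_le {α r : ℝ} (h0 : 0 < α) (h1 : α ≤ 1) (hr : 1 ≤ r) :
    ∃ K : ℝ, 0 ≤ K ∧ ∀ T : ℝ, 0 ≤ T →
      ∑' p : ℕ × ℕ, (if cesaroScale α p.1 p.2 ≤ T then indexWeight r p else 0) ≤
        ENNReal.ofReal (K * momentFun α r T) := by
  have hr0 : 0 < r := by linarith
  rcases lt_trichotomy α (1 - 1 / r) with h | h | h
  · -- the exponent of `k` is below `-1`
    have hr1 : 0 < r - 1 := by
      have := lt_div_of_lt_one_sub h0 hr h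
      by_contra hle
      have : (r - 1) / α ≤ 0 := div_nonpos_of_nonpos_of_nonneg (not_lt.1 hle) h0.le
      linarith
    set q := 0 + (1 - α) * ((r - 1 + 0) / α) with hq
    have hq1 : 1 < q := by
      have := lt_div_of_lt_one_sub h0 hr h
      have e : q = (r - 1) / α - (r - 1) := by rw [hq]; field_simp; ring
      linarith
    have hsum : Summable fun k : ℕ => ((k : ℝ) + 1) ^ (-q) := by
      have := (summable_nat_add_iff 1).2 (Real.summable_nat_rpow.2 (show -q < -1 by linarith))
      simpa using this
    refine ⟨(min (r - 1) 1)⁻¹ * ∑' k : ℕ, ((k : ℝ) + 1) ^ (-q), ?_, fun T hT => ?_⟩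
    · have := lt_min hr1 one_pos
      have : 0 ≤ ∑' k : ℕ, ((k : ℝ) + 1) ^ (-q) := tsum_nonneg fun k => by positivity
      positivity
    refine (tsum_indexWeight_le h0 h1 le_rfl (by linarith) hT).trans ?_
    have hT' : ∑' k : ℕ, (if (k : ℝ) + 1 ≤ 2 * T then ENNReal.ofReal (((k : ℝ) + 1) ^ (-q)) else 0)
        ≤ ENNReal.ofReal (∑' k : ℕ, ((k : ℝ) + 1) ^ (-q)) := by
      rw [ENNReal.ofReal_tsum_of_nonneg (fun k => by positivity) hsum]
      refine ENNReal.tsum_le_tsum fun k => ?_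
      split_ifs <;> simp
    refine (mul_le_mul_right hT' _).trans (le_of_eq ?_)
    have := lt_min (show 0 < r - 1 + 0 by linarith) one_pos
    rw [← ENNReal.ofReal_mul (by positivity), momentFun, if_pos h]
    congr 1
    simp
    ring
  · have hr1 : 0 < r - 1 := by
      have e : r * α = r - 1 := by rw [h]; field_simp
      rw [← e]; positivity
    have hrα : (r - 1) / α = r := by
      rw [div_eq_iff h0.ne', h]; field_simp
    have hmin := lt_min hr1 one_pos
    have h32 : 0 < Real.log (3 / 2) := Real.log_pos (by norm_num)
    have hl2 : 0 < Real.log 2 := Real.log_pos (by norm_num)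
    refine ⟨(min (r - 1) 1)⁻¹ * (1 + (1 + Real.log 2) / Real.log (3 / 2)), by positivity,
      fun T hT => ?_⟩
    refine (tsum_indexWeight_le h0 h1 le_rfl (by linarith) hT).trans ?_
    have hq : -(0 + (1 - α) * ((r - 1 + 0) / α)) = -1 := by
      rw [add_zero, hrα]
      have : r * α = r - 1 := by rw [h]; field_simp
      linarith
    rw [hq, tsum_ite_add_one_le _ (by positivity),
      ← ENNReal.ofReal_sum_of_nonneg fun n _ => by positivity,
      ← ENNReal.ofReal_mul (by simp only [add_zero]; positivity)]
    have hl : 0 ≤ Real.log (1 + T) := Real.log_nonneg (by linarith)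
    have key : ∑ k ∈ Finset.range ⌊2 * T⌋₊, ((k : ℝ) + 1) ^ (-1 : ℝ) ≤
        (1 + (1 + Real.log 2) / Real.log (3 / 2)) * Real.log (1 + T) := by
      rcases lt_or_ge (2 * T) 1 with h2 | h2
      · rw [Nat.floor_eq_zero.2 h2]
        simp only [Finset.range_zero, Finset.sum_empty]
        positivity
      · refine le_trans ?_ (log_one_add_bound h2)
        have h3 := harmonic_le_one_add_log ⌊2 * T⌋₊
        rw [harmonic] at h3
        push_cast at h3
        simp only [Real.rpow_neg_one]
        refine h3.trans ?_
        gcongr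
        · exact_mod_cast Nat.floor_pos.2 h2
        · exact Nat.floor_le (by linarith)
    apply ENNReal.ofReal_le_ofReal
    rw [momentFun, if_neg h.not_lt, if_pos h]
    simp only [add_zero, Real.rpow_zero, one_mul]
    rw [hrα]
    calc _ ≤ (min (r - 1) 1)⁻¹ * T ^ r *
          ((1 + (1 + Real.log 2) / Real.log (3 / 2)) * Real.log (1 + T)) := by gcongr
      _ = _ := by ring
  · -- half of the largest admissible shift `δ`
    set δ := (1 - r + α * r) / 2 with hδ
    have hαr : r - 1 < α * r := by
      have := mul_lt_mul_of_pos_right h hr0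
      rwa [sub_mul, one_div_mul_cancel hr0.ne', one_mul] at this
    have hδ0 : 0 < δ := by rw [hδ]; linarith
    set s := r - 1 + δ with hs
    have hs0 : 0 < s := by linarith
    set q := δ + (1 - α) * (s / α) with hq
    have hq1 : 0 < 1 - q := by
      have e : 1 - q = δ / α := by
        rw [hq, hs, hδ]; field_simp; ring
      rw [e]; positivity
    have hexp : s / α + (1 - q) = r := by
      rw [hq, hs]; field_simp; ring
    have hm1 := lt_min hs0 one_pos
    have hm2 := lt_min hq1 one_pos
    refine ⟨2 ^ δ * (min s 1)⁻¹ * ((min (1 - q) 1)⁻¹ * 2 ^ (1 - q)), by positivity,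
      fun T hT => ?_⟩
    refine (tsum_indexWeight_le h0 h1 hδ0.le hs0 hT).trans ?_
    have h2 := tsum_rpow_sub_one_le hq1 (R := 2 * T) (by positivity)
    rw [show 1 - q - 1 = -q by ring] at h2
    refine (mul_le_mul_right h2 _).trans ?_
    rw [← ENNReal.ofReal_mul (by positivity)]
    apply ENNReal.ofReal_le_ofReal
    rw [momentFun, if_neg h.not_gt, if_neg h.ne']
    rcases hT.eq_or_lt with rfl | hT0
    · rw [mul_zero, Real.zero_rpow hr0.ne', Real.zero_rpow hq1.ne']
      simp
    conv_rhs => rw [← hexp, Real.rpow_add hT0]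
    rw [Real.mul_rpow (by norm_num) hT]
    apply le_of_eq
    ring

/-- Lower bound for the total index weight of the scales up to `T`, from the indices `n` of the
order of the largest admissible one. -/
theorem exists_le_tsum_indexWeight {α : ℝ} (r : ℝ) (h0 : 0 < α) (h1 : α ≤ 1) :
    ∃ c : ℝ, 0 < c ∧ ∀ T : ℝ, 0 ≤ T →
      ∑' k : ℕ, (if (k : ℝ) + 1 ≤ T / 4 then ENNReal.ofReal
        (c * T ^ ((r - 1) / α) * ((k : ℝ) + 1) ^ (-((1 - α) * ((r - 1) / α)))) else 0) ≤
      ∑' p : ℕ × ℕ, (if cesaroScale α p.1 p.2 ≤ T then indexWeight r p else 0) := by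
  obtain ⟨c, hc, hsum⟩ := exists_le_tsum_rpow r
  refine ⟨c, hc, fun T hT => ?_⟩
  rw [ENNReal.tsum_prod', ENNReal.tsum_comm]
  refine ENNReal.tsum_le_tsum fun k => ?_
  split_ifs with hk
  swap
  · exact zero_le
  set m : ℝ := (k : ℝ) + 1 with hm
  have hm0 : 0 < m := by positivity
  set R : ℝ := (T * m ^ (α - 1)) ^ (1 / α) with hR
  have hRm : 4 * m ≤ R := by
    rw [hR, one_div, Real.le_rpow_inv_iff_of_pos (by positivity) (by positivity) h0,
      Real.mul_rpow (by norm_num) hm0.le, Real.rpow_sub_one hm0.ne', ← mul_div_assoc,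
      le_div_iff₀ hm0]
    have h4 : (4 : ℝ) ^ α ≤ 4 := by
      simpa using Real.rpow_le_rpow_of_exponent_le (show (1 : ℝ) ≤ 4 by norm_num) h1
    have : (0 : ℝ) < m ^ α := by positivity
    calc (4 : ℝ) ^ α * m ^ α * m ≤ 4 * m ^ α * m := by gcongr
      _ = (4 * m) * m ^ α := by ring
      _ ≤ T * m ^ α := by gcongr; linarith
  have hm1 : 1 ≤ m := by rw [hm]; linarith [(k.cast_nonneg : (0 : ℝ) ≤ k)]
  have e : c * T ^ ((r - 1) / α) * m ^ (-((1 - α) * ((r - 1) / α))) = c * R ^ (r - 1) := by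
    rw [hR, ← Real.rpow_mul (by positivity), Real.mul_rpow hT (by positivity),
      ← Real.rpow_mul hm0.le, mul_assoc]
    congr 3 <;> ring
  rw [e]
  refine (hsum R (by linarith)).trans (ENNReal.tsum_le_tsum fun n => ?_)
  split_ifs with hn hs hs
  · have hkn : k ≤ n + 1 := by
      have : (k : ℝ) ≤ ((n + 1 : ℕ) : ℝ) := by push_cast; rw [hm] at hRm; linarith [hn.1]
      exact_mod_cast this
    rw [indexWeight, if_pos hkn]
  · refine absurd ?_ hs
    have h3 := hn.2
    rw [hR, one_div, Real.le_rpow_inv_iff_of_pos (by positivity) (by positivity) h0,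
      show α - 1 = -(1 - α) by ring, Real.rpow_neg hm0.le, ← div_eq_mul_inv,
      le_div_iff₀ (by positivity)] at h3
    rw [cesaroScale]
    dsimp only
    linarith
  · exact zero_le
  · exact zero_le

/-- The moment function is at most of the order of the total index weight of the scales up to
`T`. -/
theorem exists_momentFun_le {α r : ℝ} (h0 : 0 < α) (h1 : α ≤ 1) (hr : 1 ≤ r) :
    ∃ K : ℝ, ∀ T : ℝ, 0 ≤ T → ENNReal.ofReal (momentFun α r T) ≤ ENNReal.ofReal K *
      (1 + ∑' p : ℕ × ℕ, (if cesaroScale α p.1 p.2 ≤ T then indexWeight r p else 0)) := by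
  have hr0 : 0 < r := by linarith
  obtain ⟨c, hc, hsum⟩ := exists_le_tsum_indexWeight r h0 h1
  suffices key : ∃ K, ∀ T : ℝ, 4 ≤ T →
      momentFun α r T ≤ K * (c * T ^ ((r - 1) / α) * ∑ k ∈ Finset.range ⌊T / 4⌋₊,
        ((k : ℝ) + 1) ^ (-((1 - α) * ((r - 1) / α)))) by
    obtain ⟨K, hK⟩ := key
    refine ⟨max K (momentFun α r 4), fun T hT => ?_⟩
    rcases le_total T 4 with h4 | h4
    · calc ENNReal.ofReal (momentFun α r T) ≤ ENNReal.ofReal (max K (momentFun α r 4)) * 1 := by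
            rw [mul_one]
            apply ENNReal.ofReal_le_ofReal
            exact (momentFun_monotoneOn h0 hr (mem_Ici.2 hT) (by simp) h4).trans
              (le_max_right _ _)
        _ ≤ _ := by gcongr; exact le_self_add
    · set A := c * T ^ ((r - 1) / α) * ∑ k ∈ Finset.range ⌊T / 4⌋₊,
        ((k : ℝ) + 1) ^ (-((1 - α) * ((r - 1) / α))) with hA
      have hA0 : 0 ≤ A := mul_nonneg (by positivity)
        (Finset.sum_nonneg fun k _ => by positivity)
      have hAle : ENNReal.ofReal A ≤
          ∑' p : ℕ × ℕ, (if cesaroScale α p.1 p.2 ≤ T then indexWeight r p else 0) := by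
        refine le_trans (le_of_eq ?_) (hsum T hT)
        rw [tsum_ite_add_one_le _ (by positivity),
          ← ENNReal.ofReal_sum_of_nonneg fun n _ => by positivity, hA, Finset.mul_sum]
      calc ENNReal.ofReal (momentFun α r T)
          ≤ ENNReal.ofReal (max K (momentFun α r 4) * A) := by
            apply ENNReal.ofReal_le_ofReal
            refine (hK T h4).trans ?_
            gcongr
            exact le_max_left _ _
        _ = ENNReal.ofReal (max K (momentFun α r 4)) * ENNReal.ofReal A :=
            ENNReal.ofReal_mul ((momentFun_nonneg α r (by norm_num)).trans (le_max_right _ _))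
        _ ≤ _ := by gcongr; exact hAle.trans le_add_self
  have hfl : ∀ T : ℝ, 4 ≤ T → 1 ≤ ⌊T / 4⌋₊ := fun T hT => Nat.floor_pos.2 (by linarith)
  -- the first summand is one
  have hone : ∀ (q T : ℝ), 4 ≤ T → 1 ≤ ∑ k ∈ Finset.range ⌊T / 4⌋₊, ((k : ℝ) + 1) ^ (-q) := by
    intro q T hT
    calc (1 : ℝ) = (((0 : ℕ) : ℝ) + 1) ^ (-q) := by simp
      _ ≤ _ := Finset.single_le_sum (f := fun k : ℕ => ((k : ℝ) + 1) ^ (-q))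
          (fun k _ => by positivity) (Finset.mem_range.2 (hfl T hT))
  rcases lt_trichotomy α (1 - 1 / r) with h | h | h
  · refine ⟨c⁻¹, fun T hT => ?_⟩
    rw [momentFun, if_pos h, ← mul_assoc, ← mul_assoc, inv_mul_cancel₀ hc.ne', one_mul]
    exact le_mul_of_one_le_right (by positivity) (hone _ T hT)
  · have hrα : (r - 1) / α = r := by
      rw [div_eq_iff h0.ne', h]; field_simp
    have hq : (1 - α) * ((r - 1) / α) = 1 := by
      have : r * α = r - 1 := by rw [h]; field_simp
      rw [hrα]; linarith
    refine ⟨c⁻¹ * (1 + Real.log 8), fun T hT => ?_⟩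
    rw [momentFun, if_neg h.not_lt, if_pos h, hq, hrα]
    set σ := ∑ k ∈ Finset.range ⌊T / 4⌋₊, ((k : ℝ) + 1) ^ (-(1 : ℝ)) with hσ
    have h8 : 0 < Real.log 8 := Real.log_pos (by norm_num)
    have hσ1 : 1 ≤ σ := hone 1 T hT
    have hσlog : Real.log (T / 4) ≤ σ := by
      have h3 := log_add_one_le_harmonic ⌊T / 4⌋₊
      rw [harmonic] at h3
      push_cast at h3
      simp only [hσ, Real.rpow_neg_one]
      refine le_trans (Real.log_le_log (by linarith) ?_) h3
      exact_mod_cast (Nat.lt_floor_add_one (T / 4)).le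
    have hlog : Real.log (1 + T) ≤ Real.log (T / 4) + Real.log 8 := by
      rw [← Real.log_mul (by linarith) (by norm_num)]
      exact Real.log_le_log (by linarith) (by linarith)
    have hlog' : Real.log (1 + T) ≤ (1 + Real.log 8) * σ := by nlinarith
    have hcc : c⁻¹ * c = 1 := inv_mul_cancel₀ hc.ne'
    calc T ^ r * Real.log (1 + T) ≤ T ^ r * ((1 + Real.log 8) * σ) := by gcongr
      _ = (c⁻¹ * c) * (T ^ r * ((1 + Real.log 8) * σ)) := by rw [hcc, one_mul]
      _ = _ := by ring
  · set q := (1 - α) * ((r - 1) / α) with hq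
    have hq0 : 0 ≤ q := mul_nonneg (by linarith) (div_nonneg (by linarith) h0.le)
    have hexp : (r - 1) / α + 1 + (-q) = r := by
      rw [hq]; field_simp; ring
    refine ⟨c⁻¹ * (8 * (1 / 4) ^ q), fun T hT => ?_⟩
    have hT0 : 0 < T := by linarith
    rw [momentFun, if_neg h.not_gt, if_neg h.ne']
    have hlow : T / 8 * (T / 4) ^ (-q) ≤ ∑ k ∈ Finset.range ⌊T / 4⌋₊, ((k : ℝ) + 1) ^ (-q) := by
      calc T / 8 * (T / 4) ^ (-q) ≤ (⌊T / 4⌋₊ : ℝ) * (T / 4) ^ (-q) := by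
            gcongr
            have h3 := Nat.lt_floor_add_one (T / 4)
            have h4 : (1 : ℝ) ≤ ⌊T / 4⌋₊ := by exact_mod_cast hfl T hT
            linarith
        _ = ∑ k ∈ Finset.range ⌊T / 4⌋₊, (T / 4) ^ (-q) := by simp
        _ ≤ _ := by
            refine Finset.sum_le_sum fun k hk => ?_
            refine Real.rpow_le_rpow_of_nonpos (by positivity) ?_ (by linarith)
            have h3 : k + 1 ≤ ⌊T / 4⌋₊ := Finset.mem_range.1 hk
            calc (k : ℝ) + 1 ≤ (⌊T / 4⌋₊ : ℝ) := by exact_mod_cast h3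
              _ ≤ T / 4 := Nat.floor_le (by linarith)
    have hcc : c⁻¹ * c = 1 := inv_mul_cancel₀ hc.ne'
    have h4 : ((1 : ℝ) / 4) ^ q * (1 / 4) ^ (-q) = 1 := by
      rw [← Real.rpow_add (by norm_num)]; simp
    calc T ^ r = T ^ ((r - 1) / α) * T * T ^ (-q) := by
          rw [← Real.rpow_add_one hT0.ne', ← Real.rpow_add hT0, hexp]
      _ = (c⁻¹ * c) * (((1 : ℝ) / 4) ^ q * (1 / 4) ^ (-q)) *
            (T ^ ((r - 1) / α) * T * T ^ (-q)) := by rw [hcc, h4]; ring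
      _ = c⁻¹ * (8 * (1 / 4) ^ q) * (c * T ^ ((r - 1) / α) * (T / 8 * (T / 4) ^ (-q))) := by
          rw [div_eq_mul_one_div T 4, Real.mul_rpow hT0.le (by norm_num)]; ring
      _ ≤ _ := by gcongr

namespace SublinearExpectationSpace

variable {Ω : Type*} [MeasurableSpace Ω] (S : SublinearExpectationSpace Ω)

theorem momentCondition_iff (α r : ℝ) (X : Ω → ℝ) :
    S.MomentCondition α r X ↔ S.choquet (fun ω => momentFun α r |X ω|) < ⊤ := by
  unfold MomentCondition momentFun
  rcases lt_trichotomy α (1 - 1 / r) with h | h | h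
  · simp only [h, h.ne, h.not_gt, if_true, false_imp_iff, true_imp_iff, and_true]
  · simp only [← h, lt_irrefl, if_false, if_true, false_imp_iff, true_imp_iff, true_and, and_true]
  · simp only [h, h.ne', h.not_gt, if_false, false_imp_iff, true_imp_iff, true_and]

end SublinearExpectationSpace

/-! ### From complete convergence to the moment condition -/

/-- If `1 - exp (-s n) ≤ V n'` for all `n'` in the dyadic block of `n`, then summability of
`n^{r-2} V n` first forces `s n` to be small, and then `n^{r-2} s n` to be summable. -/
theorem tsum_rpow_mul_lt_top_of_one_sub_exp_le {r : ℝ} (hr : 1 ≤ r) {V s : ℕ → ℝ}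
    (hV : ∀ n, 0 ≤ V n) (hs : ∀ n, 0 ≤ s n)
    (hVs : ∀ n n', n ≤ n' → n' ≤ 2 * n → 1 - Real.exp (-s n) ≤ V n')
    (h : ∑' n : ℕ, ENNReal.ofReal (((n : ℝ) + 1) ^ (r - 2)) * ENNReal.ofReal (V n) < ⊤) :
    ∑' n : ℕ, ENNReal.ofReal (((n : ℝ) + 1) ^ (r - 2)) * ENNReal.ofReal (s n) < ⊤ := by
  have e : ∀ (f : ℕ → ℝ), (∑' n : ℕ, ENNReal.ofReal (((n : ℝ) + 1) ^ (r - 2)) *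
      ENNReal.ofReal (f n)) = ∑' n : ℕ, ENNReal.ofReal (((n : ℝ) + 1) ^ (r - 2) * f n) :=
    fun f => tsum_congr fun n => (ENNReal.ofReal_mul (by positivity)).symm
  rw [e] at h ⊢
  have hVsum : Summable fun n : ℕ => ((n : ℝ) + 1) ^ (r - 2) * V n := by
    have := ENNReal.summable_toReal h.ne
    refine this.congr fun n => ENNReal.toReal_ofReal (mul_nonneg (by positivity) (hV n))
  have htail := tendsto_sum_nat_add fun n : ℕ => ((n : ℝ) + 1) ^ (r - 2) * V n
  obtain ⟨N, hN⟩ := (htail.eventually_lt_const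
    (show (0 : ℝ) < 1 / 4 by norm_num)).exists_forall_of_atTop
  have hsmall : ∀ n, N ≤ n → 1 - Real.exp (-s n) ≤ 1 / 2 := by
    intro n hn
    have hx : 0 ≤ 1 - Real.exp (-s n) := by
      have := Real.exp_le_one_iff.2 (neg_nonpos.2 (hs n)); linarith
    have hn1 : (0 : ℝ) < n + 1 := by positivity
    have hblock : 1 / 2 * (1 - Real.exp (-s n)) ≤
        ∑ j ∈ Finset.range (n + 1), ((((j + n : ℕ) : ℝ) + 1) ^ (r - 2) * V (j + n)) := by
      calc 1 / 2 * (1 - Real.exp (-s n))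
          = ∑ j ∈ Finset.range (n + 1), (1 / (2 * ((n : ℝ) + 1)) * (1 - Real.exp (-s n))) := by
            rw [Finset.sum_const, Finset.card_range, nsmul_eq_mul]
            push_cast
            field_simp
        _ ≤ _ := by
            refine Finset.sum_le_sum fun j hj => ?_
            have hj' : j < n + 1 := Finset.mem_range.1 hj
            have hjn : (j : ℝ) ≤ n := by exact_mod_cast Nat.lt_succ_iff.1 hj'
            have h1 : (1 : ℝ) ≤ ((j + n : ℕ) : ℝ) + 1 := by
              linarith [((j + n : ℕ).cast_nonneg : (0 : ℝ) ≤ _)]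
            refine mul_le_mul ?_ (hVs n (j + n) (by omega) (by omega)) hx (by positivity)
            calc 1 / (2 * ((n : ℝ) + 1)) ≤ 1 / (((j + n : ℕ) : ℝ) + 1) := by
                  apply one_div_le_one_div_of_le (by positivity)
                  push_cast; linarith
              _ = (((j + n : ℕ) : ℝ) + 1) ^ (-1 : ℝ) := by rw [Real.rpow_neg_one, one_div]
              _ ≤ _ := Real.rpow_le_rpow_of_exponent_le h1 (by linarith)
    have hle := (((summable_nat_add_iff n).2 hVsum).sum_le_tsum (Finset.range (n + 1))
      fun j _ => mul_nonneg (by positivity) (hV _))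
    have := hN n hn
    linarith
  have hbound : ∀ n, N ≤ n → s n ≤ 2 * V n := by
    intro n hn
    have h1 := hsmall n hn
    have h2 := hVs n n le_rfl (by omega)
    have h3 := Real.exp_pos (-s n)
    have h4 : (1 + s n) * Real.exp (-s n) ≤ 1 := by
      have := mul_le_mul_of_nonneg_right (Real.add_one_le_exp (s n)) h3.le
      rw [← Real.exp_add, add_neg_cancel, Real.exp_zero] at this
      linarith
    nlinarith [hs n]
  have hsum : Summable fun n : ℕ => ((n : ℝ) + 1) ^ (r - 2) * s n := by
    rw [← summable_nat_add_iff N]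
    refine Summable.of_nonneg_of_le (fun n => mul_nonneg (by positivity) (hs _)) (fun n => ?_)
      (((summable_nat_add_iff N).2 hVsum).mul_left 2)
    calc (((n + N : ℕ) : ℝ) + 1) ^ (r - 2) * s (n + N)
        ≤ (((n + N : ℕ) : ℝ) + 1) ^ (r - 2) * (2 * V (n + N)) := by
          gcongr; exact hbound _ (by omega)
      _ = _ := by ring
  rw [← ENNReal.ofReal_tsum_of_nonneg (fun n => mul_nonneg (by positivity) (hs n)) hsum]
  exact ENNReal.ofReal_lt_top

/-- A single term is a difference of two consecutive partial sums. -/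
theorem abs_weighted_le_two_mul_maxCesaroSum {Ω : Type*} (α : ℝ) (Xs : ℕ → Ω → ℝ) {n i : ℕ}
    (hi : i ≤ n) (ω : Ω) :
    |cesaroWeight α n i * Xs i ω| ≤ 2 * maxCesaroSum α Xs n ω := by
  set P : ℕ → ℝ := fun j =>
    ∑ i ∈ Finset.range (j + 1), cesaro (α - 1) (n - i) * Xs i ω / cesaro α n with hP
  have hle : ∀ j ≤ n, |P j| ≤ maxCesaroSum α Xs n ω := fun j hj =>
    Finset.le_sup' (fun j => |P j|) (Finset.mem_range.2 (Nat.lt_succ_of_le hj))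
  have hw : ∀ i, cesaroWeight α n i * Xs i ω = cesaro (α - 1) (n - i) * Xs i ω / cesaro α n :=
    fun i => by rw [cesaroWeight]; ring
  rcases Nat.eq_zero_or_pos i with rfl | hpos
  · have h0 := hle 0 hi
    have : cesaroWeight α n 0 * Xs 0 ω = P 0 := by rw [hw]; simp [hP]
    rw [this]
    linarith [abs_nonneg (P 0)]
  · obtain ⟨l, rfl⟩ : ∃ l, i = l + 1 := ⟨i - 1, by omega⟩
    have : cesaroWeight α n (l + 1) * Xs (l + 1) ω = P (l + 1) - P l := by
      rw [hw]; simp only [hP]; rw [Finset.sum_range_succ _ (l + 1)]; ring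
    rw [this]
    have h1 := hle (l + 1) hi
    have h2 := hle l (by omega)
    exact (abs_sub _ _).trans (by linarith)

theorem maxCesaroSum_nonneg {Ω : Type*} (α : ℝ) (Xs : ℕ → Ω → ℝ) (n : ℕ) (ω : Ω) :
    0 ≤ maxCesaroSum α Xs n ω := by
  have := abs_weighted_le_two_mul_maxCesaroSum α Xs (Nat.zero_le n) ω
  linarith [abs_nonneg (cesaroWeight α n 0 * Xs 0 ω)]

theorem tsum_indexWeight_mul (r : ℝ) (f : ℕ × ℕ → ℝ≥0∞) :
    ∑' p, indexWeight r p * f p = ∑' n : ℕ, ENNReal.ofReal (((n : ℝ) + 1) ^ (r - 2)) *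
      ∑ k ∈ Finset.range (n + 2), f (n, k) := by
  rw [ENNReal.tsum_prod']
  refine tsum_congr fun n => ?_
  rw [tsum_eq_sum (s := Finset.range (n + 2)) fun k hk => ?_, Finset.mul_sum]
  · refine Finset.sum_congr rfl fun k hk => ?_
    rw [indexWeight, if_pos (Nat.lt_succ_iff.1 (Finset.mem_range.1 hk))]
  · rw [indexWeight, if_neg, zero_mul]
    simp only [Finset.mem_range] at hk ⊢
    omega

theorem cesaroScale_le_two_mul {α : ℝ} (h0 : 0 < α) (h1 : α ≤ 1) {n n' : ℕ} (h : n' ≤ 2 * n)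
    (k : ℕ) : cesaroScale α n' k ≤ 2 * cesaroScale α n k := by
  have hn : (n' : ℝ) + 1 ≤ 2 * ((n : ℝ) + 1) := by
    have : (n' : ℝ) ≤ 2 * n := by exact_mod_cast h
    linarith
  have h2 : (2 : ℝ) ^ α ≤ 2 := by
    simpa using Real.rpow_le_rpow_of_exponent_le (show (1 : ℝ) ≤ 2 by norm_num) h1
  unfold cesaroScale
  calc ((k : ℝ) + 1) ^ (1 - α) * ((n' : ℝ) + 1) ^ α
      ≤ ((k : ℝ) + 1) ^ (1 - α) * (2 * ((n : ℝ) + 1)) ^ α := by gcongr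
    _ = ((k : ℝ) + 1) ^ (1 - α) * (2 ^ α * ((n : ℝ) + 1) ^ α) := by
        rw [Real.mul_rpow (by norm_num) (by positivity)]
    _ ≤ ((k : ℝ) + 1) ^ (1 - α) * (2 * ((n : ℝ) + 1) ^ α) := by gcongr
    _ = _ := by ring

namespace SublinearExpectationSpace

variable {Ω : Type*} [MeasurableSpace Ω] (S : SublinearExpectationSpace Ω)

theorem maxCesaroSum_mem {Xs : ℕ → Ω → ℝ} (hXs : ∀ i, Xs i ∈ S.H) (α : ℝ) (n : ℕ) :
    maxCesaroSum α Xs n ∈ S.H := by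
  refine S.sup'_mem _ _ fun j _ => S.abs_mem (S.sum_mem _ fun i _ => ?_)
  have := S.const_mul_mem (cesaro (α - 1) (n - i) / cesaro α n) (hXs i)
  convert this using 2
  ring

variable {S} in
theorem IdentDist.tail_eq {X Y : Ω → ℝ} (h : S.IdentDist X Y) (hX : X ∈ S.H) (hY : Y ∈ S.H)
    (t : ℝ) : S.tail X t = S.tail Y t := by
  have hm : MeasurableSet {x : ℝ | t < |x|} := measurableSet_lt measurable_const (by fun_prop)
  exact h.capacity_eq hX hY hm

/-- Complete moment convergence implies complete convergence, by Markov's inequality. -/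
theorem completeConvergence_of_completeMomentConvergence {r : ℝ} {M : ℕ → Ω → ℝ}
    (hM : ∀ n, M n ∈ S.H) (h : S.CompleteMomentConvergence r M) :
    S.CompleteConvergence r M := by
  intro ε hε
  have hδ : 0 < ε / 2 := by positivity
  have key : ∀ n, S.capacity {ω | ε < M (n + 1) ω} ≤
      (ENNReal.ofReal (ε / 2))⁻¹ * S.expNonneg fun ω => max (M (n + 1) ω - ε / 2) 0 := by
    intro n
    have h1 := S.mul_capacity_le hδ.le (S.posPart_sub_mem (ε / 2) (hM (n + 1)))
      (fun ω => le_max_right _ _) (A := {ω | ε < M (n + 1) ω})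
      (measurableSet_lt measurable_const (S.measurable_of_mem _ (hM _))) fun ω hω => by
        have : ε < M (n + 1) ω := hω
        exact le_max_of_le_left (by linarith)
    rwa [mul_comm (ENNReal.ofReal (ε / 2))⁻¹, ← div_eq_mul_inv, ENNReal.le_div_iff_mul_le
      (Or.inl (by simpa using hδ)) (Or.inl ENNReal.ofReal_ne_top), mul_comm]
  calc _ ≤ ∑' n : ℕ, (ENNReal.ofReal (ε / 2))⁻¹ * (ENNReal.ofReal (((n + 1 : ℕ) : ℝ) ^ (r - 2)) *
        S.expNonneg fun ω => max (M (n + 1) ω - ε / 2) 0) := by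
        refine ENNReal.tsum_le_tsum fun n => ?_
        rw [mul_left_comm]
        gcongr
        exact key n
    _ < ⊤ := by
        rw [ENNReal.tsum_mul_left]
        exact ENNReal.mul_lt_top (by simpa using hδ) (h _ hδ)

/-- Complete convergence implies the moment condition: independence bounds the sum of the
capacities of the events `|X_i| > c / a_{ni}` by the capacity of their union. -/
theorem momentCondition_of_completeConvergence {α r : ℝ} (h0 : 0 < α) (h1 : α ≤ 1) (hr : 1 ≤ r)
    {X : Ω → ℝ} (hX : X ∈ S.H) {Xs : ℕ → Ω → ℝ} (hXs : ∀ i, Xs i ∈ S.H)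
    (hindep : S.IndepSeq Xs) (hident : ∀ i, S.IdentDist (Xs i) X)
    (h : S.CompleteConvergence r (maxCesaroSum α Xs)) : S.MomentCondition α r X := by
  set D := 4 / α with hD
  have hD4 : 4 ≤ D := by rw [hD, le_div_iff₀ h0]; linarith
  have hfin : ∀ t, S.tail X t ≠ ⊤ := fun t => ((S.tail_le_one X t).trans_lt (by simp)).ne
  set V : ℕ → ℝ := fun n => (S.capacity {ω | 1 < maxCesaroSum α Xs (n + 1) ω}).toReal with hV
  set s : ℕ → ℝ := fun n =>
    ∑ k ∈ Finset.range (n + 2), (S.tail X (2 * D * cesaroScale α n k)).toReal with hs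
  have hcap : ∀ A, S.capacity A ≠ ⊤ := fun A => ((S.capacity_le_one A).trans_lt (by simp)).ne
  have hVs : ∀ n n', n ≤ n' → n' ≤ 2 * n → 1 - Real.exp (-s n) ≤ V n' := by
    intro n n' hn hn'
    have hB : ∀ i, MeasurableSet {x : ℝ | D * cesaroScale α n' (n' + 1 - i) < |x|} := fun i =>
      measurableSet_lt measurable_const (by fun_prop)
    have h2 := hindep.one_sub_capacity_biUnion_le hXs hB (n' + 1)
    have h3 : (S.capacity {ω | ∃ i ≤ n' + 1, Xs i ω ∈
        {x : ℝ | D * cesaroScale α n' (n' + 1 - i) < |x|}}).toReal ≤ V n' := by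
      refine ENNReal.toReal_mono (hcap _) (S.capacity_mono ?_)
      rintro ω ⟨i, hi, hlt⟩
      have hlt' : D * cesaroScale α n' (n' + 1 - i) < |Xs i ω| := hlt
      have h4 := abs_weighted_le_two_mul_maxCesaroSum α Xs hi ω
      have h5 := le_cesaroWeight h0 h1 n' i
      have h6 := cesaroScale_pos α n' (n' + 1 - i)
      rw [abs_mul, abs_of_pos (cesaroWeight_pos h0 _ _)] at h4
      have h7 : 2 < cesaroWeight α (n' + 1) i * |Xs i ω| := by
        calc 2 = α / 2 / cesaroScale α n' (n' + 1 - i) *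
              (D * cesaroScale α n' (n' + 1 - i)) := by
              rw [hD]; field_simp; norm_num
          _ < α / 2 / cesaroScale α n' (n' + 1 - i) * |Xs i ω| := by gcongr
          _ ≤ _ := by gcongr
      change 1 < maxCesaroSum α Xs (n' + 1) ω
      linarith
    have h4 : s n ≤ ∑ i ∈ Finset.range (n' + 1 + 1), (S.capacity (Xs i ⁻¹'
        {x : ℝ | D * cesaroScale α n' (n' + 1 - i) < |x|})).toReal := by
      calc s n ≤ ∑ k ∈ Finset.range (n' + 2), (S.tail X (2 * D * cesaroScale α n k)).toReal :=
            Finset.sum_le_sum_of_subset_of_nonneg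
              (Finset.range_mono (by omega)) fun k _ _ => ENNReal.toReal_nonneg
        _ ≤ ∑ k ∈ Finset.range (n' + 2), (S.tail X (D * cesaroScale α n' k)).toReal := by
            refine Finset.sum_le_sum fun k _ =>
              ENNReal.toReal_mono (hfin _) (S.tail_antitone X ?_)
            have := cesaroScale_le_two_mul h0 h1 hn' k
            nlinarith
        _ = _ := by
            rw [← Finset.sum_range_reflect]
            refine Finset.sum_congr rfl fun i _ => ?_
            rw [← (hident i).tail_eq (hXs i) hX]
            rfl
    have h5 := Real.exp_le_exp.2 (neg_le_neg h4)
    linarith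
  have hsum := tsum_rpow_mul_lt_top_of_one_sub_exp_le hr (fun n => ENNReal.toReal_nonneg)
    (fun n => Finset.sum_nonneg fun k _ => ENNReal.toReal_nonneg) hVs (by
      have := h 1 one_pos
      simp only [Nat.cast_add, Nat.cast_one] at this
      simpa only [hV, ENNReal.ofReal_toReal (hcap _)] using this)
  obtain ⟨K, hK⟩ := exists_momentFun_le h0 h1 hr
  rw [momentCondition_iff]
  set L := max ((2 * D) ^ ((r - 1) / α)) ((2 * D) ^ r * (2 * D)) with hL
  have hL0 : 0 ≤ L := le_max_of_le_right (by positivity)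
  refine S.choquet_lt_top_of_tsum (fun t ht => momentFun_nonneg α r ht)
    (momentFun_monotoneOn h0 hr) (fun x hx => exists_momentFun_eq h0 hr hx)
    (w := indexWeight r) (s := fun p => 2 * D * cesaroScale α p.1 p.2)
    (C := ENNReal.ofReal L * ENNReal.ofReal K)
    (ENNReal.mul_ne_top ENNReal.ofReal_ne_top ENNReal.ofReal_ne_top) ?_ ?_
  · intro t ht
    have hD0 : 0 < 2 * D := by linarith
    have e : t = 2 * D * (t / (2 * D)) := by field_simp
    have hscale : ∀ p : ℕ × ℕ, 2 * D * cesaroScale α p.1 p.2 ≤ t ↔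
        cesaroScale α p.1 p.2 ≤ t / (2 * D) := fun p => by
      rw [le_div_iff₀ hD0, mul_comm]
    simp only [hscale]
    calc ENNReal.ofReal (momentFun α r t)
        ≤ ENNReal.ofReal (L * momentFun α r (t / (2 * D))) := by
          apply ENNReal.ofReal_le_ofReal
          conv_lhs => rw [e]
          exact momentFun_mul_le_of_one_le α r (by linarith) (by positivity)
      _ = ENNReal.ofReal L * ENNReal.ofReal (momentFun α r (t / (2 * D))) :=
          ENNReal.ofReal_mul hL0
      _ ≤ _ := by
          rw [mul_assoc]
          gcongr
          exact hK _ (by positivity)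
  · rw [tsum_indexWeight_mul]
    convert hsum using 4 with n
    rw [ENNReal.ofReal_sum_of_nonneg fun k _ => ENNReal.toReal_nonneg]
    exact Finset.sum_congr rfl fun k _ => (ENNReal.ofReal_toReal (hfin _)).symm

end SublinearExpectationSpace

/-! ### A maximal exponential inequality -/

/-- Truncation of `z` to the interval `[-y, y]`. -/
noncomputable def clip (y z : ℝ) : ℝ := max (-y) (min z y)

theorem abs_clip_le {y : ℝ} (hy : 0 ≤ y) (z : ℝ) : |clip y z| ≤ y :=
  abs_le.2 ⟨le_max_left _ _, max_le (by linarith) (min_le_right _ _)⟩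

theorem clip_of_abs_le {y z : ℝ} (h : |z| ≤ y) : clip y z = z := by
  rw [clip, min_eq_left (abs_le.1 h).2, max_eq_right (abs_le.1 h).1]

theorem abs_clip_sub_clip_le (y a b : ℝ) : |clip y a - clip y b| ≤ |a - b| := by
  refine (abs_max_sub_max_le_max _ _ _ _).trans (max_le (by simp) ?_)
  exact (abs_min_sub_min_le_max _ _ _ _).trans (max_le le_rfl (by simp))

theorem clip_neg {y : ℝ} (hy : 0 ≤ y) (z : ℝ) : clip y (-z) = -clip y z := by
  unfold clip
  rcases le_total z y with h1 | h1 <;> rcases le_total (-y) z with h2 | h2 <;>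
    simp only [max_def, min_def] <;> split_ifs <;> linarith

theorem clip_le_add {y : ℝ} (hy : 0 ≤ y) (z : ℝ) : clip y z ≤ z + max (|z| - y) 0 := by
  rcases le_or_gt |z| y with h | h
  · rw [clip_of_abs_le h]; linarith [le_max_right (|z| - y) 0]
  · have h1 := le_max_left (|z| - y) 0
    have h2 := le_abs_self (clip y z)
    have h3 := abs_clip_le hy z
    rcases le_total 0 z with h0 | h0
    · rw [abs_of_nonneg h0] at h1 h ⊢
      linarith
    · rw [abs_of_nonpos h0] at h1 h ⊢
      have : clip y z = -y := by
        rw [clip, max_eq_left]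
        exact (min_le_left _ _).trans (by linarith)
      linarith

theorem abs_clip_le_abs {y : ℝ} (hy : 0 ≤ y) (z : ℝ) : |clip y z| ≤ |z| := by
  rcases le_or_gt |z| y with h | h
  · rw [clip_of_abs_le h]
  · exact (abs_clip_le hy z).trans h.le

theorem exp_le_one_add_add_sq_mul_exp_abs (u : ℝ) :
    Real.exp u ≤ 1 + u + u ^ 2 * Real.exp |u| := by
  have h := Complex.norm_exp_sub_sum_le_norm_mul_exp (u : ℂ) 2
  have e : Complex.exp u - ∑ m ∈ Finset.range 2, (u : ℂ) ^ m / m.factorial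
      = ((Real.exp u - (1 + u) : ℝ) : ℂ) := by
    simp [Finset.sum_range_succ]
  rw [e, Complex.norm_real, Complex.norm_real, Real.norm_eq_abs, Real.norm_eq_abs, sq_abs] at h
  linarith [le_abs_self (Real.exp u - (1 + u))]

theorem sq_le_exp {L : ℝ} (hL : 0 ≤ L) : L ^ 2 ≤ Real.exp L := by
  have h := Real.quadratic_le_exp_of_nonneg (show 0 ≤ L / 2 by positivity)
  have h2 : L ≤ Real.exp (L / 2) := by nlinarith [sq_nonneg (L - 2)]
  calc L ^ 2 ≤ Real.exp (L / 2) ^ 2 := by gcongr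
    _ = Real.exp L := by rw [← Real.exp_nat_mul]; congr 1; push_cast; ring

theorem abs_exp_sub_exp_le {u v M : ℝ} (hu : u ≤ M) (hv : v ≤ M) :
    |Real.exp u - Real.exp v| ≤ Real.exp M * |u - v| := by
  wlog h : v ≤ u generalizing u v
  · rw [abs_sub_comm, abs_sub_comm u]
    exact this hv hu (not_le.1 h).le
  rw [abs_of_nonneg (sub_nonneg.2 (Real.exp_le_exp.2 h)), abs_of_nonneg (sub_nonneg.2 h)]
  have h1 : Real.exp u * (1 + (v - u)) ≤ Real.exp v := by
    calc _ ≤ Real.exp u * Real.exp (v - u) := by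
          gcongr; linarith [Real.add_one_le_exp (v - u)]
      _ = _ := by rw [← Real.exp_add]; congr 1; ring
  have h2 := Real.exp_le_exp.2 hu
  nlinarith

/-- The number of integers `m ≥ 0` with `c + m < z` is at least `z - c`. -/
theorem ofReal_posPart_sub_le_tsum (c z : ℝ) : ENNReal.ofReal (max (z - c) 0) ≤
    ∑' m : ℕ, ENNReal.ofReal (if c + m < z then 1 else 0) := by
  refine le_trans ?_ (ENNReal.sum_le_tsum (Finset.range ⌈z - c⌉₊))
  have : ∀ m ∈ Finset.range ⌈z - c⌉₊,
      ENNReal.ofReal (if c + (m : ℝ) < z then 1 else 0) = 1 := fun m hm => by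
    have := Nat.lt_ceil.1 (Finset.mem_range.1 hm)
    rw [if_pos (by linarith), ENNReal.ofReal_one]
  rw [Finset.sum_congr rfl this, Finset.sum_const, Finset.card_range, nsmul_eq_mul, mul_one]
  refine ENNReal.ofReal_le_of_le_toReal ?_
  simpa using Nat.le_ceil (z - c)

/-- Dyadic layers of the truncated square, starting at the truncation level and going down. -/
theorem ofReal_clip_sq_le_tsum {y : ℝ} (hy : 0 < y) (z : ℝ) : ENNReal.ofReal (clip y z ^ 2) ≤
    ∑' j : ℕ, ENNReal.ofReal (if y * (1 / 2) ^ (j + 1) < |z| then y ^ 2 * (1 / 4) ^ j else 0) := by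
  rcases eq_or_ne z 0 with rfl | hz
  · rw [clip_of_abs_le (by simpa using hy.le)]; simp
  have hex : ∃ j : ℕ, y * (1 / 2) ^ (j + 1) < |z| := by
    obtain ⟨j, hj⟩ := exists_pow_lt_of_lt_one (show 0 < |z| / y by positivity)
      (show (1 / 2 : ℝ) < 1 by norm_num)
    refine ⟨j, ?_⟩
    rw [lt_div_iff₀ hy] at hj
    have : y * (1 / 2) ^ (j + 1) ≤ (1 / 2) ^ j * y := by
      rw [pow_succ]
      nlinarith [show (0 : ℝ) < (1 / 2) ^ j * y by positivity]
    linarith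
  classical
  set j := Nat.find hex with hj
  refine le_trans ?_ (ENNReal.le_tsum j)
  rw [if_pos (Nat.find_spec hex)]
  apply ENNReal.ofReal_le_ofReal
  have e : y ^ 2 * (1 / 4) ^ j = (y * (1 / 2) ^ j) ^ 2 := by
    rw [mul_pow, ← pow_mul, mul_comm j, pow_mul]; norm_num
  rw [e, ← sq_abs (clip y z)]
  gcongr
  rcases Nat.eq_zero_or_pos j with h0 | hpos
  · rw [h0, pow_zero, mul_one]; exact abs_clip_le hy.le z
  · obtain ⟨l, hl⟩ : ∃ l, j = l + 1 := ⟨j - 1, by omega⟩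
    have := Nat.find_min hex (m := l) (by omega)
    rw [hl]
    exact (abs_clip_le_abs hy.le z).trans (not_lt.1 this)

/-- Dyadic layers of the excess over `ε`. -/
theorem ofReal_posPart_sub_le_tsum_two_pow {ε : ℝ} (hε : 0 < ε) (z : ℝ) :
    ENNReal.ofReal (max (z - ε) 0) ≤
      ∑' j : ℕ, ENNReal.ofReal (if 2 ^ j * ε < z then 2 ^ (j + 1) * ε else 0) := by
  rcases le_or_gt z ε with hz | hz
  · rw [max_eq_right (by linarith)]; simp
  have hex : ∃ j : ℕ, z ≤ 2 ^ (j + 1) * ε := by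
    obtain ⟨j, hj⟩ := pow_unbounded_of_one_lt (z / ε) (show (1 : ℝ) < 2 by norm_num)
    refine ⟨j, ?_⟩
    rw [div_lt_iff₀ hε] at hj
    have : (2 : ℝ) ^ j * ε ≤ 2 ^ (j + 1) * ε := by gcongr <;> norm_num
    linarith
  classical
  set j := Nat.find hex with hj
  have hlt : 2 ^ j * ε < z := by
    rcases Nat.eq_zero_or_pos j with h0 | hpos
    · simpa [h0] using hz
    · obtain ⟨l, hl⟩ : ∃ l, j = l + 1 := ⟨j - 1, by omega⟩
      have := Nat.find_min hex (m := l) (by omega)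
      rw [hl]
      exact not_le.1 this
  refine le_trans ?_ (ENNReal.le_tsum j)
  rw [if_pos hlt]
  apply ENNReal.ofReal_le_ofReal
  exact max_le (by linarith [Nat.find_spec hex]) (by positivity)

namespace SublinearExpectationSpace

variable {Ω : Type*} [MeasurableSpace Ω] (S : SublinearExpectationSpace Ω)

theorem clip_mem (y a : ℝ) {X : Ω → ℝ} (hX : X ∈ S.H) : (fun ω => clip y (a * X ω)) ∈ S.H :=
  S.lip_mem (φ := fun x => clip y (a * x)) (K := |a|) (fun x x' => by
    rw [← abs_mul, mul_sub]; exact abs_clip_sub_clip_le _ _ _) hX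

theorem excess_mem (y a : ℝ) {X : Ω → ℝ} (hX : X ∈ S.H) :
    (fun ω => max (|a * X ω| - y) 0) ∈ S.H :=
  S.posPart_sub_mem y (S.abs_mem (S.const_mul_mem a hX))

theorem clip_sq_mem (y a : ℝ) {X : Ω → ℝ} (hX : X ∈ S.H) :
    (fun ω => clip y (a * X ω) ^ 2) ∈ S.H := by
  simp only [sq]
  exact S.mul_mem (S.clip_mem y a hX) (S.clip_mem y a hX)

theorem E_const_mul_eq_zero {X : Ω → ℝ} (hX : X ∈ S.H) (h1 : S.E X = 0)
    (h2 : S.E (fun ω => -X ω) = 0) (c : ℝ) : S.E (fun ω => c * X ω) = 0 := by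
  rcases le_total 0 c with hc | hc
  · rw [S.pos_homog X hX c hc, h1, mul_zero]
  · have e : (fun ω => c * X ω) = fun ω => (-c) * (-X ω) := by funext ω; ring
    have hn : (fun ω => -X ω) ∈ S.H := by simpa using S.const_mul_mem (-1) hX
    rw [e, S.pos_homog _ hn (-c) (by linarith), h2, mul_zero]

/-- Exponential moment of a truncated variable without mean uncertainty, in terms of the excess
over the truncation level and of the truncated second moment. -/
theorem expNonneg_exp_clip_le {X : Ω → ℝ} (hX : X ∈ S.H) (h1 : S.E X = 0)
    (h2 : S.E (fun ω => -X ω) = 0) {y l a m q : ℝ} (hy : 0 ≤ y) (hl : 0 ≤ l)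
    (hm0 : 0 ≤ m) (hq0 : 0 ≤ q)
    (hm : S.expNonneg (fun ω => max (|a * X ω| - y) 0) ≤ ENNReal.ofReal m)
    (hq : S.expNonneg (fun ω => clip y (a * X ω) ^ 2) ≤ ENNReal.ofReal q)
    (hH : (fun ω => Real.exp (l * clip y (a * X ω))) ∈ S.H) :
    S.expNonneg (fun ω => Real.exp (l * clip y (a * X ω))) ≤
      ENNReal.ofReal (1 + (l * m + l ^ 2 * Real.exp (l * y) * q)) := by
  set κ := l ^ 2 * Real.exp (l * y) with hκ
  have hκ0 : 0 ≤ κ := by positivity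
  have hA : (fun ω => 1 + l * a * X ω) ∈ S.H :=
    S.add_mem (S.const_mem 1) (S.const_mul_mem (l * a) hX)
  have hex := S.const_mul_mem l (S.excess_mem y a hX)
  have hsq := S.const_mul_mem κ (S.clip_sq_mem y a hX)
  have hB := S.add_mem hex hsq
  have hex0 : ∀ ω, 0 ≤ l * max (|a * X ω| - y) 0 := fun ω =>
    mul_nonneg hl (le_max_right _ _)
  have hsq0 : ∀ ω, 0 ≤ κ * clip y (a * X ω) ^ 2 := fun ω => by positivity
  have hpt : ∀ ω, Real.exp (l * clip y (a * X ω)) ≤ (1 + l * a * X ω) +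
      (l * max (|a * X ω| - y) 0 + κ * clip y (a * X ω) ^ 2) := by
    intro ω
    have h3 := exp_le_one_add_add_sq_mul_exp_abs (l * clip y (a * X ω))
    have h4 : |l * clip y (a * X ω)| ≤ l * y := by
      rw [abs_mul, abs_of_nonneg hl]
      gcongr
      exact abs_clip_le hy _
    have h5 : l * clip y (a * X ω) ≤ l * (a * X ω + max (|a * X ω| - y) 0) := by
      gcongr
      exact clip_le_add hy _
    have h6 : (l * clip y (a * X ω)) ^ 2 * Real.exp |l * clip y (a * X ω)| ≤
        (l * clip y (a * X ω)) ^ 2 * Real.exp (l * y) := by gcongr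
    have h7 : (l * clip y (a * X ω)) ^ 2 * Real.exp (l * y) = κ * clip y (a * X ω) ^ 2 := by
      rw [hκ]; ring
    linarith
  have hEA : S.E (fun ω => 1 + l * a * X ω) ≤ 1 := by
    have h3 := S.subadd _ (S.const_mem 1) _ (S.const_mul_mem (l * a) hX)
      (fun h => EReal.coe_ne_top 1 (by rw [← h.1, S.const]))
      (fun h => EReal.coe_ne_bot 1 (by rw [← h.1, S.const]))
    rwa [S.const, S.E_const_mul_eq_zero hX h1 h2, add_zero] at h3
  have hEB : S.expNonneg (fun ω => l * max (|a * X ω| - y) 0 + κ * clip y (a * X ω) ^ 2) ≤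
      ENNReal.ofReal (l * m + κ * q) := by
    refine (S.expNonneg_add_le hex hsq hex0 hsq0).trans ?_
    rw [S.expNonneg_const_mul hl (S.excess_mem y a hX),
      S.expNonneg_const_mul hκ0 (S.clip_sq_mem y a hX),
      ENNReal.ofReal_add (by positivity) (by positivity), ENNReal.ofReal_mul hl,
      ENNReal.ofReal_mul hκ0]
    gcongr
  have hEB' : S.E (fun ω => l * max (|a * X ω| - y) 0 + κ * clip y (a * X ω) ^ 2) ≤
      ((l * m + κ * q : ℝ) : EReal) := by
    rw [← S.coe_expNonneg hB fun ω => add_nonneg (hex0 ω) (hsq0 ω)]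
    refine (EReal.coe_ennreal_le_coe_ennreal_iff.2 hEB).trans_eq ?_
    rw [EReal.coe_ennreal_ofReal, max_eq_left (by positivity)]
  have hBbot : S.E (fun ω => l * max (|a * X ω| - y) 0 + κ * clip y (a * X ω) ^ 2) ≠ ⊥ := by
    intro h
    have := S.E_nonneg hB fun ω => add_nonneg (hex0 ω) (hsq0 ω)
    rw [h] at this
    simp at this
  have hle : S.E (fun ω => Real.exp (l * clip y (a * X ω))) ≤
      ((1 + (l * m + κ * q) : ℝ) : EReal) := by
    refine (S.mono _ (S.add_mem hA hB) _ hH hpt).trans ?_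
    refine (S.subadd _ hA _ hB ?_ ?_).trans ?_
    · rintro ⟨-, h⟩; exact hBbot h
    · rintro ⟨-, h⟩
      rw [h] at hEB'
      exact absurd hEB' (not_le.2 (EReal.coe_lt_top _))
    · rw [EReal.coe_add]
      exact add_le_add hEA hEB'
  calc S.expNonneg (fun ω => Real.exp (l * clip y (a * X ω)))
      ≤ ((1 + (l * m + κ * q) : ℝ) : EReal).toENNReal := EReal.toENNReal_le_toENNReal hle
    _ = _ := by rw [EReal.toENNReal_of_ne_top (EReal.coe_ne_top _), EReal.toReal_coe]

variable {S} in
/-- Maximal exponential inequality for sums of truncated independent variables without mean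
uncertainty. -/
theorem IndepSeq.capacity_sum_clip_le {Xs : ℕ → Ω → ℝ} (hi : S.IndepSeq Xs)
    (hXs : ∀ i, Xs i ∈ S.H) (h1 : ∀ i, S.E (Xs i) = 0)
    (h2 : ∀ i, S.E (fun ω => -Xs i ω) = 0) {a m q : ℕ → ℝ} {y L : ℝ} (hy : 0 < y) (hL : 0 ≤ L)
    (hm0 : ∀ i, 0 ≤ m i) (hq0 : ∀ i, 0 ≤ q i)
    (hm : ∀ i, S.expNonneg (fun ω => max (|a i * Xs i ω| - y) 0) ≤ ENNReal.ofReal (m i))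
    (hq : ∀ i, S.expNonneg (fun ω => clip y (a i * Xs i ω) ^ 2) ≤ ENNReal.ofReal (q i))
    (x : ℝ) (n : ℕ) :
    S.capacity {ω | ∃ j ≤ n, x ≤ ∑ i ∈ Finset.range (j + 1), clip y (a i * Xs i ω)} ≤
      ENNReal.ofReal (Real.exp (L / y * (∑ i ∈ Finset.range (n + 1), m i - x) +
        (L / y) ^ 2 * Real.exp L * ∑ i ∈ Finset.range (n + 1), q i)) := by
  set l := L / y with hl
  have hl0 : 0 ≤ l := by positivity
  have hly : l * y = L := by rw [hl]; field_simp
  set b : ℕ → ℝ := fun i => l * m i + l ^ 2 * Real.exp L * q i with hb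
  have hb0 : ∀ i, 0 ≤ b i := fun i =>
    add_nonneg (mul_nonneg hl0 (hm0 i)) (mul_nonneg (by positivity) (hq0 i))
  have hlclip : ∀ z, l * clip y z ≤ L := fun z => by
    rw [← hly]
    gcongr
    exact (le_abs_self _).trans (abs_clip_le hy.le z)
  have hmeasclip : ∀ i, Measurable fun x : ℝ => clip y (a i * x) := fun i => by
    unfold clip; fun_prop
  have hexpH : ∀ i, (fun ω => Real.exp (l * clip y (a i * Xs i ω))) ∈ S.H := fun i =>
    S.lip_mem (φ := fun x => Real.exp (l * clip y (a i * x))) (K := Real.exp L * (l * |a i|))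
      (fun u v => by
        refine (abs_exp_sub_exp_le (hlclip _) (hlclip _)).trans ?_
        have h3 := abs_clip_sub_clip_le y (a i * u) (a i * v)
        rw [← mul_sub, abs_mul] at h3
        rw [← mul_sub, abs_mul, abs_of_nonneg hl0]
        calc _ ≤ Real.exp L * (l * (|a i| * |u - v|)) := by gcongr
          _ = _ := by ring) (hXs i)
  have e : ∀ i z, Real.exp (l * clip y (a i * z) - b i) =
      Real.exp (-b i) * Real.exp (l * clip y (a i * z)) := fun i z => by
    rw [← Real.exp_add]; congr 1; ring
  have ville := hi.capacity_prod_le hXs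
    (h := fun i z => Real.exp (l * clip y (a i * z) - b i)) (K := Real.exp L)
    (fun i => ((hmeasclip i).const_mul l |>.sub_const _).exp)
    (fun i z => (Real.exp_pos _).le)
    (fun i z => Real.exp_le_exp.2 (by linarith [hlclip (a i * z), hb0 i]))
    (fun i => by simp only [e]; exact S.const_mul_mem _ (hexpH i))
    (fun i => by
      simp only [e]
      rw [S.expNonneg_const_mul (Real.exp_pos _).le (hexpH i)]
      have h3 := S.expNonneg_exp_clip_le (hXs i) (h1 i) (h2 i) hy.le hl0 (hm0 i) (hq0 i) (hm i)
        (hq i) (hexpH i)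
      rw [hly] at h3
      calc _ ≤ ENNReal.ofReal (Real.exp (-b i)) * ENNReal.ofReal (1 + b i) := by
            gcongr
        _ = ENNReal.ofReal (Real.exp (-b i) * (1 + b i)) :=
            (ENNReal.ofReal_mul (Real.exp_pos _).le).symm
        _ ≤ ENNReal.ofReal (Real.exp (-b i) * Real.exp (b i)) := by
            gcongr
            linarith [Real.add_one_le_exp (b i)]
        _ = 1 := by rw [← Real.exp_add]; simp)
    (c := Real.exp (l * x - ∑ i ∈ Finset.range (n + 1), b i)) (Real.exp_pos _) n
  refine (S.capacity_mono ?_).trans (ville.trans_eq ?_)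
  · rintro ω ⟨j, hj, hx⟩
    refine ⟨j, hj, ?_⟩
    rw [← Real.exp_sum, Finset.sum_sub_distrib, ← Finset.mul_sum]
    apply Real.exp_le_exp.2
    have h3 : ∑ i ∈ Finset.range (j + 1), b i ≤ ∑ i ∈ Finset.range (n + 1), b i :=
      Finset.sum_le_sum_of_subset_of_nonneg (Finset.range_mono (by omega)) fun i _ _ => hb0 i
    have h4 := mul_le_mul_of_nonneg_left hx hl0
    linarith
  · rw [← Real.exp_neg]
    congr 2
    simp only [hb, Finset.sum_add_distrib, ← Finset.mul_sum]
    ring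

end SublinearExpectationSpace

/-! ### The maximal inequality for Cesàro sums -/

namespace SublinearExpectationSpace

variable {Ω : Type*} [MeasurableSpace Ω] (S : SublinearExpectationSpace Ω)

/-- The series `∑ 𝕍(|X| > c + m)`, a bound for the expected excess of `|X|` over `c`. -/
noncomputable def tailSum (X : Ω → ℝ) (c : ℝ) : ℝ≥0∞ := ∑' m : ℕ, S.tail X (c + m)

/-- The series `∑ y² 4⁻ʲ 𝕍(|a X| > y 2⁻ʲ⁻¹)`, a bound for the second moment of `a X` truncated at
`y`. -/
noncomputable def truncMoment (X : Ω → ℝ) (y a : ℝ) : ℝ≥0∞ :=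
  ∑' j : ℕ, ENNReal.ofReal (y ^ 2 * (1 / 4) ^ j) * S.tail X (y * (1 / 2) ^ (j + 1) / a)

theorem tailSum_antitone (X : Ω → ℝ) : Antitone (S.tailSum X) := fun _ _ h =>
  ENNReal.tsum_le_tsum fun _ => S.tail_antitone X (by linarith)

theorem tsum_ofReal_mul_quarter_pow_lt_top (c : ℝ) :
    ∑' j : ℕ, ENNReal.ofReal (c * (1 / 4) ^ j) < ⊤ := by
  have h : Summable fun j : ℕ => |c| * (1 / 4 : ℝ) ^ j :=
    (summable_geometric_of_lt_one (by norm_num) (by norm_num)).mul_left _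
  calc _ ≤ ∑' j : ℕ, ENNReal.ofReal (|c| * (1 / 4) ^ j) := by
        gcongr with j
        exact le_abs_self c
    _ = ENNReal.ofReal (∑' j : ℕ, |c| * (1 / 4 : ℝ) ^ j) :=
        (ENNReal.ofReal_tsum_of_nonneg (fun j => by positivity) h).symm
    _ < ⊤ := ENNReal.ofReal_lt_top

theorem truncMoment_lt_top (X : Ω → ℝ) (y a : ℝ) : S.truncMoment X y a < ⊤ :=
  (ENNReal.tsum_le_tsum fun _ => mul_le_of_le_one_right zero_le (S.tail_le_one X _)).trans_lt
    (tsum_ofReal_mul_quarter_pow_lt_top _)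

variable {S} in
theorem CountablySubadditive.expNonneg_excess_le (hS : S.CountablySubadditive) {X : Ω → ℝ}
    (hX : X ∈ S.H) {a : ℝ} (ha : 0 < a) (y : ℝ) :
    S.expNonneg (fun ω => max (|a * X ω| - y) 0) ≤ ENNReal.ofReal a * S.tailSum X (y / a) := by
  have e : (fun ω => max (|a * X ω| - y) 0) = fun ω => a * max (|X ω| - y / a) 0 := by
    funext ω
    rw [mul_max_of_nonneg _ _ ha.le, mul_zero, abs_mul, abs_of_pos ha, mul_sub]
    congr 2
    field_simp
  have habs := S.abs_mem hX
  rw [e, S.expNonneg_const_mul ha.le (S.posPart_sub_mem _ habs)]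
  gcongr
  have := hS.expNonneg_le_tsum_capacity (S.posPart_sub_mem (y / a) habs)
    (fun ω => le_max_right _ _) (S.measurable_of_mem _ habs) (w := fun _ => 1)
    (s := fun m => y / a + m) (fun _ => zero_le_one)
    (fun ω => ofReal_posPart_sub_le_tsum (y / a) |X ω|)
  simpa [tailSum, tail] using this

variable {S} in
theorem CountablySubadditive.expNonneg_clip_sq_le (hS : S.CountablySubadditive) {X : Ω → ℝ}
    (hX : X ∈ S.H) {a y : ℝ} (ha : 0 < a) (hy : 0 < y) :
    S.expNonneg (fun ω => clip y (a * X ω) ^ 2) ≤ S.truncMoment X y a := by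
  refine (hS.expNonneg_le_tsum_capacity (S.clip_sq_mem y a hX) (fun ω => sq_nonneg _)
    (S.measurable_of_mem _ (S.abs_mem (S.const_mul_mem a hX)))
    (w := fun j => y ^ 2 * (1 / 4) ^ j) (s := fun j => y * (1 / 2) ^ (j + 1))
    (fun j => by positivity) (fun ω => ofReal_clip_sq_le_tsum hy (a * X ω))).trans_eq ?_
  refine tsum_congr fun j => ?_
  congr 2
  ext ω
  simp only [mem_ofPred_eq]
  rw [abs_mul, abs_of_pos ha, div_lt_iff₀ ha, mul_comm a]

variable {S} in
/-- Fuk-Nagaev type inequality for the maximal Cesàro sum: large single terms, and a power of the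
truncated variance. -/
theorem IndepSeq.capacity_maxCesaroSum_le (hS : S.CountablySubadditive) {α : ℝ} (h0 : 0 < α)
    (h1 : α ≤ 1) {X : Ω → ℝ} (hX : X ∈ S.H) {Xs : ℕ → Ω → ℝ} (hXs : ∀ i, Xs i ∈ S.H)
    (hindep : S.IndepSeq Xs) (hident : ∀ i, S.IdentDist (Xs i) X)
    (hmean : ∀ i, S.E (Xs i) = 0 ∧ -S.E (fun ω => -Xs i ω) = 0)
    (hfin : S.tailSum X 0 ≠ ⊤) {n : ℕ} {y γ B : ℝ} (hy : 0 < y) (hγ : 0 < γ)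
    (hτ : S.tailSum X (y * ((n : ℝ) + 1) ^ α / 2) ≤ ENNReal.ofReal (2 * γ * y)) (hB0 : 0 < B)
    (hB : ∑ i ∈ Finset.range (n + 2), S.truncMoment X y (cesaroWeight α (n + 1) i) ≤
      ENNReal.ofReal B) :
    S.capacity {ω | 4 * γ * y < maxCesaroSum α Xs (n + 1) ω} ≤
      ∑ k ∈ Finset.range (n + 2), S.tail X (y / 2 * cesaroScale α n k) +
        2 * ENNReal.ofReal (Real.exp 1 * (B / y ^ 2) ^ γ) := by
  have hy2 : 0 < y ^ 2 := by positivity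
  -- if the variance bound exceeds `y ^ 2`, the right-hand side is at least one
  rcases lt_or_ge (y ^ 2) B with hlarge | hsmall
  · refine (S.capacity_le_one _).trans (le_trans ?_ le_add_self)
    have h3 : 1 ≤ (B / y ^ 2) ^ γ := Real.one_le_rpow ((one_le_div hy2).2 hlarge.le) hγ.le
    have h4 : 1 ≤ Real.exp 1 * (B / y ^ 2) ^ γ :=
      one_le_mul_of_one_le_of_one_le (Real.one_le_exp zero_le_one) h3
    calc (1 : ℝ≥0∞) ≤ 2 * 1 := by norm_num
      _ ≤ _ := by
        gcongr
        simpa using ENNReal.ofReal_le_ofReal h4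
  set a : ℕ → ℝ := cesaroWeight α (n + 1) with ha
  have ha0 : ∀ i, 0 < a i := cesaroWeight_pos h0 (n + 1)
  set L := Real.log (y ^ 2 / B) / 2 with hLdef
  have hL : 0 ≤ L := by
    have := Real.log_nonneg ((one_le_div hB0).2 hsmall)
    positivity
  have hexp2L : Real.exp (2 * L) = y ^ 2 / B := by
    rw [hLdef, mul_div_cancel₀ _ (two_ne_zero), Real.exp_log (by positivity)]
  have hτfin : ∀ c, 0 ≤ c → S.tailSum X c ≠ ⊤ := fun c hc =>
    ((S.tailSum_antitone X hc).trans_lt (lt_top_iff_ne_top.2 hfin)).ne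
  set m : ℕ → ℝ := fun i => a i * (S.tailSum X (y / a i)).toReal with hm
  set q : ℕ → ℝ := fun i => (S.truncMoment X y (a i)).toReal with hq
  have hm0 : ∀ i, 0 ≤ m i := fun i => mul_nonneg (ha0 i).le ENNReal.toReal_nonneg
  have hq0 : ∀ i, 0 ≤ q i := fun i => ENNReal.toReal_nonneg
  have htail : ∀ i t, S.tail (Xs i) t = S.tail X t := fun i t => (hident i).tail_eq (hXs i) hX t
  have hexc : ∀ i, S.expNonneg (fun ω => max (|a i * Xs i ω| - y) 0) ≤
      ENNReal.ofReal (m i) := by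
    intro i
    refine (hS.expNonneg_excess_le (hXs i) (ha0 i) y).trans_eq ?_
    have e : S.tailSum (Xs i) (y / a i) = S.tailSum X (y / a i) :=
      tsum_congr fun _ => htail i _
    have := ha0 i
    rw [e, hm, ENNReal.ofReal_mul (ha0 i).le, ENNReal.ofReal_toReal (hτfin _ (by positivity))]
  have hsqr : ∀ i, S.expNonneg (fun ω => clip y (a i * Xs i ω) ^ 2) ≤ ENNReal.ofReal (q i) := by
    intro i
    refine (hS.expNonneg_clip_sq_le (hXs i) (ha0 i) hy).trans_eq ?_
    rw [hq, ENNReal.ofReal_toReal (S.truncMoment_lt_top _ _ _).ne]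
    exact tsum_congr fun j => by rw [htail i]
  have hEX : ∀ i, S.E (Xs i) = 0 := fun i => (hmean i).1
  have hEnX : ∀ i, S.E (fun ω => -Xs i ω) = 0 := fun i => by
    have h3 := (hmean i).2
    have h4 := congrArg Neg.neg h3
    simpa using h4
  have hmsum : ∑ i ∈ Finset.range (n + 2), m i ≤ 2 * γ * y := by
    have hτr : (S.tailSum X (y * ((n : ℝ) + 1) ^ α / 2)).toReal ≤ 2 * γ * y :=
      ENNReal.toReal_le_of_le_ofReal (by positivity) hτ
    calc ∑ i ∈ Finset.range (n + 2), m i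
        ≤ ∑ i ∈ Finset.range (n + 2), a i * (2 * γ * y) := by
          refine Finset.sum_le_sum fun i _ => ?_
          have := ha0 i
          have h3 : S.tailSum X (y / a i) ≤ S.tailSum X (y * ((n : ℝ) + 1) ^ α / 2) := by
            apply S.tailSum_antitone
            rw [le_div_iff₀ (ha0 i), mul_div_assoc, mul_assoc]
            refine mul_le_of_le_one_right hy.le ?_
            have h4 := cesaroWeight_le h0 h1 n i
            have h5 := rpow_le_cesaroScale h1 n (n + 1 - i)
            have h6 : (0 : ℝ) < ((n : ℝ) + 1) ^ α := by positivity
            calc ((n : ℝ) + 1) ^ α / 2 * a i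
                ≤ ((n : ℝ) + 1) ^ α / 2 * (2 / ((n : ℝ) + 1) ^ α) := by
                  gcongr
                  exact h4.trans (by gcongr)
              _ = 1 := by field_simp
          have h7 := ENNReal.toReal_mono (hτfin _ (by positivity)) h3
          rw [hm]
          dsimp only
          gcongr
          exact h7.trans hτr
      _ = 2 * γ * y := by
          rw [← Finset.sum_mul, ha, sum_cesaroWeight h0, one_mul]
  have hqsum : ∑ i ∈ Finset.range (n + 2), q i ≤ B := by
    rw [hq, ← ENNReal.toReal_sum fun i _ => (S.truncMoment_lt_top _ _ _).ne]
    exact ENNReal.toReal_le_of_le_ofReal hB0.le hB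
  have hexpo : L / y * (∑ i ∈ Finset.range (n + 2), m i - 4 * γ * y) +
      (L / y) ^ 2 * Real.exp L * ∑ i ∈ Finset.range (n + 2), q i ≤ 1 - 2 * γ * L := by
    have h3 : L / y * (∑ i ∈ Finset.range (n + 2), m i - 4 * γ * y) ≤ -(2 * γ * L) := by
      calc _ ≤ L / y * (2 * γ * y - 4 * γ * y) := by gcongr
        _ = _ := by field_simp; ring
    have h4 : (L / y) ^ 2 * Real.exp L * ∑ i ∈ Finset.range (n + 2), q i ≤ 1 := by
      calc _ ≤ (L / y) ^ 2 * Real.exp L * B := by gcongr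
        _ = L ^ 2 * Real.exp L * (B / y ^ 2) := by field_simp
        _ ≤ Real.exp L * Real.exp L * (B / y ^ 2) := by gcongr; exact sq_le_exp hL
        _ = 1 := by
            rw [← Real.exp_add, ← two_mul, hexp2L]
            field_simp
    linarith
  have hpow : Real.exp (1 - 2 * γ * L) = Real.exp 1 * (B / y ^ 2) ^ γ := by
    have h3 : Real.log (B / y ^ 2) = -(2 * L) := by
      rw [← inv_div, Real.log_inv, ← hexp2L, Real.log_exp]
    rw [Real.rpow_def_of_pos (by positivity), h3, ← Real.exp_add]
    congr 1
    ring
  have hone : ∀ b : ℕ → ℝ, (∀ i, b i = a i ∨ b i = -a i) →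
      S.capacity {ω | ∃ j ≤ n + 1, 4 * γ * y ≤
        ∑ i ∈ Finset.range (j + 1), clip y (b i * Xs i ω)} ≤
      ENNReal.ofReal (Real.exp 1 * (B / y ^ 2) ^ γ) := by
    intro b hb
    refine (hindep.capacity_sum_clip_le hXs hEX hEnX hy hL hm0 hq0 (fun i => ?_) (fun i => ?_)
      (4 * γ * y) (n + 1)).trans ?_
    · rcases hb i with h | h
      · rw [h]; exact hexc i
      · simp only [h, neg_mul, abs_neg]; exact hexc i
    · rcases hb i with h | h
      · rw [h]; exact hsqr i
      · simp only [h, neg_mul, clip_neg hy.le, neg_sq]; exact hsqr i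
    · rw [← hpow]
      exact ENNReal.ofReal_le_ofReal (Real.exp_le_exp.2 hexpo)
  have hXm : ∀ i, Measurable (Xs i) := fun i => S.measurable_of_mem _ (hXs i)
  have hmeas : ∀ b : ℕ → ℝ, MeasurableSet {ω | ∃ j ≤ n + 1, 4 * γ * y ≤
      ∑ i ∈ Finset.range (j + 1), clip y (b i * Xs i ω)} := by
    intro b
    have e : {ω | ∃ j ≤ n + 1, 4 * γ * y ≤ ∑ i ∈ Finset.range (j + 1), clip y (b i * Xs i ω)} =
        ⋃ j ≤ n + 1, {ω | 4 * γ * y ≤ ∑ i ∈ Finset.range (j + 1), clip y (b i * Xs i ω)} := by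
      ext; simp
    rw [e]
    refine MeasurableSet.biUnion (Set.to_countable _) fun j _ =>
      measurableSet_le measurable_const (Finset.measurable_fun_sum _ fun i _ => ?_)
    exact S.measurable_of_mem _ (S.clip_mem y (b i) (hXs i))
  have hbig : ∀ i, MeasurableSet {ω | y < |a i * Xs i ω|} := fun i =>
    measurableSet_lt measurable_const (by have := hXm i; fun_prop)
  have hincl : {ω | 4 * γ * y < maxCesaroSum α Xs (n + 1) ω} ⊆
      (⋃ i ∈ Finset.range (n + 2), {ω | y < |a i * Xs i ω|}) ∪
      ({ω | ∃ j ≤ n + 1, 4 * γ * y ≤ ∑ i ∈ Finset.range (j + 1), clip y (a i * Xs i ω)} ∪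
       {ω | ∃ j ≤ n + 1, 4 * γ * y ≤
          ∑ i ∈ Finset.range (j + 1), clip y (-a i * Xs i ω)}) := by
    intro ω hω
    by_cases hall : ∀ i ∈ Finset.range (n + 2), |a i * Xs i ω| ≤ y
    swap
    · push Not at hall
      obtain ⟨i, hi, hlt⟩ := hall
      exact Or.inl (mem_biUnion hi hlt)
    right
    have hω' : 4 * γ * y < maxCesaroSum α Xs (n + 1) ω := hω
    rw [maxCesaroSum, Finset.lt_sup'_iff] at hω'
    obtain ⟨j, hj, hlt⟩ := hω'
    have hjn : j ≤ n + 1 := Nat.lt_succ_iff.1 (Finset.mem_range.1 hj)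
    have hclip : ∀ i ∈ Finset.range (j + 1),
        cesaro (α - 1) (n + 1 - i) * Xs i ω / cesaro α (n + 1) = clip y (a i * Xs i ω) := by
      intro i hi
      have hi' := Finset.mem_range.1 hi
      rw [clip_of_abs_le (hall i (Finset.mem_range.2 (by omega))), ha, cesaroWeight]
      ring
    rw [Finset.sum_congr rfl hclip] at hlt
    rcases lt_abs.1 hlt with h3 | h3
    · exact Or.inl ⟨j, hjn, h3.le⟩
    · refine Or.inr ⟨j, hjn, ?_⟩
      simp only [neg_mul, clip_neg hy.le, Finset.sum_neg_distrib]
      exact h3.le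
  have hbigcap : ∑ i ∈ Finset.range (n + 2), S.capacity {ω | y < |a i * Xs i ω|} ≤
      ∑ k ∈ Finset.range (n + 2), S.tail X (y / 2 * cesaroScale α n k) := by
    rw [← Finset.sum_range_reflect (fun k => S.tail X (y / 2 * cesaroScale α n k))]
    refine Finset.sum_le_sum fun i _ => ?_
    rw [← htail i]
    refine S.capacity_mono fun ω hω => ?_
    have h3 : y < |a i * Xs i ω| := hω
    rw [abs_mul, abs_of_pos (ha0 i)] at h3
    have h4 := cesaroWeight_le h0 h1 n i
    have h5 := cesaroScale_pos α n (n + 1 - i)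
    change y / 2 * cesaroScale α n (n + 2 - 1 - i) < |Xs i ω|
    rw [show n + 2 - 1 - i = n + 1 - i by omega]
    have h6 : y < 2 / cesaroScale α n (n + 1 - i) * |Xs i ω| :=
      h3.trans_le (mul_le_mul_of_nonneg_right h4 (abs_nonneg _))
    rw [div_mul_eq_mul_div, lt_div_iff₀ h5] at h6
    linarith
  calc _ ≤ _ := S.capacity_mono hincl
    _ ≤ S.capacity (⋃ i ∈ Finset.range (n + 2), {ω | y < |a i * Xs i ω|}) +
        (_ + _) := by
        refine (S.capacity_union_le (Finset.measurableSet_biUnion _ fun i _ => hbig i)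
          ((hmeas a).union (hmeas fun i => -a i))).trans ?_
        gcongr
        exact S.capacity_union_le (hmeas a) (hmeas fun i => -a i)
    _ ≤ _ := by
        rw [two_mul]
        gcongr
        · exact (S.capacity_biUnion_le _ hbig).trans hbigcap
        · exact hone a fun i => Or.inl rfl
        · exact hone (fun i => -a i) fun i => Or.inr rfl

end SublinearExpectationSpace

/-! ### From the moment condition to complete convergence -/

theorem tsum_lt_top_of_le_of_le {f g : ℕ → ℝ≥0∞} (hf : ∀ n, f n < ⊤) {N : ℕ}
    (h : ∀ n, N ≤ n → f n ≤ g n) (hg : ∑' n, g n < ⊤) : ∑' n, f n < ⊤ := by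
  have hle : ∀ n, f n ≤ (if n ∈ Finset.range N then f n else 0) + g n := fun n => by
    by_cases hn : n < N
    · simp [hn]
    · simpa [hn] using h n (not_lt.1 hn)
  refine (ENNReal.tsum_le_tsum hle).trans_lt ?_
  rw [ENNReal.tsum_add]
  refine ENNReal.add_lt_top.2 ⟨?_, hg⟩
  rw [tsum_eq_sum (s := Finset.range N) fun n hn => if_neg hn]
  exact ENNReal.sum_lt_top.2 fun n hn => by rw [if_pos hn]; exact hf n

namespace SublinearExpectationSpace

variable {Ω : Type*} [MeasurableSpace Ω] (S : SublinearExpectationSpace Ω)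

theorem tailSum_lt_top {α r : ℝ} (h0 : 0 < α) (hr : 1 ≤ r) {X : Ω → ℝ}
    (hM : S.choquet (fun ω => momentFun α r |X ω|) < ⊤) : S.tailSum X 0 < ⊤ := by
  have hl : 0 < Real.log 2 := Real.log_pos (by norm_num)
  have key := S.tsum_mul_tail_lt_top (fun t ht => momentFun_nonneg α r ht)
    (momentFun_monotoneOn h0 hr) hM (w := fun _ : ℕ => 1) (s := fun m => (m : ℝ) + 1)
    (fun m => by positivity) (C := ENNReal.ofReal (Real.log 2)⁻¹) ENNReal.ofReal_ne_top
    (fun t ht => by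
      rw [tsum_ite_add_one_le _ ht, Finset.sum_const, Finset.card_range, nsmul_eq_mul, mul_one,
        ← ENNReal.ofReal_mul (by positivity)]
      rcases lt_or_ge t 1 with h | h
      · rw [Nat.floor_eq_zero.2 h]; simp
      · rw [← ENNReal.ofReal_natCast]
        apply ENNReal.ofReal_le_ofReal
        calc (⌊t⌋₊ : ℝ) ≤ t := Nat.floor_le ht
          _ ≤ t ^ r := by simpa using Real.rpow_le_rpow_of_exponent_le h hr
          _ ≤ _ := rpow_le_momentFun h0 hr h)
  simp only [one_mul] at key
  have e : S.tailSum X 0 = S.tail X 0 + ∑' m : ℕ, S.tail X ((m : ℝ) + 1) := by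
    rw [tailSum, tsum_eq_zero_add' ENNReal.summable]
    simp
  rw [e]
  exact ENNReal.add_lt_top.2 ⟨(S.tail_le_one X 0).trans_lt (by simp), key⟩

/-- The excess series at the truncation level `y n^α` is eventually small, uniformly in
`y ≥ y₀`. -/
theorem exists_tailSum_le {X : Ω → ℝ} (hfin : S.tailSum X 0 < ⊤) {α γ y₀ : ℝ} (h0 : 0 < α)
    (hγ : 0 < γ) (hy₀ : 0 < y₀) : ∃ N : ℕ, ∀ n, N ≤ n → ∀ y, y₀ ≤ y →
      S.tailSum X (y * ((n : ℝ) + 1) ^ α / 2) ≤ ENNReal.ofReal (2 * γ * y) := by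
  have hpos : 0 < ENNReal.ofReal (2 * γ * y₀) := by
    rw [ENNReal.ofReal_pos]; positivity
  have hfin' : ∑' m : ℕ, S.tail X m ≠ ⊤ := by simpa [tailSum] using hfin.ne
  obtain ⟨c, hc⟩ := ((ENNReal.tendsto_sum_nat_add _ hfin').eventually_lt_const
    hpos).exists_forall_of_atTop
  have htend : Filter.Tendsto (fun n : ℕ => ((n : ℝ) + 1) ^ α) Filter.atTop Filter.atTop :=
    (tendsto_rpow_atTop h0).comp
      (Filter.tendsto_atTop_add_const_right _ _ tendsto_natCast_atTop_atTop)
  obtain ⟨N, hN⟩ := (htend.eventually_ge_atTop (2 * c / y₀)).exists_forall_of_atTop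
  refine ⟨N, fun n hn y hy => ?_⟩
  have h1 : (c : ℝ) ≤ y * ((n : ℝ) + 1) ^ α / 2 := by
    have h2 := hN n hn
    rw [div_le_iff₀ hy₀] at h2
    have h3 : ((n : ℝ) + 1) ^ α * y₀ ≤ ((n : ℝ) + 1) ^ α * y := by gcongr
    linarith
  calc S.tailSum X (y * ((n : ℝ) + 1) ^ α / 2) ≤ S.tailSum X c := S.tailSum_antitone X h1
    _ = ∑' m : ℕ, S.tail X ((m + c : ℕ) : ℝ) := by
        refine tsum_congr fun m => ?_
        push_cast
        rw [add_comm]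
    _ ≤ ENNReal.ofReal (2 * γ * y₀) := (hc c le_rfl).le
    _ ≤ _ := by gcongr

/-- A weak-type bound for the tail. -/
theorem exists_tail_le_rpow {α r p : ℝ} (h0 : 0 < α) (hr : 1 ≤ r) (hp0 : 0 ≤ p) (hpr : p ≤ r)
    {X : Ω → ℝ} (hM : S.choquet (fun ω => momentFun α r |X ω|) < ⊤) :
    ∃ K : ℝ, 0 < K ∧ ∀ t, 0 < t → S.tail X t ≤ ENNReal.ofReal (K * t ^ (-p)) := by
  rw [S.choquet_lt_top_iff fun ω => momentFun_nonneg α r (abs_nonneg _)] at hM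
  set I := ∫⁻ x in Ioi (0 : ℝ), S.capacity {ω | x < momentFun α r |X ω|} with hI
  set C := ENNReal.ofReal (Real.log 2)⁻¹ * I with hC
  have hCfin : C ≠ ⊤ := ENNReal.mul_ne_top ENNReal.ofReal_ne_top hM.ne
  refine ⟨max 1 C.toReal, by positivity, fun t ht => ?_⟩
  rcases le_or_gt t 1 with h | h
  · refine (S.tail_le_one X t).trans ?_
    rw [← ENNReal.ofReal_one]
    apply ENNReal.ofReal_le_ofReal
    exact one_le_mul_of_one_le_of_one_le (le_max_left _ _)
      (Real.one_le_rpow_of_pos_of_le_one_of_nonpos ht h (by linarith))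
  · have key := tsum_mul_le_lintegral (v := S.tail X) (Φ := momentFun α r)
      (S.measurable_capacity_gt fun ω => momentFun α r |X ω|)
      (fun s hs x _ hx => S.capacity_mono fun ω hω => hx.trans_le
        (momentFun_monotoneOn h0 hr hs (mem_Ici.2 (abs_nonneg _)) (le_of_lt hω)))
      (w := fun _ : Unit => ENNReal.ofReal (t ^ r)) (s := fun _ => t) (fun _ => ht.le)
      (C := ENNReal.ofReal (Real.log 2)⁻¹) (fun u hu => by
        rw [tsum_fintype, Finset.sum_const, Finset.card_univ, Fintype.card_unit, one_smul]
        have hl : 0 < Real.log 2 := Real.log_pos (by norm_num)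
        split_ifs with htu
        · rw [← ENNReal.ofReal_mul (by positivity)]
          apply ENNReal.ofReal_le_ofReal
          refine le_trans ?_ (rpow_le_momentFun h0 hr (h.le.trans htu))
          exact Real.rpow_le_rpow ht.le htu (by linarith)
        · exact zero_le)
    rw [tsum_fintype, Finset.sum_const, Finset.card_univ, Fintype.card_unit, one_smul] at key
    have htr : 0 < t ^ r := by positivity
    have h2 : S.tail X t ≤ C / ENNReal.ofReal (t ^ r) := by
      rw [ENNReal.le_div_iff_mul_le (Or.inl (by simpa using htr)) (Or.inl ENNReal.ofReal_ne_top),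
        mul_comm]
      exact key
    refine h2.trans ?_
    have h3 : C / ENNReal.ofReal (t ^ r) = ENNReal.ofReal (C.toReal / t ^ r) := by
      rw [ENNReal.ofReal_div_of_pos htr, ENNReal.ofReal_toReal hCfin]
    rw [h3]
    apply ENNReal.ofReal_le_ofReal
    rw [div_eq_mul_inv, ← Real.rpow_neg ht.le]
    exact mul_le_mul (le_max_right _ _)
      (Real.rpow_le_rpow_of_exponent_le h.le (by linarith)) (by positivity) (by positivity)

/-- Summability of the single-term probabilities over all indices and a family of levels `c j`,
by counting the indices below a level and summing over the levels. -/
theorem tsum_tsum_indexWeight_mul_tail_lt_top {α r : ℝ} (h0 : 0 < α) (h1 : α ≤ 1) (hr : 1 ≤ r)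
    {X : Ω → ℝ} (hM : S.choquet (fun ω => momentFun α r |X ω|) < ⊤) {w g c : ℕ → ℝ}
    (hw : ∀ j, 0 ≤ w j) (hg : ∀ j, 0 ≤ g j) (hc : ∀ j, 0 < c j)
    (hΦ : ∀ j t, 0 ≤ t → momentFun α r (t / c j) ≤ g j * momentFun α r t)
    (hsum : Summable fun j => w j * g j) :
    ∑' j, ENNReal.ofReal (w j) *
      ∑' p : ℕ × ℕ, indexWeight r p * S.tail X (c j * cesaroScale α p.1 p.2) < ⊤ := by
  obtain ⟨K, hK0, hK⟩ := exists_tsum_indexWeight_le h0 h1 hr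
  have e : ∑' j, ENNReal.ofReal (w j) *
      ∑' p : ℕ × ℕ, indexWeight r p * S.tail X (c j * cesaroScale α p.1 p.2) =
      ∑' x : ℕ × (ℕ × ℕ), (ENNReal.ofReal (w x.1) * indexWeight r x.2) *
        S.tail X (c x.1 * cesaroScale α x.2.1 x.2.2) := by
    rw [ENNReal.tsum_prod']
    refine tsum_congr fun j => ?_
    rw [← ENNReal.tsum_mul_left]
    exact tsum_congr fun p => (mul_assoc _ _ _).symm
  rw [e]
  refine S.tsum_mul_tail_lt_top (fun t ht => momentFun_nonneg α r ht)
    (momentFun_monotoneOn h0 hr) hM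
    (s := fun x : ℕ × (ℕ × ℕ) => c x.1 * cesaroScale α x.2.1 x.2.2)
    (fun x => (mul_pos (hc _) (cesaroScale_pos _ _ _)).le)
    (C := ENNReal.ofReal (K * ∑' j, w j * g j)) ENNReal.ofReal_ne_top fun t ht => ?_
  rw [ENNReal.tsum_prod', ENNReal.ofReal_mul hK0,
    ENNReal.ofReal_tsum_of_nonneg (fun j => mul_nonneg (hw j) (hg j)) hsum, mul_assoc, mul_comm,
    mul_assoc, ← ENNReal.tsum_mul_right]
  refine ENNReal.tsum_le_tsum fun j => ?_
  have hscale : ∀ p : ℕ × ℕ, c j * cesaroScale α p.1 p.2 ≤ t ↔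
      cesaroScale α p.1 p.2 ≤ t / c j := fun p => by rw [le_div_iff₀ (hc j), mul_comm]
  have hΦ0 := momentFun_nonneg α r ht
  calc ∑' p : ℕ × ℕ, (if c j * cesaroScale α p.1 p.2 ≤ t then
        ENNReal.ofReal (w j) * indexWeight r p else 0)
      = ENNReal.ofReal (w j) *
          ∑' p : ℕ × ℕ, (if cesaroScale α p.1 p.2 ≤ t / c j then indexWeight r p else 0) := by
        rw [← ENNReal.tsum_mul_left]
        refine tsum_congr fun p => ?_
        simp only [hscale, mul_ite, mul_zero]
    _ ≤ ENNReal.ofReal (w j) * ENNReal.ofReal (K * momentFun α r (t / c j)) := by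
        gcongr
        exact hK _ (div_nonneg ht (hc j).le)
    _ ≤ ENNReal.ofReal (w j) * ENNReal.ofReal (K * (g j * momentFun α r t)) := by
        gcongr
        exact hΦ j t ht
    _ = _ := by
        rw [← ENNReal.ofReal_mul (hw j), ← ENNReal.ofReal_mul hΦ0,
          ← ENNReal.ofReal_mul (mul_nonneg (hw j) (hg j))]
        congr 1
        ring

/-- Geometric estimate of the truncated second moment under a weak-type bound of order
`p < 2`. -/
theorem truncMoment_le {X : Ω → ℝ} {K p : ℝ} (hK : 0 < K) (hp : p < 2)
    (htail : ∀ t, 0 < t → S.tail X t ≤ ENNReal.ofReal (K * t ^ (-p))) {y a : ℝ} (hy : 0 < y)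
    (ha : 0 < a) : S.truncMoment X y a ≤
      ENNReal.ofReal (K * 2 ^ p * (1 - 2 ^ p / 4)⁻¹ * y ^ 2 * y ^ (-p) * a ^ p) := by
  have h4 : (2 : ℝ) ^ p < 4 := by
    calc (2 : ℝ) ^ p < 2 ^ (2 : ℝ) := Real.rpow_lt_rpow_of_exponent_lt (by norm_num) hp
      _ = 4 := by norm_num
  have hgeo : HasSum (fun j : ℕ => ((2 : ℝ) ^ p / 4) ^ j) (1 - 2 ^ p / 4)⁻¹ :=
    hasSum_geometric_of_lt_one (by positivity) (by linarith)
  have hgeo' := hgeo.mul_left (K * 2 ^ p * y ^ 2 * y ^ (-p) * a ^ p)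
  have e : K * 2 ^ p * (1 - 2 ^ p / 4)⁻¹ * y ^ 2 * y ^ (-p) * a ^ p =
      ∑' j : ℕ, K * 2 ^ p * y ^ 2 * y ^ (-p) * a ^ p * ((2 : ℝ) ^ p / 4) ^ j := by
    rw [hgeo'.tsum_eq]; ring
  rw [e, ENNReal.ofReal_tsum_of_nonneg (fun j => by positivity) hgeo'.summable]
  refine ENNReal.tsum_le_tsum fun j => ?_
  refine (mul_le_mul_right (htail _ (by positivity)) _).trans_eq ?_
  rw [← ENNReal.ofReal_mul (by positivity)]
  congr 1
  have e2 : (((1 : ℝ) / 2) ^ (j + 1)) ^ (-p) = 2 ^ p * ((2 : ℝ) ^ p) ^ j := by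
    rw [← pow_succ', one_div, inv_pow, Real.inv_rpow (by positivity), Real.rpow_neg (by positivity),
      inv_inv, ← Real.rpow_natCast, ← Real.rpow_natCast, ← Real.rpow_mul (by norm_num),
      ← Real.rpow_mul (by norm_num), mul_comm]
  rw [Real.div_rpow (by positivity) ha.le, Real.mul_rpow hy.le (by positivity), e2,
    Real.rpow_neg ha.le, div_inv_eq_mul, div_pow, div_pow, one_pow]
  ring

/-- The moment condition implies complete convergence for `r = 1`. -/
theorem completeConvergence_one_of_choquet (hS : S.CountablySubadditive) {α : ℝ} (h0 : 0 < α)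
    (h1 : α ≤ 1) {X : Ω → ℝ} (hX : X ∈ S.H) {Xs : ℕ → Ω → ℝ} (hXs : ∀ i, Xs i ∈ S.H)
    (hindep : S.IndepSeq Xs) (hident : ∀ i, S.IdentDist (Xs i) X)
    (hmean : ∀ i, S.E (Xs i) = 0 ∧ -S.E (fun ω => -Xs i ω) = 0)
    (hM : S.choquet (fun ω => momentFun α 1 |X ω|) < ⊤) :
    S.CompleteConvergence 1 (maxCesaroSum α Xs) := by
  intro ε hε
  have hfin := S.tailSum_lt_top h0 le_rfl hM
  have hΦ : ∀ t, momentFun α 1 t = t := fun t => by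
    rw [momentFun, if_neg (by simpa using h0.le), if_neg (by simpa using h0.ne'), Real.rpow_one]
  set y := ε / 4 with hy'
  have hy : 0 < y := by positivity
  obtain ⟨N, hN⟩ := S.exists_tailSum_le hfin h0 one_pos hy
  set Q : ℕ → ℝ≥0∞ := fun n =>
    ∑ i ∈ Finset.range (n + 2), S.truncMoment X y (cesaroWeight α (n + 1) i) with hQ
  have hQfin : ∀ n, Q n ≠ ⊤ := fun n =>
    (ENNReal.sum_lt_top.2 fun i _ => S.truncMoment_lt_top _ _ _).ne
  -- the levels `y 2⁻ʲ⁻²`; the first one is below the level `y / 2` of the single terms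
  have hdouble := S.tsum_tsum_indexWeight_mul_tail_lt_top h0 h1 le_rfl hM
    (w := fun j => (1 / 4) ^ j) (g := fun j => 4 / y * 2 ^ j)
    (c := fun j => y * (1 / 2) ^ (j + 2)) (fun j => by positivity) (fun j => by positivity)
    (fun j => by positivity) (fun j t _ => by
      rw [hΦ, hΦ]
      apply le_of_eq
      rw [one_div, inv_pow, pow_add]
      field_simp
      norm_num)
    (by
      have : Summable fun j : ℕ => 4 / y * (1 / 2 : ℝ) ^ j :=
        (summable_geometric_of_lt_one (by norm_num) (by norm_num)).mul_left _
      refine this.congr fun j => ?_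
      rw [mul_left_comm, ← mul_pow]
      norm_num)
  have hsingle : ∑' n : ℕ, ENNReal.ofReal (((n : ℝ) + 1) ^ ((1 : ℝ) - 2)) *
      ∑ k ∈ Finset.range (n + 2), S.tail X (y / 2 * cesaroScale α n k) < ⊤ := by
    refine lt_of_le_of_lt ?_ ((ENNReal.le_tsum 0).trans_lt hdouble)
    rw [pow_zero, ENNReal.ofReal_one, one_mul, tsum_indexWeight_mul]
    gcongr with n k
    refine S.tail_antitone X ?_
    have := cesaroScale_pos α n k
    dsimp only
    gcongr
    linarith
  have hvar : ∑' n : ℕ, ENNReal.ofReal (((n : ℝ) + 1) ^ ((1 : ℝ) - 2)) * Q n < ⊤ := by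
    have hle : ∀ n, Q n ≤ ENNReal.ofReal (y ^ 2) * ∑' j : ℕ, ENNReal.ofReal ((1 / 4) ^ j) *
        ∑ k ∈ Finset.range (n + 2), S.tail X (y * (1 / 2) ^ (j + 2) * cesaroScale α n k) := by
      intro n
      have e : ∀ i, i ∈ Finset.range (n + 2) → S.truncMoment X y (cesaroWeight α (n + 1) i) ≤
          ENNReal.ofReal (y ^ 2) * ∑' j : ℕ, ENNReal.ofReal ((1 / 4) ^ j) *
            S.tail X (y * (1 / 2) ^ (j + 2) * cesaroScale α n (n + 2 - 1 - i)) := by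
        intro i _
        rw [truncMoment, ← ENNReal.tsum_mul_left]
        refine ENNReal.tsum_le_tsum fun j => ?_
        rw [ENNReal.ofReal_mul (by positivity), mul_assoc]
        gcongr
        refine S.tail_antitone X ?_
        have h3 := cesaroWeight_le h0 h1 n i
        have h4 := cesaroScale_pos α n (n + 1 - i)
        rw [show n + 2 - 1 - i = n + 1 - i by omega, le_div_iff₀ (cesaroWeight_pos h0 _ _)]
        calc y * (1 / 2) ^ (j + 2) * cesaroScale α n (n + 1 - i) * cesaroWeight α (n + 1) i
            ≤ y * (1 / 2) ^ (j + 2) * cesaroScale α n (n + 1 - i) *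
                (2 / cesaroScale α n (n + 1 - i)) := by gcongr
          _ = y * (1 / 2) ^ (j + 1) := by
              rw [pow_succ _ (j + 1)]; field_simp
      refine (Finset.sum_le_sum e).trans_eq ?_
      rw [← Finset.mul_sum, ← Summable.tsum_finsetSum fun _ _ => ENNReal.summable]
      congr 1
      refine tsum_congr fun j => ?_
      rw [← Finset.mul_sum, Finset.sum_range_reflect
        (fun k => S.tail X (y * (1 / 2) ^ (j + 2) * cesaroScale α n k))]
    calc _ ≤ ∑' n : ℕ, ENNReal.ofReal (((n : ℝ) + 1) ^ ((1 : ℝ) - 2)) *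
          (ENNReal.ofReal (y ^ 2) * ∑' j : ℕ, ENNReal.ofReal ((1 / 4) ^ j) *
          ∑ k ∈ Finset.range (n + 2), S.tail X (y * (1 / 2) ^ (j + 2) * cesaroScale α n k)) := by
          gcongr with n
          exact hle n
      _ = ENNReal.ofReal (y ^ 2) * ∑' j : ℕ, ENNReal.ofReal ((1 / 4) ^ j) *
          ∑' p : ℕ × ℕ, indexWeight 1 p *
            S.tail X (y * (1 / 2) ^ (j + 2) * cesaroScale α p.1 p.2) := by
          simp only [tsum_indexWeight_mul, ← ENNReal.tsum_mul_left]
          rw [ENNReal.tsum_comm]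
          refine tsum_congr fun j => tsum_congr fun n => ?_
          ring
      _ < ⊤ := ENNReal.mul_lt_top ENNReal.ofReal_lt_top hdouble
  have hinv : ∑' n : ℕ, ENNReal.ofReal (((n : ℝ) + 1) ^ ((1 : ℝ) - 2)) *
      ENNReal.ofReal (((n : ℝ) + 1) ^ (-1 : ℝ)) < ⊤ := by
    have hs : Summable fun n : ℕ => ((n : ℝ) + 1) ^ (-2 : ℝ) := by
      simpa using
        (summable_nat_add_iff 1).2 (Real.summable_nat_rpow.2 (show (-2 : ℝ) < -1 by norm_num))
    have e : ∀ n : ℕ, ENNReal.ofReal (((n : ℝ) + 1) ^ ((1 : ℝ) - 2)) *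
        ENNReal.ofReal (((n : ℝ) + 1) ^ (-1 : ℝ)) = ENNReal.ofReal (((n : ℝ) + 1) ^ (-2 : ℝ)) :=
      fun n => by
        rw [← ENNReal.ofReal_mul (by positivity), ← Real.rpow_add (by positivity)]
        norm_num
    simp only [e]
    rw [← ENNReal.ofReal_tsum_of_nonneg (fun n => by positivity) hs]
    exact ENNReal.ofReal_lt_top
  refine tsum_lt_top_of_le_of_le (N := N) (g := fun n =>
    ENNReal.ofReal (((n : ℝ) + 1) ^ ((1 : ℝ) - 2)) *
      ∑ k ∈ Finset.range (n + 2), S.tail X (y / 2 * cesaroScale α n k) +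
    2 * ENNReal.ofReal (Real.exp 1 / y ^ 2) *
      (ENNReal.ofReal (((n : ℝ) + 1) ^ ((1 : ℝ) - 2)) * Q n +
        ENNReal.ofReal (((n : ℝ) + 1) ^ ((1 : ℝ) - 2)) *
          ENNReal.ofReal (((n : ℝ) + 1) ^ (-1 : ℝ)))) (fun n => ?_) (fun n hn => ?_) ?_
  · exact ENNReal.mul_lt_top ENNReal.ofReal_lt_top ((S.capacity_le_one _).trans_lt (by simp))
  · -- the summand `(n + 1)⁻¹` only serves to make the variance bound positive
    have key := hindep.capacity_maxCesaroSum_le hS h0 h1 hX hXs hident hmean hfin.ne (n := n)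
      hy one_pos (hN n hn y le_rfl) (B := (Q n).toReal + ((n : ℝ) + 1) ^ (-1 : ℝ))
      (add_pos_of_nonneg_of_pos ENNReal.toReal_nonneg (by positivity))
      (by
        rw [ENNReal.ofReal_add ENNReal.toReal_nonneg (by positivity),
          ENNReal.ofReal_toReal (hQfin n)]
        exact le_self_add)
    rw [show 4 * 1 * y = ε by rw [hy']; ring, Real.rpow_one, ← mul_div_assoc,
      mul_div_right_comm, ENNReal.ofReal_mul (by positivity),
      ENNReal.ofReal_add ENNReal.toReal_nonneg (by positivity),
      ENNReal.ofReal_toReal (hQfin n)] at key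
    push_cast
    refine (mul_le_mul_right key _).trans_eq ?_
    ring
  · rw [ENNReal.tsum_add, ENNReal.tsum_mul_left, ENNReal.tsum_add]
    exact ENNReal.add_lt_top.2 ⟨hsingle, ENNReal.mul_lt_top
      (ENNReal.mul_lt_top (by simp) ENNReal.ofReal_lt_top) (ENNReal.add_lt_top.2 ⟨hvar, hinv⟩)⟩

theorem expNonneg_maxCesaroSum_lt_top (hS : S.CountablySubadditive) {α : ℝ} (h0 : 0 < α)
    {X : Ω → ℝ} (hX : X ∈ S.H) {Xs : ℕ → Ω → ℝ} (hXs : ∀ i, Xs i ∈ S.H)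
    (hident : ∀ i, S.IdentDist (Xs i) X) (hfin : S.tailSum X 0 < ⊤) (n : ℕ) :
    S.expNonneg (maxCesaroSum α Xs n) < ⊤ := by
  have habs : ∀ i, (fun ω => |cesaroWeight α n i * Xs i ω|) ∈ S.H := fun i =>
    S.abs_mem (S.const_mul_mem _ (hXs i))
  have hle : ∀ ω, maxCesaroSum α Xs n ω ≤
      ∑ i ∈ Finset.range (n + 1), |cesaroWeight α n i * Xs i ω| := by
    intro ω
    refine Finset.sup'_le _ _ fun j hj => ?_
    have hj' := Finset.mem_range.1 hj
    calc |∑ i ∈ Finset.range (j + 1), cesaro (α - 1) (n - i) * Xs i ω / cesaro α n|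
        ≤ ∑ i ∈ Finset.range (j + 1), |cesaro (α - 1) (n - i) * Xs i ω / cesaro α n| :=
          Finset.abs_sum_le_sum_abs _ _
      _ = ∑ i ∈ Finset.range (j + 1), |cesaroWeight α n i * Xs i ω| := by
          refine Finset.sum_congr rfl fun i _ => ?_
          rw [cesaroWeight, div_mul_eq_mul_div]
      _ ≤ _ := Finset.sum_le_sum_of_subset_of_nonneg (Finset.range_mono (by omega))
          fun i _ _ => abs_nonneg _
  refine (S.expNonneg_mono (S.maxCesaroSum_mem hXs α n) (S.sum_mem _ fun i _ => habs i)
    hle).trans_lt ((S.expNonneg_sum_le _ (fun i _ => habs i) fun i _ ω => abs_nonneg _).trans_lt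
    (ENNReal.sum_lt_top.2 fun i _ => ?_))
  have h1 := hS.expNonneg_excess_le (hXs i) (cesaroWeight_pos h0 n i) 0
  have e : (fun ω => max (|cesaroWeight α n i * Xs i ω| - 0) 0) =
      fun ω => |cesaroWeight α n i * Xs i ω| := by
    funext ω; rw [sub_zero, max_eq_left (abs_nonneg _)]
  have e2 : S.tailSum (Xs i) (0 / cesaroWeight α n i) = S.tailSum X 0 := by
    rw [zero_div]
    exact tsum_congr fun m => (hident i).tail_eq (hXs i) hX _
  rw [e, e2] at h1
  exact h1.trans_lt (ENNReal.mul_lt_top ENNReal.ofReal_lt_top hfin)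

/-- The moment condition implies complete moment convergence for `r > 1`. The expectation of
`(M - ε)⁺` is split into the layers `M > 2ʲ ε`. -/
theorem completeMomentConvergence_of_choquet (hS : S.CountablySubadditive) {α r : ℝ}
    (h0 : 0 < α) (h1 : α ≤ 1) (hr : 1 < r) {X : Ω → ℝ} (hX : X ∈ S.H) {Xs : ℕ → Ω → ℝ}
    (hXs : ∀ i, Xs i ∈ S.H) (hindep : S.IndepSeq Xs) (hident : ∀ i, S.IdentDist (Xs i) X)
    (hmean : ∀ i, S.E (Xs i) = 0 ∧ -S.E (fun ω => -Xs i ω) = 0)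
    (hM : S.choquet (fun ω => momentFun α r |X ω|) < ⊤) :
    S.CompleteMomentConvergence r (maxCesaroSum α Xs) := by
  intro ε hε
  have hfin := S.tailSum_lt_top h0 hr.le hM
  set p := min r (3 / 2) with hp
  have hp1 : 1 < p := lt_min hr (by norm_num)
  have hp2 : p < 2 := (min_le_right _ _).trans_lt (by norm_num)
  obtain ⟨K, hK, htail⟩ := S.exists_tail_le_rpow h0 hr.le (by linarith) (min_le_left r (3 / 2)) hM
  rw [← hp] at htail
  -- with this power the factor `n ^ (-α (p - 1) γ)` beats `n ^ (r - 2)`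
  set γ := max 1 (r / (α * (p - 1))) with hγ
  have hγ1 : 1 ≤ γ := le_max_left _ _
  have hγ0 : 0 < γ := by linarith
  have hαp : 0 < α * (p - 1) := mul_pos h0 (by linarith)
  have hγr : r ≤ α * (p - 1) * γ := by
    have := le_max_right 1 (r / (α * (p - 1)))
    rwa [← hγ, div_le_iff₀' hαp] at this
  have hpγ : 1 < p * γ := by nlinarith
  set y₀ := ε / (4 * γ) with hy₀
  have hy₀0 : 0 < y₀ := by positivity
  obtain ⟨N, hN⟩ := S.exists_tailSum_le hfin h0 hγ0 hy₀0
  have h4 : (2 : ℝ) ^ p < 4 := by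
    calc (2 : ℝ) ^ p < 2 ^ (2 : ℝ) := Real.rpow_lt_rpow_of_exponent_lt (by norm_num) hp2
      _ = 4 := by norm_num
  have hgeo : 0 < (1 - (2 : ℝ) ^ p / 4)⁻¹ := inv_pos.2 (by linarith)
  set D := K * 2 ^ p * (1 - 2 ^ p / 4)⁻¹ * 2 ^ (p - 1) with hD
  have hD0 : 0 < D := by positivity
  have hlevel : ∀ n, N ≤ n → ∀ j : ℕ,
      S.capacity {ω | 2 ^ j * ε < maxCesaroSum α Xs (n + 1) ω} ≤
        ∑ k ∈ Finset.range (n + 2), S.tail X (2 ^ j * y₀ / 2 * cesaroScale α n k) +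
        2 * ENNReal.ofReal (Real.exp 1 * (D ^ γ * (2 ^ j * y₀) ^ (-(p * γ)) *
          ((n : ℝ) + 1) ^ (-r))) := by
    intro n hn j
    set y := 2 ^ j * y₀ with hy
    have hyy : y₀ ≤ y := le_mul_of_one_le_left hy₀0.le (one_le_pow₀ (by norm_num))
    have hy0 : 0 < y := hy₀0.trans_le hyy
    have hn1 : (1 : ℝ) ≤ (n : ℝ) + 1 := by linarith [(n.cast_nonneg : (0 : ℝ) ≤ n)]
    set B := D * y ^ 2 * y ^ (-p) * ((n : ℝ) + 1) ^ (-(α * (p - 1))) with hB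
    have hpow : ∑ i ∈ Finset.range (n + 2), cesaroWeight α (n + 1) i ^ p ≤
        2 ^ (p - 1) * ((n : ℝ) + 1) ^ (-(α * (p - 1))) := by
      calc _ ≤ ∑ i ∈ Finset.range (n + 2), cesaroWeight α (n + 1) i *
            (2 ^ (p - 1) * ((n : ℝ) + 1) ^ (-(α * (p - 1)))) := by
            refine Finset.sum_le_sum fun i _ => ?_
            have ha := cesaroWeight_pos h0 (n + 1) i
            have h3 : cesaroWeight α (n + 1) i ≤ 2 / ((n : ℝ) + 1) ^ α := by
              refine (cesaroWeight_le h0 h1 n i).trans ?_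
              have := rpow_le_cesaroScale h1 n (n + 1 - i)
              gcongr
            calc cesaroWeight α (n + 1) i ^ p
                = cesaroWeight α (n + 1) i * cesaroWeight α (n + 1) i ^ (p - 1) := by
                  rw [← Real.rpow_one_add' ha.le (by linarith)]; congr 1; ring
              _ ≤ cesaroWeight α (n + 1) i * (2 / ((n : ℝ) + 1) ^ α) ^ (p - 1) := by
                  have := Real.rpow_le_rpow ha.le h3 (show 0 ≤ p - 1 by linarith)
                  gcongr
              _ = _ := by
                  rw [Real.div_rpow (by norm_num) (by positivity), ← Real.rpow_mul (by positivity),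
                    Real.rpow_neg (by positivity), div_eq_mul_inv]
        _ = _ := by
            rw [← Finset.sum_mul, sum_cesaroWeight h0, one_mul]
    have key := hindep.capacity_maxCesaroSum_le hS h0 h1 hX hXs hident hmean hfin.ne (n := n)
      hy0 hγ0 (hN n hn y hyy) (B := B) (by positivity) (by
        calc _ ≤ ∑ i ∈ Finset.range (n + 2), ENNReal.ofReal
              (K * 2 ^ p * (1 - 2 ^ p / 4)⁻¹ * y ^ 2 * y ^ (-p) *
                cesaroWeight α (n + 1) i ^ p) :=
              Finset.sum_le_sum fun i _ =>
                S.truncMoment_le hK hp2 htail hy0 (cesaroWeight_pos h0 _ _)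
          _ = ENNReal.ofReal (K * 2 ^ p * (1 - 2 ^ p / 4)⁻¹ * y ^ 2 * y ^ (-p) *
                ∑ i ∈ Finset.range (n + 2), cesaroWeight α (n + 1) i ^ p) := by
              rw [Finset.mul_sum, ENNReal.ofReal_sum_of_nonneg fun i _ => ?_]
              have := cesaroWeight_pos h0 (n + 1) i
              positivity
          _ ≤ _ := by
              apply ENNReal.ofReal_le_ofReal
              calc _ ≤ K * 2 ^ p * (1 - 2 ^ p / 4)⁻¹ * y ^ 2 * y ^ (-p) *
                    (2 ^ (p - 1) * ((n : ℝ) + 1) ^ (-(α * (p - 1)))) := by gcongr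
                _ = _ := by rw [hB, hD]; ring)
    rw [show 4 * γ * y = 2 ^ j * ε by rw [hy, hy₀]; field_simp] at key
    refine key.trans ?_
    gcongr
    have e : B / y ^ 2 = D * y ^ (-p) * ((n : ℝ) + 1) ^ (-(α * (p - 1))) := by
      rw [hB]; field_simp
    rw [e, Real.mul_rpow (by positivity) (by positivity), Real.mul_rpow hD0.le (by positivity),
      ← Real.rpow_mul hy0.le, ← Real.rpow_mul (by positivity), neg_mul, neg_mul]
    gcongr
  have hlayer : ∀ n, N ≤ n → S.expNonneg (fun ω => max (maxCesaroSum α Xs (n + 1) ω - ε) 0) ≤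
      ∑' j : ℕ, ENNReal.ofReal (2 ^ (j + 1) * ε) *
        (∑ k ∈ Finset.range (n + 2), S.tail X (2 ^ j * y₀ / 2 * cesaroScale α n k) +
        2 * ENNReal.ofReal (Real.exp 1 * (D ^ γ * (2 ^ j * y₀) ^ (-(p * γ)) *
          ((n : ℝ) + 1) ^ (-r)))) := by
    intro n hn
    refine (hS.expNonneg_le_tsum_capacity
      (S.posPart_sub_mem ε (S.maxCesaroSum_mem hXs α (n + 1))) (fun ω => le_max_right _ _)
      (S.measurable_of_mem _ (S.maxCesaroSum_mem hXs α (n + 1)))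
      (w := fun j => 2 ^ (j + 1) * ε) (s := fun j => 2 ^ j * ε) (fun j => by positivity)
      fun ω => ofReal_posPart_sub_le_tsum_two_pow hε _).trans ?_
    gcongr with j
    exact hlevel n hn j
  have hgeo2 : Summable fun j : ℕ => ((2 : ℝ) ^ (1 - r)) ^ j :=
    summable_geometric_of_lt_one (by positivity)
      (Real.rpow_lt_one_of_one_lt_of_neg (by norm_num) (by linarith))
  have hgeo3 : Summable fun j : ℕ => ((2 : ℝ) ^ (1 - p * γ)) ^ j :=
    summable_geometric_of_lt_one (by positivity)
      (Real.rpow_lt_one_of_one_lt_of_neg (by norm_num) (by linarith))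
  have e2 : ∀ (s : ℝ) (j : ℕ), (2 : ℝ) ^ j * ((2 : ℝ) ^ j) ^ (-s) = ((2 : ℝ) ^ (1 - s)) ^ j := by
    intro s j
    have h2j : (0 : ℝ) < 2 ^ j := by positivity
    have e3 : (2 : ℝ) ^ j * ((2 : ℝ) ^ j) ^ (-s) = ((2 : ℝ) ^ j) ^ (1 - s) := by
      rw [sub_eq_add_neg, Real.rpow_add h2j, Real.rpow_one]
    rw [e3, ← Real.rpow_natCast, ← Real.rpow_natCast, ← Real.rpow_mul (by norm_num),
      ← Real.rpow_mul (by norm_num), mul_comm]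
  -- large single terms: the gain `2 ^ (-j r)` over the level weight `2 ^ j` needs `r > 1`
  set Λ := max 1 (2 / y₀) with hΛ
  have hΛ1 : 1 ≤ Λ := le_max_left _ _
  set L := max (Λ ^ ((r - 1) / α)) (Λ ^ r * Λ) with hL
  have hL0 : 0 ≤ L := le_max_of_le_right (by positivity)
  have hsingle := S.tsum_tsum_indexWeight_mul_tail_lt_top h0 h1 hr.le hM
    (w := fun j => 2 ^ (j + 1) * ε) (g := fun j => ((2 : ℝ) ^ j) ^ (-r) * L)
    (c := fun j => 2 ^ j * y₀ / 2) (fun j => by positivity) (fun j => by positivity)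
    (fun j => by positivity) (fun j t ht => by
      have hl : (0 : ℝ) < 1 / 2 ^ j := by positivity
      have hl1 : (1 : ℝ) / 2 ^ j ≤ 1 := by
        rw [div_le_one (by positivity)]; exact one_le_pow₀ (by norm_num)
      have e3 : t / (2 ^ j * y₀ / 2) = 1 / 2 ^ j * (2 / y₀ * t) := by field_simp
      have e4 : ((1 : ℝ) / 2 ^ j) ^ r = ((2 : ℝ) ^ j) ^ (-r) := by
        rw [one_div, Real.inv_rpow (by positivity), Real.rpow_neg (by positivity)]
      have hmono := momentFun_monotoneOn h0 hr.le
      calc momentFun α r (t / (2 ^ j * y₀ / 2))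
          ≤ (1 / 2 ^ j) ^ r * momentFun α r (2 / y₀ * t) := by
            rw [e3]
            exact momentFun_mul_le_of_le_one h0 hr.le hl hl1 (by positivity)
        _ ≤ (1 / 2 ^ j) ^ r * momentFun α r (Λ * t) := by
            gcongr
            exact hmono (mem_Ici.2 (by positivity)) (mem_Ici.2 (by positivity))
              (mul_le_mul_of_nonneg_right (le_max_right _ _) ht)
        _ ≤ (1 / 2 ^ j) ^ r * (L * momentFun α r t) := by
            gcongr
            exact momentFun_mul_le_of_one_le α r hΛ1 ht
        _ = _ := by rw [e4]; ring)
    (by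
      refine (hgeo2.mul_left (2 * ε * L)).congr fun j => ?_
      rw [← e2]; ring)
  -- powers of the truncated variance: the double series factors
  have hvar : ∑' n : ℕ, ENNReal.ofReal (((n : ℝ) + 1) ^ (r - 2)) *
      ∑' j : ℕ, ENNReal.ofReal (2 ^ (j + 1) * ε) * (2 * ENNReal.ofReal (Real.exp 1 *
        (D ^ γ * (2 ^ j * y₀) ^ (-(p * γ)) * ((n : ℝ) + 1) ^ (-r)))) < ⊤ := by
    have hs : Summable fun n : ℕ => ((n : ℝ) + 1) ^ (-2 : ℝ) := by
      simpa using
        (summable_nat_add_iff 1).2 (Real.summable_nat_rpow.2 (show (-2 : ℝ) < -1 by norm_num))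
    set R := 4 * ε * Real.exp 1 * D ^ γ * y₀ ^ (-(p * γ)) with hR
    have hR0 : 0 ≤ R := by positivity
    have hterm : ∀ (n j : ℕ), ENNReal.ofReal (((n : ℝ) + 1) ^ (r - 2)) *
        (ENNReal.ofReal (2 ^ (j + 1) * ε) * (2 * ENNReal.ofReal (Real.exp 1 *
          (D ^ γ * (2 ^ j * y₀) ^ (-(p * γ)) * ((n : ℝ) + 1) ^ (-r))))) =
        ENNReal.ofReal (((n : ℝ) + 1) ^ (-2 : ℝ)) *
          ENNReal.ofReal (R * ((2 : ℝ) ^ (1 - p * γ)) ^ j) := by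
      intro n j
      have hn0 : (0 : ℝ) < (n : ℝ) + 1 := by positivity
      rw [show (2 : ℝ≥0∞) = ENNReal.ofReal 2 by simp, ← ENNReal.ofReal_mul (by positivity),
        ← ENNReal.ofReal_mul (by positivity), ← ENNReal.ofReal_mul (by positivity),
        ← ENNReal.ofReal_mul (by positivity)]
      congr 1
      rw [show (-2 : ℝ) = (r - 2) + -r by ring, Real.rpow_add hn0, ← e2,
        Real.mul_rpow (by positivity) hy₀0.le, hR]
      ring
    simp only [← ENNReal.tsum_mul_left, hterm]
    simp only [ENNReal.tsum_mul_left, ENNReal.tsum_mul_right]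
    rw [← ENNReal.ofReal_tsum_of_nonneg (fun n => by positivity) hs,
      ← ENNReal.ofReal_tsum_of_nonneg (fun j => by positivity) (hgeo3.mul_left R)]
    exact ENNReal.mul_lt_top ENNReal.ofReal_lt_top ENNReal.ofReal_lt_top
  refine tsum_lt_top_of_le_of_le (N := N) (g := fun n =>
    ENNReal.ofReal (((n : ℝ) + 1) ^ (r - 2)) * (∑' j : ℕ, ENNReal.ofReal (2 ^ (j + 1) * ε) *
      ∑ k ∈ Finset.range (n + 2), S.tail X (2 ^ j * y₀ / 2 * cesaroScale α n k)) +
    ENNReal.ofReal (((n : ℝ) + 1) ^ (r - 2)) *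
      ∑' j : ℕ, ENNReal.ofReal (2 ^ (j + 1) * ε) * (2 * ENNReal.ofReal (Real.exp 1 *
        (D ^ γ * (2 ^ j * y₀) ^ (-(p * γ)) * ((n : ℝ) + 1) ^ (-r))))) (fun n => ?_)
    (fun n hn => ?_) ?_
  · refine ENNReal.mul_lt_top ENNReal.ofReal_lt_top (lt_of_le_of_lt ?_
      (S.expNonneg_maxCesaroSum_lt_top hS h0 hX hXs hident hfin (n + 1)))
    refine S.expNonneg_mono (S.posPart_sub_mem ε (S.maxCesaroSum_mem hXs α _))
      (S.maxCesaroSum_mem hXs α _) fun ω => max_le (by linarith) (maxCesaroSum_nonneg _ _ _ _)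
  · rw [← mul_add, ← ENNReal.tsum_add]
    simp only [← mul_add]
    push_cast
    gcongr
    exact hlayer n hn
  · rw [ENNReal.tsum_add]
    refine ENNReal.add_lt_top.2 ⟨lt_of_eq_of_lt ?_ hsingle, hvar⟩
    simp only [tsum_indexWeight_mul, ← ENNReal.tsum_mul_left]
    rw [ENNReal.tsum_comm]
    refine tsum_congr fun j => tsum_congr fun n => ?_
    ring

end SublinearExpectationSpace

theorem theorem2 {Ω : Type*} [MeasurableSpace Ω] (S : SublinearExpectationSpace Ω)
    (hS : S.CountablySubadditive) (α r : ℝ) (hα0 : 0 < α) (hα1 : α ≤ 1) (hr : 1 ≤ r)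
    (X : Ω → ℝ) (hX : X ∈ S.H) (Xs : ℕ → Ω → ℝ) (hXs : ∀ i, Xs i ∈ S.H)
    (hindep : S.IndepSeq Xs) (hident : ∀ i, S.IdentDist (Xs i) X)
    (hmean : ∀ i, S.E (Xs i) = 0 ∧ -S.E (fun ω => -Xs i ω) = 0) :
    (S.MomentCondition α r X →
      (1 < r → S.CompleteMomentConvergence r (maxCesaroSum α Xs)) ∧
      S.CompleteConvergence r (maxCesaroSum α Xs)) ∧
    (S.CompleteMomentConvergence r (maxCesaroSum α Xs) → S.MomentCondition α r X) := by
  have hMmem := S.maxCesaroSum_mem hXs α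
  refine ⟨fun hM => ?_, fun h => S.momentCondition_of_completeConvergence hα0 hα1 hr hX hXs
    hindep hident (S.completeConvergence_of_completeMomentConvergence hMmem h)⟩
  rw [S.momentCondition_iff] at hM
  have hCM : 1 < r → S.CompleteMomentConvergence r (maxCesaroSum α Xs) := fun hr1 =>
    S.completeMomentConvergence_of_choquet hS hα0 hα1 hr1 hX hXs hindep hident hmean hM
  refine ⟨hCM, ?_⟩
  rcases hr.eq_or_lt with rfl | hr1
  · exact S.completeConvergence_one_of_choquet hS hα0 hα1 hX hXs hindep hident hmean hM
  · exact S.completeConvergence_of_completeMomentConvergence hMmem (hCM hr1)
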